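/- **Conventions.** All graphs are finite and simple. A *plane graph* is a planar graph together with a planar embedding and a distinguished outer face; an induced subgraph inherits the embedding, and with it the outer face. A vertex or edge is *outer* in a plane graph if it lies on the boundary of the outer face. Let $G$ be a connected plane graph. A *region* is a nonempty set $R\subseteq V(G)$ with $G[R]$ connected; the *support* $V(\mathcal R)$ of a set $\mathcal R$ of regions is the union of its members, and similarly $V(\mathcal C)=\bigcup\mathcal C$ for a set $\mathcal C$ of clusters (vertex sets). For $S\subseteq V(G)$, $\mathrm{Shatter}(\mathcal R,S)$ is the set of the vertex sets of all connected components of $G[R\setminus S]$ and of $G[R\cap S]$, over all $R\in\mathcal R$. The *contact graph* of $\mathcal R$ has vertex set $\mathcal R$; distinct $R_1,R_2$ are adjacent if there are $v_1\in R_1$, $v_2\in R_2$ that are equal or adjacent in $G$. Its distance is denoted by $\delta_{\mathcal R}$. All choices below that are called arbitrary may be made in any way. **SelectPaths.** Fix a connected plane induced subgraph $H_0$ of $G$. $\mathrm{SelectPaths}(H,W,\mathcal R)$ acts as follows and returns a set of regions and a set of supernodes. (1) If $W=\varnothing$ let $Y=\{y\}$ for an arbitrary outer vertex $y$ of $H_0$;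 otherwise let $Y$ be the set of the vertices of $H$ joined to a vertex of $W$ by an outer edge of $H_0$ (then $1\le|Y|\le2$). For each $y\in Y$ choose an arbitrary region $R_y\in\mathcal R$ containing $y$, and let the *spine* $\pi$ be an arbitrary shortest path in the contact graph of $\mathcal R$ between the regions $R_y$, $y \in Y$ (a single region if $|Y|=1$). (2) Let $N$ be the union of all $R\in\mathcal R$ with $\delta_{\mathcal R}(R,\pi)\le1$, let $\mathcal R'=\mathrm{Shatter}(\mathcal R,N)$, and let the *supernode* $S$, with spine $\pi$, consist of all regions of $\mathcal R'$ that meet $N$. (3) For each connected component $K$ of $H\setminus N$ let $\mathcal R_K$ be the set of regions of $\mathcal R'$ that meet $K$. If $K$ contains an outer vertex of $H_0$, call $\mathrm{SelectPaths}(K,N,\mathcal R_K)$; otherwise use $\mathcal R_K$ and no supernode as the result for $K$. (4) Return the union of (the regions of) $S$ and all region sets obtained in (3), and the set of supernodes consisting of $S$ and all supernodes obtained in (3). Supernodes are partially ordered by ancestry in the recursion tree. **Assign.** For a vertex $v$, a cluster $C$ and $X\subseteq V(G)$ with $G[X]$ connected and $C\cap X\ne\varnothing$, $\mathrm{Assign}(v,C,X)$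 takes an arbitrary path in $G[X]$ from $v$ to a vertex of $C$, and assigns all vertices of the path before its first assigned vertex $v'$ to the cluster of $v'$. **ClusterOuter.** Let $H$ be a connected plane induced subgraph of $G$ and $\mathcal R$ a set of regions with support $V(H)$. $\mathrm{ClusterOuter}(H,\mathcal R)$ acts as follows. (1) Compute $(\mathcal R^*,\mathcal S)=\mathrm{SelectPaths}(H,\varnothing,\mathcal R)$ with $H_0=H$. (2) Start with $S^+=S$ for every $S\in\mathcal S$; in an arbitrary order of $\mathcal S$, add to $S^+$ all regions of $\mathcal R^*$ that are adjacent, in the contact graph of $\mathcal R^*$, to a region of $S$ and do not already belong to $T^+$ for another $T\in\mathcal S$. Let the *net points* of $S$ be every 14th region along its spine, starting with the first. For a net point $P$ of $S$ let $B^{\rm small}_P=\{R\in S:\delta_S(P,R)\le4\}$ and $B^{\rm big}_P=\{R\in S^+:\delta_{S^+}(P,R)\le6\}$. (3) All vertices are unassigned at first. For each $S\in\mathcal S$, in an arbitrary order: create a cluster $C_P$ for each net point $P$ of $S$ and assign $V(B^{\rm small}_P)$ to it; then, while some $v\in V(S)$ is unassigned, call $\mathrm{Assign}(v,C_P,V(S))$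 for an arbitrary net point $P$ of $S$. (4) For each $S\in\mathcal S$, in an arbitrary order in which ancestors come first: for each net point $P$ of $S$, while some $v\in V(B^{\rm big}_P)$ is unassigned, call $\mathrm{Assign}(v,C_P,V(B^{\rm big}_P))$; then, while some $v\in V(S^+)$ is unassigned, call $\mathrm{Assign}(v,C_P,V(S^+))$ for an arbitrary net point $P$ of $S$. (5) Return the set of all clusters $C_P$. **Cluster.** $\mathrm{Cluster}(H,\mathcal R)$ computes $\mathcal C^*=\mathrm{ClusterOuter}(H,\mathcal R)$, puts $U=V(H)\setminus V(\mathcal C^*)$ and $\mathcal R^*=\mathrm{Shatter}(\mathcal R,U)$, calls $\mathrm{Cluster}(H_i,\mathcal R_i)$ for each connected component $H_i$ of $H[U]$, where $\mathcal R_i$ is the set of regions of $\mathcal R^*$ that meet $H_i$, and returns the union of $\mathcal C^*$ and all sets of clusters computed by these calls. Call $\beta\in\mathbb N$ a *scattering constant* if, for every connected plane graph $G$, every connected plane induced subgraph $H$ of $G$, every set $\mathcal R$ of regions with support $V(H)$, every possible output $\mathcal C$ of $\mathrm{ClusterOuter}(H,\mathcal R)$, every $R\in\mathcal R$ and all $v_a,v_b\in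 R$, there is a path in $G$ between $v_a$ and $v_b$ that is a concatenation of at most $\beta$ paths (consecutive ones linked by an edge), each of which either is contained in some cluster of $\mathcal C$ or consists of vertices of $R$ that belong to no cluster of $\mathcal C$. **Lemma.** There is an absolute constant $\beta\le3744$ which is a scattering constant and for which the following holds. Let $G$ be a connected plane graph and let $\mathcal R$ be a set of regions with support $V(G)$. Then the procedure $\mathrm{Cluster}(G,\mathcal R)$ has an output, and for every possible output $\mathcal C$, every region $R\in\mathcal R$ and all $v_s,v_t\in R$, there is a path in $G$ between $v_s$ and $v_t$ that intersects at most $\beta^2$ different clusters of $\mathcal C$. -/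

import Mathlib

universe u

namespace RegionClustering

/-! ## Plane graphs -/

/-- A plane embedding of a (connected) graph `G`, as a combinatorial map of genus zero with a
distinguished outer face.  `rot` sends a dart (an oriented edge) to the next dart around its tail.
Following a dart to its head and turning to the next dart there walks along the boundary of a
face, so the faces are the orbits of `d ↦ rot d.symm`, and planarity is Euler's formula.  A graph
without edges has no dart and nothing to specify. -/
structure PlaneEmbedding {V : Type u} (G : SimpleGraph V) where
  rot : Equiv.Perm G.Dart
  /-- `rot` permutes the darts leaving each vertex in one cycle. -/
  rot_sameCycle : ∀ d e : G.Dart, rot.SameCycle d e ↔ d.fst = e.fst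
  /-- The darts on the boundary of the outer face. -/
  outer : Set G.Dart
  /-- Euler's formula: `#vertices + #faces = #edges + 2`. -/
  euler : Nonempty G.Dart →
    Nat.card V +
      Nat.card (Quotient (Equiv.Perm.SameCycle.setoid
        ((SimpleGraph.Dart.symm_involutive (G := G)).toPerm.trans rot))) =
      Nat.card G.edgeSet + 2
  /-- The outer face is one of the faces. -/
  outer_face : Nonempty G.Dart → ∃ d : G.Dart, outer =
    {e | Equiv.Perm.SameCycle ((SimpleGraph.Dart.symm_involutive (G := G)).toPerm.trans rot) d e}

namespace PlaneEmbedding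

variable {V : Type u} {G : SimpleGraph V}

/-- `E.Outside X d`: the face of `G` on the boundary of which the dart `d` lies is part of the
outer face of the induced plane subgraph `G[X]`.  Deleting an edge merges the two faces on its
sides, so the outer face of `G[X]` is made of the faces of `G` that can be reached from the outer
face of `G` by crossing edges that are not edges of `G[X]`. -/
inductive Outside (E : PlaneEmbedding G) (X : Set V) : G.Dart → Prop
  | outer (d : G.Dart) (hd : d ∈ E.outer) : Outside E X d
  | face (d : G.Dart) (hd : Outside E X d) : Outside E X (E.rot d.symm)
  | cross (d : G.Dart) (hd : Outside E X d) (hX : ¬ (d.fst ∈ X ∧ d.snd ∈ X)) :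
      Outside E X d.symm

/-- `v` is a vertex on the outer face of `G[X]` (with the embedding inherited from `G`).
The last clause concerns only the graph with one vertex, when `G` is connected. -/
def IsOuterVertex (E : PlaneEmbedding G) (X : Set V) (v : V) : Prop :=
  v ∈ X ∧ ((∃ d : G.Dart, d.fst = v ∧ E.Outside X d) ∨ ∀ d : G.Dart, d.fst ≠ v)

/-- `x y` is an edge of `G[X]` on the outer face of `G[X]`. -/
def IsOuterEdge (E : PlaneEmbedding G) (X : Set V) (x y : V) : Prop :=
  x ∈ X ∧ y ∈ X ∧ ∃ d : G.Dart, d.fst = x ∧ d.snd = y ∧ (E.Outside X d ∨ E.Outside X d.symm)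

end PlaneEmbedding

/-! ## Regions, shattering, contact graph -/

section Regions

variable {V : Type u}

/-- A region: a connected (in particular nonempty) set of vertices. -/
def IsRegion (G : SimpleGraph V) (R : Set V) : Prop := (G.induce R).Connected

/-- `𝓡` is a set of regions with support `X`. -/
def IsRegionSet (G : SimpleGraph V) (X : Set V) (𝓡 : Set (Set V)) : Prop :=
  (∀ R ∈ 𝓡, IsRegion G R) ∧ ⋃₀ 𝓡 = X

/-- The vertex sets of the connected components of `G[A]`. -/
def components (G : SimpleGraph V) (A : Set V) : Set (Set V) :=
  {C | ∃ c : (G.induce A).ConnectedComponent, C = Subtype.val '' c.supp}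

/-- Shattering all the regions of `𝓡` by the boundary of `S`. -/
def shatter (G : SimpleGraph V) (𝓡 : Set (Set V)) (S : Set V) : Set (Set V) :=
  {C | ∃ R ∈ 𝓡, C ∈ components G (R \ S) ∪ components G (R ∩ S)}

/-- The members of `𝓡` that intersect `K`. -/
def meeting (𝓡 : Set (Set V)) (K : Set V) : Set (Set V) := {R | R ∈ 𝓡 ∧ (R ∩ K).Nonempty}

/-- The region contact graph of `𝓡`.  Its vertices are the members of `𝓡`; the other sets of
vertices are kept as isolated points, which never matter. -/
def contactGraph (G : SimpleGraph V) (𝓡 : Set (Set V)) : SimpleGraph (Set V) where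
  Adj A B := A ≠ B ∧ A ∈ 𝓡 ∧ B ∈ 𝓡 ∧ ∃ a ∈ A, ∃ b ∈ B, a = b ∨ G.Adj a b
  symm := ⟨by
    rintro A B ⟨hne, hA, hB, a, ha, b, hb, h⟩
    exact ⟨hne.symm, hB, hA, b, hb, a, ha, h.imp Eq.symm SimpleGraph.Adj.symm⟩⟩
  loopless := ⟨fun _ h => h.1 rfl⟩

end Regions

/-! ## The procedure `SelectPaths` -/

/-- A supernode: a set of regions together with its spine, listed in order. -/
@[ext] structure Supernode (V : Type u) where
  regions : Set (Set V)
  spine : List (Set V)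

section Procedures

variable {V : Type u}

/-- The vertex set of a supernode. -/
def Supernode.verts (S : Supernode V) : Set V := ⋃₀ S.regions

/-- `Y` is the set of critical vertices of `H` with respect to `W` in the plane graph `G[X]`.  At
the start, when `W = ∅` and `H = X`, it consists of an arbitrary outer vertex. -/
def IsCriticalSet {G : SimpleGraph V} (E : PlaneEmbedding G) (X H W Y : Set V) : Prop :=
  (W = ∅ ∧ ∃ y, E.IsOuterVertex X y ∧ Y = {y}) ∨
  (W ≠ ∅ ∧ Y = {y | y ∈ H ∧ ∃ w ∈ W, E.IsOuterEdge X y w})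

/-- `π` lists a shortest path in the contact graph of `𝓡` between regions chosen to contain the
one or two critical vertices in `Y` (one and the same region if there is only one). -/
def IsSpine (G : SimpleGraph V) (𝓡 : Set (Set V)) (Y : Set V) (π : List (Set V)) : Prop :=
  ∃ (y₁ y₂ : V) (r : V → Set V), Y = {y₁, y₂} ∧
    (∀ y ∈ Y, r y ∈ 𝓡 ∧ y ∈ r y) ∧
    ∃ p : (contactGraph G 𝓡).Walk (r y₁) (r y₂),
      (∀ q : (contactGraph G 𝓡).Walk (r y₁) (r y₂), p.length ≤ q.length) ∧ π = p.support

/-- The regions of `𝓡` at distance at most one from `π` in the contact graph of `𝓡`. -/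
def nearSpine (G : SimpleGraph V) (𝓡 : Set (Set V)) (π : List (Set V)) : Set (Set V) :=
  {R | R ∈ 𝓡 ∧ ∃ P ∈ π, (contactGraph G 𝓡).edist R P ≤ 1}

/-- The supernode with spine `π` carved out of `𝓡`: the regions that intersect the neighborhood
of `π`, after shattering by (the boundary of) that neighborhood. -/
def carve (G : SimpleGraph V) (𝓡 : Set (Set V)) (π : List (Set V)) : Supernode V where
  regions := meeting (shatter G 𝓡 (⋃₀ nearSpine G 𝓡 π)) (⋃₀ nearSpine G 𝓡 π)
  spine := π

/-- `SelectPaths E X H W 𝓡 out 𝓢 anc`: in the plane graph `G[X]`, a run of the procedure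
`SelectPaths` on the subgraph `G[H]`, the previous set `W` and the set of regions `𝓡` can return
the set of regions `out` and the set of supernodes `𝓢`; `anc S T` says that the supernode `S` was
created by a proper ancestor, in the recursion tree, of the call that created `T`. -/
inductive SelectPaths {G : SimpleGraph V} (E : PlaneEmbedding G) (X : Set V) :
    Set V → Set V → Set (Set V) → Set (Set V) → Set (Supernode V) →
      (Supernode V → Supernode V → Prop) → Prop
  | run (H W : Set V) (𝓡 : Set (Set V)) (Y : Set V) (π : List (Set V))
      (S : Supernode V) (𝓡' : Set (Set V))
      (out : Set V → Set (Set V)) (𝓢 : Set V → Set (Supernode V))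
      (anc : Set V → Supernode V → Supernode V → Prop)
      (hY : IsCriticalSet E X H W Y)
      (hπ : IsSpine G 𝓡 Y π)
      (hS : S = carve G 𝓡 π)
      (h𝓡' : 𝓡' = shatter G 𝓡 (⋃₀ nearSpine G 𝓡 π))
      (hrec : ∀ K ∈ components G (H \ S.verts), (∃ v ∈ K, E.IsOuterVertex X v) →
        SelectPaths E X K S.verts (meeting 𝓡' K) (out K) (𝓢 K) (anc K))
      (hleaf : ∀ K ∈ components G (H \ S.verts), (¬ ∃ v ∈ K, E.IsOuterVertex X v) →
        out K = meeting 𝓡' K ∧ 𝓢 K = ∅ ∧ ∀ A B, ¬ anc K A B) :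
      SelectPaths E X H W 𝓡
        (S.regions ∪ ⋃ K ∈ components G (H \ S.verts), out K)
        ({S} ∪ ⋃ K ∈ components G (H \ S.verts), 𝓢 K)
        (fun A B => (A = S ∧ ∃ K ∈ components G (H \ S.verts), B ∈ 𝓢 K) ∨
          ∃ K ∈ components G (H \ S.verts), anc K A B)

/-! ## The procedure `ClusterOuter` -/

/-- Every 14th region along the spine, starting with the first one. -/
def Supernode.netPoints (S : Supernode V) : List (Set V) :=
  (List.range S.spine.length).filterMap (fun i => S.spine[14 * i]?)

/-- The small ball around a net point `P` of `S`. -/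
def smallBall (G : SimpleGraph V) (S : Supernode V) (P : Set V) : Set (Set V) :=
  {R | R ∈ S.regions ∧ (contactGraph G S.regions).edist P R ≤ 4}

/-- The big ball around a net point `P` of a supernode with expansion `Sp`. -/
def bigBall (G : SimpleGraph V) (Sp : Set (Set V)) (P : Set V) : Set (Set V) :=
  {R | R ∈ Sp ∧ (contactGraph G Sp).edist P R ≤ 6}

open Classical in
/-- One step of the expansion: add to the current set of `S` the regions of `𝓡s` adjacent to a
region of `S` and not in the current set of another supernode. -/
noncomputable def expandStep (G : SimpleGraph V) (𝓡s : Set (Set V)) (𝓢 : Set (Supernode V))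
    (f : Supernode V → Set (Set V)) (S : Supernode V) : Supernode V → Set (Set V) :=
  fun T => if T = S then
      f S ∪ {R | R ∈ 𝓡s ∧ (∃ Q ∈ S.regions, (contactGraph G 𝓡s).Adj R Q) ∧
        ∀ S' ∈ 𝓢, S' ≠ S → R ∉ f S'}
    else f T

/-- The expansions of all supernodes, computed in the given order. -/
noncomputable def expansion (G : SimpleGraph V) (𝓡s : Set (Set V)) (𝓢 : Set (Supernode V))
    (order : List (Supernode V)) : Supernode V → Set (Set V) :=
  order.foldl (expandStep G 𝓡s 𝓢) Supernode.regions

/-- `order` lists each member of `𝓢` exactly once. -/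
def IsEnumeration (𝓢 : Set (Supernode V)) (order : List (Supernode V)) : Prop :=
  order.Nodup ∧ ∀ S, S ∈ order ↔ S ∈ 𝓢

/-- A partial assignment of vertices to clusters; a cluster is named by its net point. -/
abbrev Assignment (V : Type u) := V → Option (Set V)

/-- `Assign G X P v σ σ'`: a call of `Assign` for the vertex `v`, the cluster of the net point `P`
and the vertex set `X` can turn the assignment `σ` into `σ'`.  Here `p` followed by `q` is the
chosen path in `G[X]` from `v` to a vertex `w` of the cluster, and `z` is its first assigned
vertex. -/
def Assign (G : SimpleGraph V) (X : Set V) (P : Set V) (v : V) (σ σ' : Assignment V) : Prop :=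
  ∃ (z w : V) (p : G.Walk v z) (q : G.Walk z w) (L : Set V),
    (p.append q).IsPath ∧ (∀ x ∈ (p.append q).support, x ∈ X) ∧ σ w = some P ∧
    (∀ x ∈ p.support, x ≠ z → σ x = none) ∧ σ z = some L ∧
    (∀ x ∈ p.support, x ≠ z → σ' x = some L) ∧
    (∀ x, x ∉ p.support ∨ x = z → σ' x = σ x)

/-- The loop: while some vertex `v` of `X` is unassigned, choose a net point `P` among `nets` and
call `Assign` for `v`, `P`, `X`. -/
inductive AssignLoop (G : SimpleGraph V) (X : Set V) (nets : List (Set V)) :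
    Assignment V → Assignment V → Prop
  | done (σ : Assignment V) (h : ∀ v ∈ X, σ v ≠ none) : AssignLoop G X nets σ σ
  | step (σ σ₁ σ₂ : Assignment V) (v : V) (P : Set V) (hv : v ∈ X) (hσ : σ v = none)
      (hP : P ∈ nets) (h₁ : Assign G X P v σ σ₁) (h₂ : AssignLoop G X nets σ₁ σ₂) :
      AssignLoop G X nets σ σ₂

/-- Running a nondeterministic step once for each entry of a list, in order. -/
inductive ForLoop {α : Type u} (body : α → Assignment V → Assignment V → Prop) :
    List α → Assignment V → Assignment V → Prop
  | nil (σ : Assignment V) : ForLoop body [] σ σ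
  | cons (a : α) (l : List α) (σ σ₁ σ₂ : Assignment V) (h₁ : body a σ σ₁)
      (h₂ : ForLoop body l σ₁ σ₂) : ForLoop body (a :: l) σ σ₂

open Classical in
/-- Create the clusters of the net points of `S` and assign the small balls to them. -/
noncomputable def assignSmallBalls (G : SimpleGraph V) (S : Supernode V) (σ : Assignment V) :
    Assignment V :=
  S.netPoints.foldl
    (fun τ P v => if v ∈ ⋃₀ smallBall G S P then some P else τ v) σ

/-- Assigning the vertices of the supernode `S`. -/
def assignSupernode (G : SimpleGraph V) (S : Supernode V) (σ σ' : Assignment V) : Prop :=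
  AssignLoop G S.verts S.netPoints (assignSmallBalls G S σ) σ'

/-- Assigning the vertices of the expansion `Sp` of the supernode `S`: first the big balls around
the net points, one after the other, then the rest. -/
def assignExpansion (G : SimpleGraph V) (Sp : Set (Set V)) (S : Supernode V)
    (σ σ' : Assignment V) : Prop :=
  ∃ (nets : List (Set V)) (τ : Assignment V), nets.Perm S.netPoints ∧
    ForLoop (fun P => AssignLoop G (⋃₀ bigBall G Sp P) [P]) nets σ τ ∧
    AssignLoop G (⋃₀ Sp) S.netPoints τ σ'

/-- `ClusterOuter E X 𝓡 𝓒`: the set of clusters `𝓒` is a possible output of the procedure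
`ClusterOuter` on the plane graph `G[X]` and the set of regions `𝓡`. -/
def ClusterOuter {G : SimpleGraph V} (E : PlaneEmbedding G) (X : Set V) (𝓡 : Set (Set V))
    (𝓒 : Set (Set V)) : Prop :=
  ∃ (𝓡s : Set (Set V)) (𝓢 : Set (Supernode V)) (anc : Supernode V → Supernode V → Prop)
    (order₂ order₃ order₄ : List (Supernode V)) (σ₃ σ₄ : Assignment V),
    SelectPaths E X X ∅ 𝓡 𝓡s 𝓢 anc ∧
    IsEnumeration 𝓢 order₂ ∧ IsEnumeration 𝓢 order₃ ∧ IsEnumeration 𝓢 order₄ ∧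
    order₄.Pairwise (fun A B => ¬ anc B A) ∧
    ForLoop (assignSupernode G) order₃ (fun _ => none) σ₃ ∧
    ForLoop (fun S => assignExpansion G (expansion G 𝓡s 𝓢 order₂ S) S) order₄ σ₃ σ₄ ∧
    𝓒 = {C | ∃ S ∈ 𝓢, ∃ P ∈ S.netPoints, C = {v | σ₄ v = some P}}

/-! ## The procedure `Cluster` -/

/-- `Cluster E X 𝓡 𝓒`: the set of clusters `𝓒` is a possible output of the recursive procedure
`Cluster` on the plane graph `G[X]` and the set of regions `𝓡`. -/
inductive Cluster {G : SimpleGraph V} (E : PlaneEmbedding G) :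
    Set V → Set (Set V) → Set (Set V) → Prop
  | run (X : Set V) (𝓡 𝓒s : Set (Set V)) (U : Set V) (𝓒 : Set V → Set (Set V))
      (houter : ClusterOuter E X 𝓡 𝓒s)
      (hU : U = X \ ⋃₀ 𝓒s)
      (hrec : ∀ K ∈ components G U, Cluster E K (meeting (shatter G 𝓡 U) K) (𝓒 K)) :
      Cluster E X 𝓡 (𝓒s ∪ ⋃ K ∈ components G U, 𝓒 K)

end Procedures

/-- `β` is a scattering constant of the procedure `ClusterOuter`: in every output, any two
vertices of a region `R` are joined by a path that is the concatenation of at most `β` subpaths,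
each of which lies in one cluster or consists of unassigned vertices of `R`.  The subpaths are
given by their lists of vertices. -/
def IsScatteringConstant (β : ℕ) : Prop :=
  ∀ (V : Type u) [Finite V] (G : SimpleGraph V) (E : PlaneEmbedding G) (X : Set V)
    (𝓡 𝓒 : Set (Set V)),
    G.Connected → (G.induce X).Connected → IsRegionSet G X 𝓡 → ClusterOuter E X 𝓡 𝓒 →
    ∀ R ∈ 𝓡, ∀ a ∈ R, ∀ b ∈ R, ∃ (Γ : G.Walk a b) (pieces : List (List V)),
      Γ.IsPath ∧ Γ.support = pieces.flatten ∧ pieces.length ≤ β ∧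
      ∀ L ∈ pieces, (∃ C ∈ 𝓒, ∀ x ∈ L, x ∈ C) ∨ (∀ x ∈ L, x ∈ R ∧ x ∉ ⋃₀ 𝓒)

end RegionClustering

namespace RegionClustering

/-! ## Connected vertex sets and components -/

section Linked

variable {V : Type u} {G : SimpleGraph V} {A B C K : Set V} {u v w x y : V}

/-- `u` and `v` are joined by a walk inside `A`. -/
def Linked (G : SimpleGraph V) (A : Set V) (u v : V) : Prop :=
  ∃ p : G.Walk u v, ∀ x ∈ p.support, x ∈ A

theorem Linked.refl (hu : u ∈ A) : Linked G A u u := ⟨.nil, by simpa using hu⟩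

theorem Linked.left_mem (h : Linked G A u v) : u ∈ A := by
  obtain ⟨p, hp⟩ := h
  exact hp _ p.start_mem_support

theorem Linked.right_mem (h : Linked G A u v) : v ∈ A := by
  obtain ⟨p, hp⟩ := h
  exact hp _ p.end_mem_support

theorem Linked.symm (h : Linked G A u v) : Linked G A v u := by
  obtain ⟨p, hp⟩ := h
  exact ⟨p.reverse, by simpa using hp⟩

theorem Linked.trans (h : Linked G A u v) (h' : Linked G A v w) : Linked G A u w := by
  obtain ⟨p, hp⟩ := h
  obtain ⟨q, hq⟩ := h'
  refine ⟨p.append q, fun x hx => ?_⟩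
  rcases SimpleGraph.Walk.mem_support_append_iff .. |>.1 hx with h | h
  exacts [hp x h, hq x h]

theorem Linked.mono (hAB : A ⊆ B) (h : Linked G A u v) : Linked G B u v := by
  obtain ⟨p, hp⟩ := h
  exact ⟨p, fun x hx => hAB (hp x hx)⟩

theorem Linked.of_adj (hu : u ∈ A) (hv : v ∈ A) (h : G.Adj u v) : Linked G A u v :=
  ⟨h.toWalk, by simp [hu, hv]⟩

/-- Induction along a walk in its most used form: a property that passes along the edges inside `A`
spreads over everything linked to `u`. -/
theorem Linked.mem_of_closed (h : Linked G A u v) (hu : u ∈ B)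
    (hB : ∀ x ∈ B, x ∈ A → ∀ y ∈ A, G.Adj x y → y ∈ B) : v ∈ B := by
  obtain ⟨p, hp⟩ := h
  induction p with
  | nil => exact hu
  | cons hadj p ih =>
    simp only [SimpleGraph.Walk.support_cons, List.mem_cons, forall_eq_or_imp] at hp
    exact ih (hB _ hu hp.1 _ (hp.2 _ p.start_mem_support) hadj) hp.2

theorem Linked.exists_exit (h : Linked G A u v) (hu : u ∈ B) (hv : v ∉ B) :
    ∃ x ∈ A, x ∈ B ∧ ∃ y ∈ A, y ∉ B ∧ G.Adj x y := by
  by_contra! hcon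
  exact hv (h.mem_of_closed hu fun x hx hxA y hy hadj => by
    by_contra hyB
    exact hcon x hxA hx y hy hyB hadj)

/-- The walk can be taken inside any subset of `A` that contains `u` and is closed in `A`. -/
theorem Linked.restrict (h : Linked G A u v) (hu : u ∈ B)
    (hB : ∀ x ∈ B, ∀ y ∈ A, G.Adj x y → y ∈ B) : Linked G B u v := by
  have : v ∈ {z | Linked G B u z} := h.mem_of_closed (Linked.refl hu) fun x hx _ y hy hadj =>
    hx.trans (Linked.of_adj hx.right_mem (hB x hx.right_mem y hy hadj) hadj)
  exact this

theorem linked_iff_reachable (hu : u ∈ A) (hv : v ∈ A) :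
    Linked G A u v ↔ (G.induce A).Reachable ⟨u, hu⟩ ⟨v, hv⟩ := by
  constructor
  · rintro ⟨p, hp⟩
    exact ⟨p.induce A hp⟩
  · rintro ⟨p⟩
    refine ⟨p.map (SimpleGraph.Embedding.induce A).toHom, fun x hx => ?_⟩
    have hx' := (SimpleGraph.Walk.support_map (SimpleGraph.Embedding.induce A).toHom p) ▸ hx
    obtain ⟨y, -, rfl⟩ := List.mem_map.1 hx'
    exact y.2

theorem isRegion_iff :
    IsRegion G A ↔ A.Nonempty ∧ ∀ u ∈ A, ∀ v ∈ A, Linked G A u v := by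
  unfold IsRegion
  rw [SimpleGraph.connected_iff]
  constructor
  · rintro ⟨h, ⟨x⟩⟩
    exact ⟨⟨x, x.2⟩, fun u hu v hv => (linked_iff_reachable hu hv).2 (h ⟨u, hu⟩ ⟨v, hv⟩)⟩
  · rintro ⟨⟨x, hx⟩, h⟩
    exact ⟨fun a b => (linked_iff_reachable a.2 b.2).1 (h a a.2 b b.2), ⟨⟨x, hx⟩⟩⟩

theorem IsRegion.nonempty (h : IsRegion G A) : A.Nonempty := (isRegion_iff.1 h).1

theorem IsRegion.linked (h : IsRegion G A) (hu : u ∈ A) (hv : v ∈ A) : Linked G A u v :=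
  (isRegion_iff.1 h).2 u hu v hv

theorem isRegion_of_center (hu : u ∈ A) (h : ∀ v ∈ A, Linked G A u v) : IsRegion G A :=
  isRegion_iff.2 ⟨⟨u, hu⟩, fun v hv w hw => (h v hv).symm.trans (h w hw)⟩

theorem isRegion_linkedSet (hu : u ∈ A) : IsRegion G {x | Linked G A u x} :=
  isRegion_of_center (Linked.refl hu) fun _ (hv : Linked G A u _) =>
    hv.restrict (Linked.refl hu) fun _ hx _ hy hadj =>
      Linked.trans hx (Linked.of_adj (Linked.right_mem hx) hy hadj)

theorem IsRegion.union (hA : IsRegion G A) (hB : IsRegion G B) (hx : x ∈ A) (hy : y ∈ B)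
    (h : x = y ∨ G.Adj x y) : IsRegion G (A ∪ B) := by
  refine isRegion_of_center (u := x) (Or.inl hx) fun v hv => ?_
  have hxy : Linked G (A ∪ B) x y := by
    rcases h with rfl | h
    · exact Linked.refl (Or.inl hx)
    · exact Linked.of_adj (Or.inl hx) (Or.inr hy) h
  rcases hv with hv | hv
  · exact (hA.linked hx hv).mono Set.subset_union_left
  · exact hxy.trans ((hB.linked hy hv).mono Set.subset_union_right)

/-- Trades connected components on a subtype for classes of `Linked` on `V`, so that components of
different subgraphs can be compared directly. -/
theorem mem_components_iff :
    C ∈ components G A ↔ ∃ u ∈ A, C = {x | Linked G A u x} := by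
  have key : ∀ (u : V) (hu : u ∈ A), Subtype.val ''
      ((G.induce A).connectedComponentMk ⟨u, hu⟩).supp = {x | Linked G A u x} := by
    intro u hu
    ext x
    simp only [Set.mem_image, SimpleGraph.ConnectedComponent.mem_supp_iff, Subtype.exists,
      SimpleGraph.ConnectedComponent.eq, exists_and_right, exists_eq_right, Set.mem_ofPred_eq]
    constructor
    · rintro ⟨hx, h⟩
      exact ((linked_iff_reachable hx hu).2 h).symm
    · intro h
      exact ⟨h.right_mem, (linked_iff_reachable h.right_mem hu).1 h.symm⟩
  constructor
  · rintro ⟨c, rfl⟩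
    induction c using SimpleGraph.ConnectedComponent.ind with
    | h v => exact ⟨v, v.2, key v v.2⟩
  · rintro ⟨u, hu, rfl⟩
    exact ⟨_, (key u hu).symm⟩

theorem linkedSet_mem_components (hu : u ∈ A) : {x | Linked G A u x} ∈ components G A :=
  mem_components_iff.2 ⟨u, hu, rfl⟩

theorem exists_component (hu : u ∈ A) : ∃ C ∈ components G A, u ∈ C :=
  ⟨_, linkedSet_mem_components hu, Linked.refl hu⟩

theorem component_subset (hC : C ∈ components G A) : C ⊆ A := by
  obtain ⟨u, hu, rfl⟩ := mem_components_iff.1 hC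
  exact fun x hx => Linked.right_mem hx

theorem component_isRegion (hC : C ∈ components G A) : IsRegion G C := by
  obtain ⟨u, hu, rfl⟩ := mem_components_iff.1 hC
  exact isRegion_linkedSet hu

theorem component_linked (hC : C ∈ components G A) (hx : x ∈ C) (h : Linked G A x y) :
    y ∈ C := by
  obtain ⟨u, hu, rfl⟩ := mem_components_iff.1 hC
  exact Linked.trans hx h

theorem component_closed (hC : C ∈ components G A) (hx : x ∈ C) (hy : y ∈ A)
    (h : G.Adj x y) : y ∈ C :=
  component_linked hC hx (Linked.of_adj (component_subset hC hx) hy h)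

theorem IsRegion.subset_component (hB : IsRegion G B) (hBA : B ⊆ A) (hC : C ∈ components G A)
    (hx : x ∈ B) (hxC : x ∈ C) : B ⊆ C := fun _ hy =>
  component_linked hC hxC ((hB.linked hx hy).mono hBA)

theorem IsRegion.exists_component (hB : IsRegion G B) (hBA : B ⊆ A) :
    ∃ C ∈ components G A, B ⊆ C := by
  obtain ⟨x, hx⟩ := hB.nonempty
  obtain ⟨C, hC, hxC⟩ := RegionClustering.exists_component (G := G) (hBA hx)
  exact ⟨C, hC, hB.subset_component hBA hC hx hxC⟩

theorem component_eq (hB : B ∈ components G A) (hC : C ∈ components G A) (hx : x ∈ B)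
    (hxC : x ∈ C) : B = C :=
  Set.Subset.antisymm
    ((component_isRegion hB).subset_component (component_subset hB) hC hx hxC)
    ((component_isRegion hC).subset_component (component_subset hC) hB hxC hx)

theorem component_disjoint (hB : B ∈ components G A) (hC : C ∈ components G A) (h : B ≠ C) :
    Disjoint B C :=
  Set.disjoint_left.2 fun _ hx hxC => h (component_eq hB hC hx hxC)

theorem IsRegion.mem_components (hA : IsRegion G A) : A ∈ components G A := by
  obtain ⟨u, hu⟩ := hA.nonempty
  refine mem_components_iff.2 ⟨u, hu, ?_⟩
  ext x
  exact ⟨fun hx => hA.linked hu hx, fun hx => Linked.right_mem hx⟩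

/-- A connected set that meets `B` but does not lie in `B` : every component of the part outside
`B` has a neighbour in `B`. -/
theorem IsRegion.component_diff_exit (hA : IsRegion G A) (hC : C ∈ components G (A \ B))
    (hne : (A ∩ B).Nonempty) : ∃ x ∈ C, ∃ y ∈ A ∩ B, G.Adj x y := by
  obtain ⟨x, hx⟩ := (component_isRegion hC).nonempty
  obtain ⟨z, hzA, hzB⟩ := hne
  have hzC : z ∉ C := fun h => (component_subset hC h).2 hzB
  obtain ⟨a, haA, haC, b, hbA, hbC, hadj⟩ :=
    (hA.linked (component_subset hC hx).1 hzA).exists_exit hx hzC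
  refine ⟨a, haC, b, ⟨hbA, ?_⟩, hadj⟩
  by_contra hbB
  exact hbC (component_closed hC haC ⟨hbA, hbB⟩ hadj)

theorem isRegion_univ (hG : G.Connected) : IsRegion G Set.univ := by
  obtain ⟨v⟩ := hG.nonempty
  refine isRegion_of_center (u := v) trivial fun w _ => ?_
  obtain ⟨p⟩ := hG.preconnected v w
  exact ⟨p, fun _ _ => trivial⟩

end Linked

end RegionClustering

/-! ### Hodge decomposition for a connected plane graph -/

namespace RegionClustering

namespace PlaneEmbedding

open Finset

variable {V : Type u} {G : SimpleGraph V} (E : PlaneEmbedding G)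

theorem symm_fst (d : G.Dart) : d.symm.fst = d.snd := rfl

theorem symm_snd (d : G.Dart) : d.symm.snd = d.fst := rfl

/-- The permutation of the darts that walks along the boundaries of the faces. -/
def facePerm : Equiv.Perm G.Dart :=
  (SimpleGraph.Dart.symm_involutive (G := G)).toPerm.trans E.rot

theorem facePerm_apply (d : G.Dart) : E.facePerm d = E.rot d.symm := rfl

theorem rot_fst (d : G.Dart) : (E.rot d).fst = d.fst :=
  ((E.rot_sameCycle d (E.rot d)).1 ((Equiv.Perm.sameCycle_apply_right).2 .rfl)).symm

theorem facePerm_fst (d : G.Dart) : (E.facePerm d).fst = d.snd := E.rot_fst d.symm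

theorem sameCycle_eq {α β : Type*} {f : Equiv.Perm α} {g : α → β} (hg : ∀ a, g (f a) = g a)
    {a b : α} (h : f.SameCycle a b) : g a = g b := by
  obtain ⟨n, rfl⟩ := h
  have hinv : ∀ a, g (f⁻¹ a) = g a := fun a => by simpa using (hg (f⁻¹ a)).symm
  induction n with
  | zero => rfl
  | succ n ih => rw [add_comm, zpow_add, zpow_one, Equiv.Perm.mul_apply, hg]; exact ih
  | pred n ih =>
    rw [sub_eq_neg_add, zpow_add, zpow_neg_one, Equiv.Perm.mul_apply, hinv]; exact ih

/-- Rotations and reversals act transitively on the darts of a connected graph. -/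
theorem dart_const (hG : G.Connected) {β : Type*} {g : G.Dart → β}
    (hrot : ∀ d, g (E.rot d) = g d) (hsymm : ∀ d, g d.symm = g d) (d e : G.Dart) :
    g d = g e := by
  have hfst : ∀ d e : G.Dart, d.fst = e.fst → g d = g e := fun d e h =>
    sameCycle_eq hrot ((E.rot_sameCycle d e).2 h)
  obtain ⟨p⟩ := hG.preconnected d.fst e.fst
  have key : ∀ (u v : V) (_ : G.Walk u v) (d e : G.Dart), d.fst = u → e.fst = v → g d = g e := by
    intro u v p
    induction p with
    | nil => rintro d e rfl h; exact hfst d e h.symm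
    | @cons a b c hadj p ih =>
      intro d e hd he
      rw [hfst d ⟨(a, b), hadj⟩ hd, ← hsymm]
      exact ih _ _ rfl he
  exact key _ _ p d e rfl rfl

/-- The total flux through a face vanishes. -/
theorem flux [Fintype G.Dart] {g : G.Dart → ℝ} (hg : ∀ d, g (E.facePerm d) = g d) (f : V → ℝ) :
    ∑ d : G.Dart, g d * f d.snd = ∑ d : G.Dart, g d * f d.fst := by
  rw [← Equiv.sum_comp E.facePerm (fun d => g d * f d.fst)]
  exact sum_congr rfl fun d _ => by rw [hg, E.facePerm_fst]

theorem sum_symm [Fintype G.Dart] (f : G.Dart → ℝ) : ∑ d : G.Dart, f d.symm = ∑ d, f d :=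
  Equiv.sum_comp (SimpleGraph.Dart.symm_involutive (G := G)).toPerm f

/-- Differences of vertex potentials are orthogonal to differences of face potentials. -/
theorem orthogonal [Fintype G.Dart] {φ : G.Dart → ℝ} (hφ : ∀ d, φ (E.facePerm d) = φ d)
    (f : V → ℝ) : ∑ d : G.Dart, (f d.snd - f d.fst) * (φ d - φ d.symm) = 0 := by
  have h1 : ∑ d : G.Dart, (f d.snd - f d.fst) * φ d = 0 := by
    have := E.flux hφ f
    simp only [sub_mul, sum_sub_distrib, mul_comm (f _)]
    linarith
  have h2 : ∑ d : G.Dart, (f d.snd - f d.fst) * φ d.symm = 0 := by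
    rw [← sum_symm, ← neg_eq_zero, ← sum_neg_distrib, ← h1]
    refine sum_congr rfl fun d _ => ?_
    rw [SimpleGraph.Dart.symm_symm, symm_fst, symm_snd]
    ring
  simp only [mul_sub, sum_sub_distrib, h1, h2, sub_zero]

theorem mk_facePerm (d : G.Dart) : (⟦E.facePerm d⟧ : Quotient
    (Equiv.Perm.SameCycle.setoid E.facePerm)) = ⟦d⟧ :=
  Quotient.sound (Equiv.Perm.sameCycle_apply_left.2 .rfl)

/-- The faces. -/
abbrev Face : Type u := Quotient (Equiv.Perm.SameCycle.setoid E.facePerm)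

theorem mk_rot (d : G.Dart) : (⟦E.rot d⟧ : E.Face) = ⟦d.symm⟧ := by
  have := E.mk_facePerm d.symm
  rwa [facePerm_apply, SimpleGraph.Dart.symm_symm] at this

variable [Finite V]

instance : Finite G.Dart :=
  Finite.of_injective _ (SimpleGraph.Dart.toProd_injective (G := G))

/-- The coboundary of a vertex potential plus the boundary of a face potential. -/
noncomputable def hodgeMap : (V → ℝ) × (E.Face → ℝ) →ₗ[ℝ] (G.Dart → ℝ) where
  toFun p d := (p.1 d.snd - p.1 d.fst) + (p.2 ⟦d⟧ - p.2 ⟦d.symm⟧)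
  map_add' p q := by ext d; simp; ring
  map_smul' c p := by ext d; simp; ring

/-- Antisymmetric functions on the darts. -/
def antisymm (G : SimpleGraph V) : Submodule ℝ (G.Dart → ℝ) where
  carrier := {θ | ∀ d, θ d.symm = - θ d}
  add_mem' := by intro a b ha hb d; simp [ha d, hb d]; ring
  zero_mem' := by intro d; simp
  smul_mem' := by intro c a ha d; simp [ha d]

/-- An antisymmetric function is determined by its values on one chosen orientation of each edge. -/
theorem finrank_antisymm_le (G : SimpleGraph V) :
    Module.finrank ℝ (antisymm G) ≤ Nat.card G.edgeSet := by
  classical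
  have := Fintype.ofFinite V
  have hchoice : ∀ e : G.edgeSet, ∃ d : G.Dart, d.edge = e := by
    rintro ⟨e, he⟩
    induction e with
    | h a b => exact ⟨⟨(a, b), he⟩, rfl⟩
  choose o ho using hchoice
  let L : antisymm G →ₗ[ℝ] (G.edgeSet → ℝ) :=
    { toFun := fun θ e => θ.1 (o e)
      map_add' := fun _ _ => rfl
      map_smul' := fun _ _ => rfl }
  have hL : Function.Injective L := by
    rw [← LinearMap.ker_eq_bot, LinearMap.ker_eq_bot']
    intro θ hθ
    ext d
    have h0 : θ.1 (o ⟨d.edge, d.edge_mem⟩) = 0 := congrFun hθ _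
    rcases (SimpleGraph.dart_edge_eq_iff _ _).1 (ho ⟨d.edge, d.edge_mem⟩) with h | h
    · rw [← h]; exact h0
    · rw [h, θ.2 d] at h0
      simpa using h0
  have := LinearMap.finrank_le_finrank_of_injective hL
  rwa [Module.finrank_fintype_fun_eq_card, ← Nat.card_eq_fintype_card] at this

/-- The two summands of `hodgeMap` are orthogonal, so on the kernel both vanish. Connectedness then
makes both potentials constant, and only the two constants remain free. -/
theorem finrank_ker_hodgeMap_le (hG : G.Connected) [Nonempty G.Dart] :
    Module.finrank ℝ (LinearMap.ker E.hodgeMap) ≤ 2 := by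
  classical
  have := Fintype.ofFinite V
  have := Fintype.ofFinite G.Dart
  obtain ⟨d₀⟩ := ‹Nonempty G.Dart›
  let L : LinearMap.ker E.hodgeMap →ₗ[ℝ] ℝ × ℝ :=
    { toFun := fun p => (p.1.1 d₀.fst, p.1.2 ⟦d₀⟧)
      map_add' := fun _ _ => rfl
      map_smul' := fun _ _ => rfl }
  have hL : Function.Injective L := by
    rw [← LinearMap.ker_eq_bot, LinearMap.ker_eq_bot']
    rintro ⟨⟨f, φ⟩, hp⟩ h0
    have hsum : ∀ d : G.Dart, (f d.snd - f d.fst) + (φ ⟦d⟧ - φ ⟦d.symm⟧) = 0 := congrFun hp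
    have hf0 : f d₀.fst = 0 := congrArg Prod.fst h0
    have hφ0 : φ ⟦d₀⟧ = 0 := congrArg Prod.snd h0
    have horth := E.orthogonal (φ := fun d => φ ⟦d⟧) (fun d => by rw [E.mk_facePerm]) f
    have hsq : ∑ d : G.Dart, (f d.snd - f d.fst) ^ 2 = 0 := by
      rw [← neg_eq_zero, ← sum_neg_distrib, ← horth]
      refine sum_congr rfl fun d _ => ?_
      linear_combination (-(f d.snd - f d.fst)) * hsum d
    have hdf : ∀ d : G.Dart, f d.snd = f d.fst := fun d => by
      have := (sum_eq_zero_iff_of_nonneg fun d _ => sq_nonneg _).1 hsq d (mem_univ _)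
      have := pow_eq_zero_iff (two_ne_zero) |>.1 this
      linarith
    have hdφ : ∀ d : G.Dart, φ ⟦d.symm⟧ = φ ⟦d⟧ := fun d => by
      have := hsum d; rw [hdf d] at this; linarith
    have hfc : ∀ d : G.Dart, f d.fst = 0 := fun d => by
      rw [← hf0]
      exact E.dart_const hG (g := fun d => f d.fst) (fun d => by rw [E.rot_fst])
        (fun d => hdf d) d d₀
    have hφc : ∀ d : G.Dart, φ ⟦d⟧ = 0 := fun d => by
      rw [← hφ0]
      exact E.dart_const hG (g := fun d => φ ⟦d⟧)
        (fun d => by rw [E.mk_rot, hdφ]) hdφ d d₀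
    have h1 : f = 0 := by
      ext v
      by_cases h : v = d₀.fst
      · rw [h]; exact hf0
      · obtain ⟨p⟩ := hG.preconnected v d₀.fst
        cases p with
        | nil => exact absurd rfl h
        | cons hadj p => exact hfc ⟨(v, _), hadj⟩
    have h2 : φ = 0 := by
      ext F
      induction F using Quotient.ind with
      | _ d => exact hφc d
    subst h1 h2
    rfl
  have := LinearMap.finrank_le_finrank_of_injective hL
  simpa using this

/-- On the sphere, every antisymmetric function on the darts is the sum of the coboundary of a
vertex potential and the boundary of a face potential. -/
theorem hodge (hG : G.Connected) {θ : G.Dart → ℝ} (hθ : ∀ d, θ d.symm = - θ d) :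
    ∃ (f : V → ℝ) (φ : G.Dart → ℝ), (∀ d, φ (E.facePerm d) = φ d) ∧
      ∀ d, θ d = (f d.snd - f d.fst) + (φ d - φ d.symm) := by
  classical
  by_cases hne : Nonempty G.Dart
  swap
  · exact ⟨0, 0, fun d => (hne ⟨d⟩).elim, fun d => (hne ⟨d⟩).elim⟩
  have := Fintype.ofFinite V
  have := Fintype.ofFinite E.Face
  have hle : LinearMap.range E.hodgeMap ≤ antisymm G := by
    rintro _ ⟨p, rfl⟩ d
    simp [hodgeMap, SimpleGraph.Dart.symm]
    ring
  have hrank := LinearMap.finrank_range_add_finrank_ker E.hodgeMap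
  have hker := E.finrank_ker_hodgeMap_le hG
  have heuler := E.euler hne
  rw [Module.finrank_prod, Module.finrank_fintype_fun_eq_card,
    Module.finrank_fintype_fun_eq_card, ← Nat.card_eq_fintype_card,
    ← Nat.card_eq_fintype_card] at hrank
  have hanti := finrank_antisymm_le G
  -- Rank-nullity and Euler's formula give rank at least `#V + #F - 2 = #E`, which is an upper bound
  -- for the dimension of the antisymmetric functions.
  have heq := Submodule.eq_of_le_of_finrank_le hle (by
    change Nat.card V + Nat.card E.Face = _ at heuler
    omega)
  have hmem : θ ∈ LinearMap.range E.hodgeMap := by rw [heq]; exact hθ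
  obtain ⟨⟨f, φ⟩, h⟩ := hmem
  exact ⟨f, fun d => φ ⟦d⟧, fun d => congrArg φ (E.mk_facePerm d), fun d => (congrFun h d).symm⟩

/-- A flow without sources is the boundary of a face potential. -/
theorem exists_facePotential [Fintype G.Dart] (hG : G.Connected) {z : G.Dart → ℝ}
    (hz : ∀ d, z d.symm = - z d)
    (hdiv : ∀ f : V → ℝ, ∑ d : G.Dart, (f d.snd - f d.fst) * z d = 0) :
    ∃ φ : G.Dart → ℝ, (∀ d, φ (E.facePerm d) = φ d) ∧ ∀ d, z d = φ d - φ d.symm := by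
  obtain ⟨f, φ, hφ, h⟩ := E.hodge hG hz
  refine ⟨φ, hφ, ?_⟩
  have horth := E.orthogonal hφ f
  -- Testing the absence of sources against `f` itself shows that the vertex part has norm zero.
  have hsq : ∑ d : G.Dart, (f d.snd - f d.fst) ^ 2 = 0 := by
    have := hdiv f
    simp only [h, mul_add, sum_add_distrib, horth, add_zero] at this
    simpa only [sq] using this
  intro d
  have := (sum_eq_zero_iff_of_nonneg fun d _ => sq_nonneg _).1 hsq d (mem_univ _)
  rw [h d, pow_eq_zero_iff (two_ne_zero) |>.1 this, zero_add]

/-- A function with vanishing sums over the faces is the coboundary of a vertex potential. -/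
theorem exists_vertexPotential [Fintype G.Dart] (hG : G.Connected) {θ : G.Dart → ℝ}
    (hθ : ∀ d, θ d.symm = - θ d)
    (hface : ∀ φ : G.Dart → ℝ, (∀ d, φ (E.facePerm d) = φ d) → ∑ d : G.Dart, θ d * φ d = 0) :
    ∃ f : V → ℝ, ∀ d : G.Dart, θ d = f d.snd - f d.fst := by
  obtain ⟨f, φ, hφ, h⟩ := E.hodge hG hθ
  refine ⟨f, ?_⟩
  have horth := E.orthogonal hφ f
  -- Dually, `θ` is orthogonal to its own face part, which therefore vanishes.
  have h1 : ∑ d : G.Dart, θ d * (φ d - φ d.symm) = 0 := by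
    have h2 : ∑ d : G.Dart, θ d * φ d.symm = - ∑ d : G.Dart, θ d * φ d := by
      rw [← sum_symm, ← sum_neg_distrib]
      exact sum_congr rfl fun d _ => by rw [hθ, SimpleGraph.Dart.symm_symm]; ring
    simp only [mul_sub, sum_sub_distrib, h2, hface φ hφ]
    simp
  have hsq : ∑ d : G.Dart, (φ d - φ d.symm) ^ 2 = 0 := by
    have h3 : ∀ d : G.Dart, θ d * (φ d - φ d.symm) =
        (f d.snd - f d.fst) * (φ d - φ d.symm) + (φ d - φ d.symm) ^ 2 := fun d => by
      rw [h d]; ring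
    simpa only [h3, sum_add_distrib, horth, zero_add] using h1
  intro d
  have := (sum_eq_zero_iff_of_nonneg fun d _ => sq_nonneg _).1 hsq d (mem_univ _)
  rw [h d, pow_eq_zero_iff (two_ne_zero) |>.1 this, add_zero]

end PlaneEmbedding

end RegionClustering

/-! ### Circulations and the outer face of an induced subgraph -/

namespace RegionClustering

namespace PlaneEmbedding

open Finset

variable {V : Type u} {G : SimpleGraph V} (E : PlaneEmbedding G) {X A K N : Set V} {u v : V}

/-! ### Flows along walks -/

open Classical in
/-- The unit flow along one dart. -/
noncomputable def arc (e d : G.Dart) : ℝ :=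
  (if d = e then 1 else 0) - (if d = e.symm then 1 else 0)

theorem arc_self (e : G.Dart) : arc e e = 1 := by
  simp [arc, (SimpleGraph.Dart.symm_ne e).symm]

theorem arc_of_ne {e d : G.Dart} (h : d ≠ e) (h' : d ≠ e.symm) : arc e d = 0 := by
  simp [arc, h, h']

theorem arc_symm (e d : G.Dart) : arc e d.symm = - arc e d := by
  classical
  have h1 : d.symm = e ↔ d = e.symm :=
    ⟨fun h => by rw [← h, SimpleGraph.Dart.symm_symm], fun h => by
      rw [h, SimpleGraph.Dart.symm_symm]⟩
  have h2 : d.symm = e.symm ↔ d = e :=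
    ⟨fun h => by rw [← SimpleGraph.Dart.symm_symm d, h, SimpleGraph.Dart.symm_symm], fun h => by
      rw [h]⟩
  unfold arc
  split_ifs <;> first | (exfalso; tauto) | norm_num

theorem sum_arc [Fintype G.Dart] (e : G.Dart) (f : V → ℝ) :
    ∑ d : G.Dart, (f d.snd - f d.fst) * arc e d = 2 * (f e.snd - f e.fst) := by
  simp only [arc, mul_sub, mul_ite, mul_one, mul_zero, sum_sub_distrib, sum_ite_eq', mem_univ,
    if_true, symm_fst, symm_snd]
  ring

/-- Adding up the arcs of a walk gives a unit flow. Its divergence is stated weakly, by pairing with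
vertex potentials; the factor 2 appears because each edge is counted through both of its darts. -/
theorem exists_flow [Fintype G.Dart] (h : Linked G A u v) : ∃ z : G.Dart → ℝ,
    (∀ d, z d.symm = - z d) ∧ (∀ d, z d ≠ 0 → d.fst ∈ A ∧ d.snd ∈ A) ∧
      ∀ f : V → ℝ, ∑ d : G.Dart, (f d.snd - f d.fst) * z d = 2 * (f v - f u) := by
  obtain ⟨p, hp⟩ := h
  induction p with
  | nil => exact ⟨0, by simp, by simp, by simp⟩
  | @cons a b c hadj p ih =>
    simp only [SimpleGraph.Walk.support_cons, List.mem_cons, forall_eq_or_imp] at hp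
    obtain ⟨z, hz, hzA, hzf⟩ := ih hp.2
    have hb := hp.2 _ p.start_mem_support
    refine ⟨fun d => arc ⟨(a, b), hadj⟩ d + z d, fun d => ?_, fun d hd => ?_, fun f => ?_⟩
    · simp only [arc_symm, hz]; ring
    · by_contra hcon
      apply hd
      have hz0 : z d = 0 := by
        by_contra h
        exact hcon (hzA d h)
      change arc _ d + z d = 0
      rw [hz0, add_zero]
      apply arc_of_ne
      · rintro rfl; exact hcon ⟨hp.1, hb⟩
      · rintro rfl; exact hcon ⟨hb, hp.1⟩
    · simp only [mul_add, sum_add_distrib, sum_arc, hzf]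
      ring

/-! ### The outer face of an induced subgraph -/

/-- All faces merged into the outer face of `G[X]` are reached from the single orbit `E.outer`, so a
quantity preserved by walking along faces and by crossing missing edges takes one value there. -/
theorem outside_const [Finite V] {β : Type*} {g : G.Dart → β}
    (hface : ∀ d, E.Outside X d → g (E.facePerm d) = g d)
    (hcross : ∀ d, E.Outside X d → ¬ (d.fst ∈ X ∧ d.snd ∈ X) → g d.symm = g d)
    {d e : G.Dart} (hd : E.Outside X d) (he : E.Outside X e) : g d = g e := by
  obtain ⟨d₀, hd₀⟩ := E.outer_face ⟨d⟩
  have hO : E.outer = {e | E.facePerm.SameCycle d₀ e} := hd₀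
  have hout : ∀ e ∈ E.outer, g e = g d₀ := by
    intro e he
    rw [hO] at he
    obtain ⟨n, hn⟩ := Equiv.Perm.SameCycle.exists_nat_pow_eq he
    have key : ∀ n : ℕ, E.Outside X ((E.facePerm ^ n) d₀) ∧ g ((E.facePerm ^ n) d₀) = g d₀ := by
      intro n
      induction n with
      | zero => exact ⟨.outer _ (by rw [hO]; exact .rfl), rfl⟩
      | succ n ih =>
        rw [pow_succ', Equiv.Perm.mul_apply]
        exact ⟨.face _ ih.1, (hface _ ih.1).trans ih.2⟩
    rw [← hn]
    exact (key n).2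
  have hall : ∀ e, E.Outside X e → g e = g d₀ := by
    intro e he
    induction he with
    | outer e he => exact hout e he
    | face e he ih => exact (hface e he).trans ih
    | cross e he hX ih => exact (hcross e he hX).trans ih
  rw [hall d hd, hall e he]

/-- `Outside` is closed only under forward steps; on a finite orbit, going forward far enough also
leads back. -/
theorem outside_facePerm_iff [Finite V] {d : G.Dart} :
    E.Outside X (E.facePerm d) ↔ E.Outside X d := by
  refine ⟨fun h => ?_, fun h => .face d h⟩
  have hc : E.facePerm.SameCycle (E.facePerm d) d := Equiv.Perm.sameCycle_apply_left.2 .rfl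
  obtain ⟨n, hn⟩ := hc.exists_nat_pow_eq
  have key : ∀ n : ℕ, E.Outside X ((E.facePerm ^ n) (E.facePerm d)) := by
    intro n
    induction n with
    | zero => exact h
    | succ n ih => rw [pow_succ', Equiv.Perm.mul_apply]; exact .face _ ih
  rw [← hn]
  exact key n

theorem outside_symm_iff {d : G.Dart} (hX : ¬ (d.fst ∈ X ∧ d.snd ∈ X)) :
    E.Outside X d.symm ↔ E.Outside X d := by
  refine ⟨fun h => ?_, fun h => .cross d h hX⟩
  rw [← SimpleGraph.Dart.symm_symm d]
  exact .cross _ h fun h' => hX ⟨h'.2, h'.1⟩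

theorem Outside.anti {Y : Set V} (hYX : Y ⊆ X) {d : G.Dart} (h : E.Outside X d) :
    E.Outside Y d := by
  induction h with
  | outer d hd => exact .outer d hd
  | face d _ ih => exact .face d ih
  | cross d _ hX ih => exact .cross d ih fun h => hX ⟨hYX h.1, hYX h.2⟩

/-- Two disjoint connected sets are joined by at most one dart along the outer face. -/
theorem outside_dart_unique [Finite V] (hG : G.Connected) (hKX : K ⊆ X) (hNX : N ⊆ X)
    (hdisj : Disjoint K N) (hK : IsRegion G K) (hN : IsRegion G N) {d₁ d₂ : G.Dart}
    (h₁ : d₁.fst ∈ K) (h₁' : d₁.snd ∈ N) (h₂ : d₂.fst ∈ K) (h₂' : d₂.snd ∈ N)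
    (o₁ : E.Outside X d₁) (o₂ : E.Outside X d₂) : d₁ = d₂ := by
  classical
  by_contra hne
  have := Fintype.ofFinite G.Dart
  obtain ⟨zN, hzN, hzNA, hzNf⟩ := exists_flow (hN.linked h₁' h₂')
  obtain ⟨zK, hzK, hzKA, hzKf⟩ := exists_flow (hK.linked h₂ h₁)
  have hKN : ∀ {x}, x ∈ K → x ∉ N := fun hx hx' => Set.disjoint_left.1 hdisj hx hx'
  -- A closed circulation inside `X`: along `d₁` into `N`, through `N`, back against `d₂` and
  -- through `K`. Being free of sources, it is the boundary of a face potential `φ`.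
  set z : G.Dart → ℝ := fun d => arc d₁ d + zN d - arc d₂ d + zK d with hzdef
  obtain ⟨φ, hφ, hz⟩ := E.exists_facePotential hG (z := z)
    (fun d => by simp only [hzdef, arc_symm, hzN, hzK]; ring)
    (fun f => by
      simp only [hzdef, mul_add, mul_sub, sum_add_distrib, sum_sub_distrib, sum_arc, hzNf, hzKf]
      ring)
  have hzN0 : ∀ d : G.Dart, ¬ (d.fst ∈ N ∧ d.snd ∈ N) → zN d = 0 := fun d h => by
    by_contra h'; exact h (hzNA d h')
  have hzK0 : ∀ d : G.Dart, ¬ (d.fst ∈ K ∧ d.snd ∈ K) → zK d = 0 := fun d h => by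
    by_contra h'; exact h (hzKA d h')
  have hzX : ∀ d : G.Dart, ¬ (d.fst ∈ X ∧ d.snd ∈ X) → z d = 0 := by
    intro d hd
    simp only [hzdef]
    rw [hzN0 d fun h => hd ⟨hNX h.1, hNX h.2⟩, hzK0 d fun h => hd ⟨hKX h.1, hKX h.2⟩,
      arc_of_ne, arc_of_ne]
    · simp
    · rintro rfl; exact hd ⟨hKX h₂, hNX h₂'⟩
    · rintro rfl; exact hd ⟨hNX h₂', hKX h₂⟩
    · rintro rfl; exact hd ⟨hKX h₁, hNX h₁'⟩
    · rintro rfl; exact hd ⟨hNX h₁', hKX h₁⟩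
  have hcut : ∀ d : G.Dart, d.fst ∈ K → d.snd ∉ K → z d = arc d₁ d - arc d₂ d := by
    intro d hd hd'
    simp only [hzdef]
    rw [hzN0 d fun h => hKN hd h.1, hzK0 d fun h => hd' h.2]
    ring
  -- The potential does not jump across edges missing from `X`, so it is constant on the outer face.
  have hφ₁₂ : φ d₁ = φ d₂ := E.outside_const (X := X) (fun d _ => hφ d)
    (fun d _ hd => by linarith [hz d, hzX d hd]) o₁ o₂
  have hz₁ : z d₁ = 1 := by
    rw [hcut d₁ h₁ fun h => hKN h h₁', arc_self, arc_of_ne hne, sub_zero]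
    rintro rfl
    exact hKN h₁ h₂'
  have hz₂ : z d₂ = -1 := by
    rw [hcut d₂ h₂ fun h => hKN h h₂', arc_self, arc_of_ne (Ne.symm hne), zero_sub]
    rintro rfl
    exact hKN h₂ h₁'
  -- The potential falls by 1 across `d₁` and rises by 1 across `d₂`. Squaring turns both jumps into
  -- `+1`, while no other dart leaving `K` contributes; yet the total jump over the darts leaving
  -- `K` must vanish.
  let g : G.Dart → ℝ := fun d => (φ d - φ d₁) ^ 2
  let χ : V → ℝ := fun v => if v ∈ K then 1 else 0
  have hflux := E.flux (g := g) (fun d => by simp only [g, hφ]) χ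
  have hfl : ∑ d : G.Dart, (g d.symm - g d) * χ d.fst = 0 := by
    have : ∑ d : G.Dart, g d.symm * χ d.fst = ∑ d : G.Dart, g d * χ d.snd := by
      rw [← sum_symm]
      exact sum_congr rfl fun d _ => by rw [SimpleGraph.Dart.symm_symm, symm_fst]
    simp only [sub_mul, sum_sub_distrib]
    rw [this]
    linarith
  have hin : ∑ d : G.Dart, (g d.symm - g d) * (χ d.fst * χ d.snd) = 0 := by
    have : ∑ d : G.Dart, g d.symm * (χ d.fst * χ d.snd) = ∑ d : G.Dart, g d * (χ d.fst * χ d.snd) := by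
      rw [← sum_symm]
      exact sum_congr rfl fun d _ => by
        rw [SimpleGraph.Dart.symm_symm, symm_fst, symm_snd, mul_comm (χ d.snd)]
    simp only [sub_mul, sum_sub_distrib]
    rw [this]
    simp
  have hout : ∑ d : G.Dart, (g d.symm - g d) * (χ d.fst * (1 - χ d.snd)) = 0 := by
    rw [← sub_eq_zero_of_eq (hfl.trans hin.symm), ← sum_sub_distrib]
    exact sum_congr rfl fun d _ => by ring
  have hval : ∀ d : G.Dart, z d ≠ 0 → d.fst ∈ K → d.snd ∉ K → d = d₁ ∨ d = d₂ := by
    intro d hd hd1 hd2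
    by_contra hcon
    push Not at hcon
    apply hd
    rw [hcut d hd1 hd2, arc_of_ne hcon.1, arc_of_ne hcon.2, sub_zero]
    · rintro rfl; exact hKN hd1 h₂'
    · rintro rfl; exact hKN hd1 h₁'
  have hg1 : g d₁.symm - g d₁ = 1 := by
    have h := hz d₁
    rw [hz₁] at h
    have : φ d₁.symm = φ d₁ - 1 := by linarith
    simp only [g, this]; ring
  have hg2 : g d₂.symm - g d₂ = 1 := by
    have h := hz d₂
    rw [hz₂] at h
    have : φ d₂.symm = φ d₁ + 1 := by linarith
    simp only [g, this, ← hφ₁₂]; ring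
  have hpos : 0 < ∑ d : G.Dart, (g d.symm - g d) * (χ d.fst * (1 - χ d.snd)) := by
    refine sum_pos' (fun d _ => ?_) ⟨d₁, mem_univ _, ?_⟩
    · by_cases hd1 : d.fst ∈ K
      swap
      · simp [χ, hd1]
      by_cases hd2 : d.snd ∈ K
      · simp [χ, hd2]
      have hχ : χ d.fst * (1 - χ d.snd) = 1 := by simp [χ, hd1, hd2]
      rw [hχ, mul_one]
      by_cases hzd : z d = 0
      · have : φ d.symm = φ d := by linarith [hz d]
        simp [g, this]
      · rcases hval d hzd hd1 hd2 with rfl | rfl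
        · rw [hg1]; norm_num
        · rw [hg2]; norm_num
    · have : d₁.snd ∉ K := fun h => hKN h h₁'
      simp [χ, h₁, this, hg1]
  exact hpos.ne' hout

/-- The boundary of the outer face is connected: if there are vertices of `K` and vertices of
`X \ K` on it, then it leaves `K` somewhere. -/
theorem exists_outside_exit [Finite V] (hG : G.Connected) (hX : IsRegion G X)
    (hKX : K ⊆ X) {d e : G.Dart} (hd : E.Outside X d) (hdK : d.fst ∈ K)
    (he : E.Outside X e) (heX : e.fst ∈ X) (heK : e.fst ∉ K) :
    ∃ d : G.Dart, E.Outside X d ∧ d.fst ∈ K ∧ d.snd ∈ X ∧ d.snd ∉ K := by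
  classical
  by_contra! hno
  have := Fintype.ofFinite G.Dart
  let o : G.Dart → ℝ := fun d => if E.Outside X d then 1 else 0
  have ho : ∀ d, o (E.facePerm d) = o d := fun d => by simp only [o, E.outside_facePerm_iff]
  let χ : V → ℝ := fun v => if v ∈ K then 1 else 0
  have hflux := E.flux ho χ
  let enter : G.Dart → ℝ := fun d => o d * ((1 - χ d.fst) * χ d.snd)
  let leave : G.Dart → ℝ := fun d => o d * (χ d.fst * (1 - χ d.snd))
  -- The outer boundary enters `K` as often as it leaves it. Comparing each dart with the reverse of
  -- the other kind makes every summand nonnegative, so all are zero and the boundary cannot enter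
  -- `K` from `X \ K` either.
  have hbal : ∑ d, (enter d - leave d.symm) = 0 := by
    have h1 : ∑ d, (enter d - leave d) = 0 := by
      have : ∀ d, enter d - leave d = o d * χ d.snd - o d * χ d.fst := fun d => by
        simp only [enter, leave]; ring
      simp only [this, sum_sub_distrib, hflux, sub_self]
    rw [sum_sub_distrib] at h1 ⊢
    rw [sum_symm leave]
    exact h1
  have hterm : ∀ d, enter d - leave d.symm =
      (o d - o d.symm) * ((1 - χ d.fst) * χ d.snd) := fun d => by
    simp only [enter, leave, symm_fst, symm_snd]; ring
  have hnn : ∀ d, 0 ≤ enter d - leave d.symm := by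
    intro d
    rw [hterm]
    by_cases h1 : d.fst ∈ K
    · simp [χ, h1]
    by_cases h2 : d.snd ∈ K
    swap
    · simp [χ, h2]
    have hχ : (1 - χ d.fst) * χ d.snd = 1 := by simp [χ, h1, h2]
    rw [hχ, mul_one]
    by_cases h3 : d.fst ∈ X
    · have : ¬ E.Outside X d.symm := fun h => h1 (hno _ h h2 h3)
      simp only [o, this, if_false, sub_zero]
      split_ifs <;> norm_num
    · have := E.outside_symm_iff (X := X) (d := d) (fun h => h3 h.1)
      simp [o, this]
  have hzero := fun d => (sum_eq_zero_iff_of_nonneg fun d _ => hnn d).1 hbal d (mem_univ _)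
  have hno' : ∀ d, E.Outside X d → d.fst ∈ X → d.fst ∉ K → d.snd ∉ K := by
    intro d hd h1 h2 h3
    have hs : ¬ E.Outside X d.symm := fun h => h2 (hno _ h h3 h1)
    have := hzero d
    rw [hterm] at this
    simp [o, χ, hd, hs, h2, h3] at this
  have hsymm : ∀ d : G.Dart, o d ≠ o d.symm → χ d.fst = χ d.snd := by
    intro d hd
    have hin : d.fst ∈ X ∧ d.snd ∈ X := by
      by_contra h
      exact hd (by simp only [o, E.outside_symm_iff h])
    have hout : E.Outside X d ∨ E.Outside X d.symm := by
      by_contra! h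
      exact hd (by simp [o, h.1, h.2])
    have : d.fst ∈ K ↔ d.snd ∈ K := by
      rcases hout with h | h
      · exact ⟨fun h1 => hno d h h1 hin.2, fun h1 => by
          by_contra h2; exact hno' d h hin.1 h2 h1⟩
      · exact ⟨fun h1 => by by_contra h2; exact hno' _ h hin.2 h2 h1,
          fun h1 => hno _ h h1 hin.1⟩
    simp only [χ, this]
  -- The differences of `χ`, restricted to outside darts, are antisymmetric: where `o` differs on
  -- the two sides of an edge, that edge lies in `X` and `χ` is equal at its ends. Their sums over
  -- faces vanish, so they have a potential `f`, and `f + χ` is constant along the outer face.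
  obtain ⟨f, hf⟩ := E.exists_vertexPotential hG (θ := fun d => o d * (χ d.fst - χ d.snd))
    (fun d => by
      by_cases h : o d = o d.symm
      · simp only [← h, symm_fst, symm_snd]; ring
      · simp only [symm_fst, symm_snd, hsymm d h]; ring)
    (fun φ hφ => by
      have := E.flux (g := fun d => o d * φ d) (fun d => by simp only [ho, hφ]) χ
      have h2 : ∀ d : G.Dart, o d * (χ d.fst - χ d.snd) * φ d =
          o d * φ d * χ d.fst - o d * φ d * χ d.snd := fun d => by ring
      simp only [h2, sum_sub_distrib, this, sub_self])
  have hstep : ∀ d, E.Outside X d → f d.snd + χ d.snd = f d.fst + χ d.fst := by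
    intro d hd
    have := hf d
    simp only [o, hd, if_true, one_mul] at this
    linarith
  have hconst : f d.fst + χ d.fst = f e.fst + χ e.fst :=
    E.outside_const (X := X) (g := fun d => f d.fst + χ d.fst)
      (fun d hd => by simp only [E.facePerm_fst]; exact hstep d hd)
      (fun d hd _ => hstep d hd) hd he
  -- On edges of `X` the difference of `f` is zero, so `f` is constant on the connected set `X`.
  -- Hence `χ` agrees at both tails, a contradiction.
  have hfX : f e.fst = f d.fst := by
    have : e.fst ∈ {v | f v = f d.fst} :=
      (hX.linked (hKX hdK) heX).mem_of_closed rfl fun x (hx : f x = f d.fst) hxX y hyX hadj => by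
        have h1 := hf ⟨(x, y), hadj⟩
        have h2 : o ⟨(x, y), hadj⟩ * (χ x - χ y) = 0 := by
          by_cases hO : E.Outside X ⟨(x, y), hadj⟩
          · have : x ∈ K ↔ y ∈ K :=
              ⟨fun h => hno _ hO h hyX, fun h => by by_contra h'; exact hno' _ hO hxX h' h⟩
            simp [χ, this]
          · simp [o, hO]
        change f y = f d.fst
        change o ⟨(x, y), hadj⟩ * (χ x - χ y) = f y - f x at h1
        rw [h2] at h1
        linarith
    exact this
  have h1 : χ d.fst = 1 := by simp [χ, hdK]
  have h2 : χ e.fst = 0 := by simp [χ, heK]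
  rw [hfX, h1, h2] at hconst
  linarith

end PlaneEmbedding

end RegionClustering

/-! ### Outer vertices -/

namespace RegionClustering

namespace PlaneEmbedding

variable {V : Type u} {G : SimpleGraph V} (E : PlaneEmbedding G) {X A H W Y Z L K N : Set V}
  {u v w x y : V}

theorem exists_dart_of_ne (hG : G.Connected) (h : v ≠ w) : ∃ d : G.Dart, d.fst = v := by
  obtain ⟨p⟩ := hG.preconnected v w
  cases p with
  | nil => exact absurd rfl h
  | cons hadj p => exact ⟨⟨(v, _), hadj⟩, rfl⟩

theorem IsOuterVertex.exists_dart (hG : G.Connected) (h : E.IsOuterVertex X v) (hne : v ≠ w) :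
    ∃ d : G.Dart, d.fst = v ∧ E.Outside X d := by
  rcases h.2 with h | h
  · exact h
  · obtain ⟨d, hd⟩ := exists_dart_of_ne hG hne
    exact absurd hd (h d)

variable [Finite V]

/-- All edges at a vertex outside `X` are missing from `G[X]`, so the faces around that vertex are
merged. -/
theorem outside_rot_iff {d : G.Dart} (hd : d.fst ∉ X) :
    E.Outside X (E.rot d) ↔ E.Outside X d := by
  have h := E.outside_facePerm_iff (X := X) (d := d.symm)
  rw [facePerm_apply, SimpleGraph.Dart.symm_symm] at h
  exact h.trans (E.outside_symm_iff fun h => hd h.1)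

/-- If no outside dart started in `X`, each of them could be crossed, so the outer face would spread
over all darts, including those at a vertex of `X`. -/
theorem exists_isOuterVertex (hG : G.Connected) (hX : X.Nonempty) :
    ∃ v, E.IsOuterVertex X v := by
  obtain ⟨v, hv⟩ := hX
  by_cases hne : ∃ w, v ≠ w
  swap
  · push Not at hne
    exact ⟨v, hv, Or.inr fun d hd => d.adj.ne ((hne d.fst).symm.trans (hne d.snd))⟩
  obtain ⟨w, hw⟩ := hne
  by_contra! hno
  have hout : ∀ d, E.Outside X d → d.fst ∉ X := fun d hd h =>
    hno d.fst ⟨h, Or.inl ⟨d, rfl, hd⟩⟩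
  have hsymm : ∀ d, E.Outside X d.symm = E.Outside X d := fun d => propext
    ⟨fun h => by
      rw [← SimpleGraph.Dart.symm_symm d]
      exact .cross _ h fun h' => hout _ h h'.1, fun h => .cross _ h fun h' => hout _ h h'.1⟩
  have hrot : ∀ d, E.Outside X (E.rot d) = E.Outside X d := fun d => by
    have h := E.outside_facePerm_iff (X := X) (d := d.symm)
    rw [facePerm_apply, SimpleGraph.Dart.symm_symm] at h
    exact (propext h).trans (hsymm d)
  obtain ⟨d, hd⟩ := exists_dart_of_ne hG hw
  obtain ⟨d₀, hd₀⟩ := E.outer_face ⟨d⟩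
  have h := E.dart_const hG hrot hsymm d₀ d
  have h₀ : E.Outside X d₀ := .outer _ (by rw [hd₀]; exact Equiv.Perm.SameCycle.rfl)
  exact hout d (h ▸ h₀) (hd ▸ hv)

/-- A vertex of `K` next to a vertex that is joined to the outer face outside `K` lies on the
outer face of `K`. -/
theorem isOuterVertex_of_adj (hG : G.Connected) (hKX : K ⊆ X) (hAK : Disjoint A K)
    (ho : E.IsOuterVertex X w) (hlink : Linked G A w u) (hv : v ∈ K) (hadj : G.Adj u v) :
    E.IsOuterVertex K v := by
  have hnot : ∀ {x}, x ∈ A → x ∉ K := fun h h' => Set.disjoint_left.1 hAK h h'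
  have hall : ∀ d e : G.Dart, d.fst ∉ K → d.fst = e.fst → E.Outside K d → E.Outside K e := by
    intro d e hdK hde hd
    have h := sameCycle_eq (f := E.rot) (g := fun d => d.fst ∉ K ∧ E.Outside K d) (fun d => by
      rw [E.rot_fst]
      by_cases h : d.fst ∈ K
      · simp [h]
      · simp [h, E.outside_rot_iff h]) ((E.rot_sameCycle d e).2 hde)
    exact (h ▸ (⟨hdK, hd⟩ : d.fst ∉ K ∧ E.Outside K d) : e.fst ∉ K ∧ E.Outside K e).2
  have hne : w ≠ v := fun h => hnot hlink.left_mem (h ▸ hv)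
  obtain ⟨d, hdw, hd⟩ := IsOuterVertex.exists_dart E hG ho hne
  have hd' := Outside.anti E hKX hd
  -- All edges met along the walk in `A` are missing from `G[K]`, so the outer face of `G[K]`
  -- surrounds every vertex of the walk.
  have hu : u ∈ {x | ∀ d : G.Dart, d.fst = x → E.Outside K d} := by
    refine hlink.mem_of_closed (fun e he => hall d e ?_ (hdw.trans he.symm) hd') ?_
    · rw [hdw]; exact hnot hlink.left_mem
    · intro x hx hxA y hyA hxy e he
      have h1 : E.Outside K ⟨(x, y), hxy⟩ := hx _ rfl
      have h2 : E.Outside K (SimpleGraph.Dart.symm ⟨(x, y), hxy⟩) :=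
        .cross _ h1 fun h => hnot hxA h.1
      exact hall _ e (hnot hyA) he.symm h2
  have h1 : E.Outside K ⟨(u, v), hadj⟩ := hu _ rfl
  exact ⟨hv, Or.inl ⟨_, rfl, .cross _ h1 fun h => hnot hlink.right_mem h.1⟩⟩

end PlaneEmbedding

/-! ### Critical vertices and separation within one call -/

section Call

variable {V : Type u} {G : SimpleGraph V} {E : PlaneEmbedding G} {X H W Y Z L K N : Set V}
  {𝓡 : Set (Set V)} {u v w x y : V}

/-- The situation in which `SelectPaths` is called for the subgraph `G[H]` and the set `W`. -/
structure CallInv (E : PlaneEmbedding G) (X H W : Set V) (𝓡 : Set (Set V)) : Prop where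
  sub : H ⊆ X
  conn : IsRegion G H
  regions : IsRegionSet G H 𝓡
  boundary : ∀ x ∈ H, ∀ y ∈ X, y ∉ H → G.Adj x y → y ∈ W
  outer : ∃ v ∈ H, E.IsOuterVertex X v
  prev : (W = ∅ ∧ H = X) ∨
    (W ⊆ X ∧ Disjoint W H ∧ IsRegion G W ∧ ∃ w ∈ W, E.IsOuterVertex X w)

variable [Finite V]

/-- Along the outer face of `X` one can leave `H` towards `W` and come back. -/
theorem CallInv.exists_darts (hI : CallInv E X H W 𝓡) (hG : G.Connected) (hX : IsRegion G X)
    (hL : L ⊆ H) (hLo : ∃ v ∈ L, E.IsOuterVertex X v) (hW : W ≠ ∅) :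
    (∃ d : G.Dart, E.Outside X d ∧ d.fst ∈ L ∧ d.snd ∈ X ∧ d.snd ∉ L) ∧
      ∃ d : G.Dart, E.Outside X d ∧ d.fst ∈ W ∧ d.snd ∈ H := by
  obtain ⟨hWX, hWH, -, w, hw, hwo⟩ := hI.prev.resolve_left fun h => hW h.1
  obtain ⟨v, hv, hvo⟩ := hLo
  have hwH : w ∉ H := Set.disjoint_left.1 hWH hw
  have hvw : v ≠ w := fun h => hwH (h ▸ hL hv)
  obtain ⟨d, rfl, hd⟩ := hvo.exists_dart E hG hvw
  obtain ⟨e, rfl, he⟩ := hwo.exists_dart E hG hvw.symm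
  refine ⟨E.exists_outside_exit hG hX (hL.trans hI.sub) hd hv he (hWX hw) fun h => hwH (hL h),
    ?_⟩
  -- Leaving `X \ H` means entering `H`, and by `boundary` the vertex left behind lies in `W`.
  obtain ⟨f, hf, hfX, hfX', hfH⟩ := E.exists_outside_exit hG hX (K := X \ H) Set.sdiff_subset he
    ⟨hWX hw, hwH⟩ hd (hI.sub (hL hv)) fun h => h.2 (hL hv)
  have hfH' : f.snd ∈ H := by
    by_contra h
    exact hfH ⟨hfX', h⟩
  exact ⟨f, hf, hI.boundary _ hfH' _ hfX.1 hfX.2 f.adj.symm, hfH'⟩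

/-- The outer boundary goes from `H` to `W` by exactly one dart and returns by exactly one. Their
ends in `H` are all the critical vertices; the two may coincide. -/
theorem CallInv.exists_criticalSet (hI : CallInv E X H W 𝓡) (hG : G.Connected)
    (hX : IsRegion G X) : ∃ y₁ ∈ H, ∃ y₂ ∈ H, IsCriticalSet E X H W {y₁, y₂} := by
  by_cases hW : W = ∅
  · have hHX := (hI.prev.resolve_right fun h => by
      obtain ⟨-, -, -, w, hw, -⟩ := h
      rw [hW] at hw
      exact hw).2
    obtain ⟨y, hy, hyo⟩ := hI.outer
    exact ⟨y, hy, y, hy, Or.inl ⟨hW, y, hyo, by simp⟩⟩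
  obtain ⟨hWX, hWH, hWc, -⟩ := hI.prev.resolve_left fun h => hW h.1
  obtain ⟨⟨d, hd, hdH, hdX, hdH'⟩, e, he, heW, heH⟩ :=
    hI.exists_darts hG hX le_rfl hI.outer hW
  have hdW := hI.boundary _ hdH _ hdX hdH' d.adj
  refine ⟨d.fst, hdH, e.snd, heH, Or.inr ⟨hW, ?_⟩⟩
  ext y
  simp only [Set.mem_insert_iff, Set.mem_singleton_iff, Set.mem_ofPred_eq]
  constructor
  · rintro (rfl | rfl)
    · exact ⟨hdH, d.snd, hdW, hI.sub hdH, hdX, d, rfl, rfl, Or.inl hd⟩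
    · exact ⟨heH, e.fst, heW, hI.sub heH, hWX heW, e.symm, rfl, rfl,
        Or.inr (by rwa [SimpleGraph.Dart.symm_symm])⟩
  · rintro ⟨hyH, w, hw, -, -, f, rfl, rfl, hf | hf⟩
    · left
      rw [E.outside_dart_unique hG hI.sub hWX hWH.symm hI.conn hWc hyH hw hdH hdW hf hd]
    · right
      rw [← E.outside_dart_unique hG hWX hI.sub hWH hWc hI.conn hw hyH heW heH hf he]
      rfl

omit [Finite V] in
theorem CallInv.mem_criticalSet (hI : CallInv E X H W 𝓡) (hY : IsCriticalSet E X H W Y)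
    {d : G.Dart} (h : E.Outside X d ∨ E.Outside X d.symm) (hd : d.fst ∈ H) (hd' : d.snd ∈ W) :
    d.fst ∈ Y := by
  have hW : W ≠ ∅ := fun h => by rw [h] at hd'; exact hd'
  have hWX := (hI.prev.resolve_left fun h => hW h.1).1
  rcases hY with h' | ⟨-, rfl⟩
  · exact absurd h'.1 hW
  · exact ⟨hd, d.snd, hd', hI.sub hd, hWX hd', d, rfl, rfl, h⟩

/-- A connected set through all critical vertices separates the rest of the outer boundary
from `W`. -/
theorem CallInv.separation (hI : CallInv E X H W 𝓡) (hG : G.Connected) (hX : IsRegion G X)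
    (hY : IsCriticalSet E X H W Y) (hZH : Z ⊆ H) (hZ : IsRegion G Z) (hYZ : Y ⊆ Z)
    (hL : L ∈ components G (H \ Z)) (hLo : ∃ v ∈ L, E.IsOuterVertex X v) :
    ∀ x ∈ L, ∀ w ∈ W, ¬ G.Adj x w := by
  intro x hx w hw hadj
  have hW : W ≠ ∅ := fun h => by rw [h] at hw; exact hw
  obtain ⟨hWX, hWH, hWc, -⟩ := hI.prev.resolve_left fun h => hW h.1
  have hLH : L ⊆ H := fun x hx => (component_subset hL hx).1
  have hLZ : ∀ x ∈ L, x ∉ Z := fun x hx => (component_subset hL hx).2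
  obtain ⟨⟨d, hd, hdL, hdX, hdL'⟩, e, he, heW, heH⟩ := hI.exists_darts hG hX hLH hLo hW
  have heZ : e.snd ∈ Z := hYZ (hI.mem_criticalSet hY (d := e.symm)
    (Or.inr (by rwa [SimpleGraph.Dart.symm_symm])) heH heW)
  -- Inside `H`, the component `L` can only be left into `Z`. A dart leaving `H` would make its tail
  -- critical, hence a member of `Z`.
  have hdZ : d.snd ∈ Z := by
    by_cases hdH : d.snd ∈ H
    · by_contra h
      exact hdL' (component_closed hL hdL ⟨hdH, h⟩ d.adj)
    · exact absurd (hYZ (hI.mem_criticalSet hY (Or.inl hd) (hLH hdL)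
        (hI.boundary _ (hLH hdL) _ hdX hdH d.adj))) (hLZ _ hdL)
  -- An edge between `L` and `W` would make `L ∪ W` connected, with two outer darts into `Z`: one
  -- from `L` and one from `W`.
  have hde := E.outside_dart_unique hG (K := L ∪ W) (N := Z)
    (Set.union_subset (hLH.trans hI.sub) hWX) (hZH.trans hI.sub)
    (Set.disjoint_left.2 fun z hz hzZ => hz.elim (fun h => hLZ z h hzZ)
      fun h => Set.disjoint_left.1 hWH h (hZH hzZ))
    ((component_isRegion hL).union hWc hx hw (Or.inr hadj)) hZ (Or.inl hdL) hdZ (Or.inr heW)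
    heZ hd he
  rw [hde] at hdL
  exact Set.disjoint_left.1 hWH heW (hLH hdL)

end Call

end RegionClustering

namespace RegionClustering

/-! ## Distances in contact graphs -/

section Contact

variable {V : Type u} {G : SimpleGraph V} {𝓐 𝓑 𝓡 : Set (Set V)} {A B C D P Q R S K H : Set V}
  {π : List (Set V)} {m n : ℕ} {u v x y : V}

/-- `A` and `B` share a vertex or are joined by an edge. -/
def Touch (G : SimpleGraph V) (A B : Set V) : Prop := ∃ a ∈ A, ∃ b ∈ B, a = b ∨ G.Adj a b

theorem Touch.symm (h : Touch G A B) : Touch G B A := by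
  obtain ⟨a, ha, b, hb, h⟩ := h
  exact ⟨b, hb, a, ha, h.imp Eq.symm SimpleGraph.Adj.symm⟩

theorem Touch.mono (h : Touch G A B) (hA : A ⊆ C) (hB : B ⊆ D) : Touch G C D := by
  obtain ⟨a, ha, b, hb, h⟩ := h
  exact ⟨a, hA ha, b, hB hb, h⟩

theorem touch_of_mem (hA : x ∈ A) (hB : x ∈ B) : Touch G A B := ⟨x, hA, x, hB, Or.inl rfl⟩

/-- `A` and `B` have distance at most `n` in the contact graph of `𝓐`. -/
def Near (G : SimpleGraph V) (𝓐 : Set (Set V)) (n : ℕ) (A B : Set V) : Prop :=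
  (contactGraph G 𝓐).edist A B ≤ n

theorem Near.refl : Near G 𝓐 n A A := by simp [Near]

theorem Near.symm (h : Near G 𝓐 n A B) : Near G 𝓐 n B A := by
  unfold Near at *
  rwa [SimpleGraph.edist_comm]

theorem Near.mono (h : Near G 𝓐 n A B) (hnm : n ≤ m) : Near G 𝓐 m A B :=
  le_trans h (by exact_mod_cast hnm)

theorem Near.trans (h : Near G 𝓐 n A B) (h' : Near G 𝓐 m B C) : Near G 𝓐 (n + m) A C := by
  refine le_trans (SimpleGraph.edist_triangle (v := B)) ?_
  push_cast
  exact add_le_add h h'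

theorem near_iff_walk :
    Near G 𝓐 n A B ↔ ∃ p : (contactGraph G 𝓐).Walk A B, p.length ≤ n := by
  constructor
  · intro h
    obtain ⟨p, hp⟩ := SimpleGraph.exists_walk_of_edist_ne_top
      (ne_top_of_le_ne_top (ENat.natCast_ne_top n) h)
    exact ⟨p, by unfold Near at h; rw [← hp] at h; exact_mod_cast h⟩
  · rintro ⟨p, hp⟩
    exact (SimpleGraph.edist_le p).trans (by exact_mod_cast hp)

theorem near_zero_iff : Near G 𝓐 0 A B ↔ A = B := by simp [Near]

theorem near_one_of_touch (hA : A ∈ 𝓐) (hB : B ∈ 𝓐) (h : Touch G A B) : Near G 𝓐 1 A B := by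
  unfold Near
  rw [Nat.cast_one, SimpleGraph.edist_le_one_iff_adj_or_eq]
  by_cases hAB : A = B
  · exact Or.inr hAB
  · exact Or.inl ⟨hAB, hA, hB, h⟩

theorem Near.touch (h : Near G 𝓐 1 A B) (hA : A.Nonempty) : Touch G A B := by
  unfold Near at h
  rw [Nat.cast_one, SimpleGraph.edist_le_one_iff_adj_or_eq] at h
  rcases h with h | rfl
  · exact h.2.2.2
  · obtain ⟨x, hx⟩ := hA
    exact touch_of_mem hx hx

theorem Near.succ (h : Near G 𝓐 (n + 1) A B) :
    A = B ∨ ∃ C, Near G 𝓐 n A C ∧ (contactGraph G 𝓐).Adj C B := by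
  obtain ⟨p, hp⟩ := near_iff_walk.1 h.symm
  cases p with
  | nil => exact Or.inl rfl
  | @cons _ C _ hadj p =>
    rw [SimpleGraph.Walk.length_cons] at hp
    exact Or.inr ⟨C, (near_iff_walk.2 ⟨p, by omega⟩).symm, hadj.symm⟩

/-- Every member of `𝓐` is contained in a member of `𝓑`. -/
def Refines (𝓐 𝓑 : Set (Set V)) : Prop := ∀ A ∈ 𝓐, ∃ B ∈ 𝓑, A ⊆ B

theorem Refines.refl : Refines 𝓐 𝓐 := fun A hA => ⟨A, hA, le_rfl⟩

theorem Refines.trans {𝓒 : Set (Set V)} (h : Refines 𝓐 𝓑) (h' : Refines 𝓑 𝓒) :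
    Refines 𝓐 𝓒 := fun A hA => by
  obtain ⟨B, hB, hAB⟩ := h A hA
  obtain ⟨C, hC, hBC⟩ := h' B hB
  exact ⟨C, hC, hAB.trans hBC⟩

/-- Passing to larger regions does not increase distances, except from zero to one. -/
theorem Near.lift (hr : Refines 𝓐 𝓑) (h : Near G 𝓐 n A B) (hA : A.Nonempty) (hAC : A ⊆ C)
    (hC : C ∈ 𝓑) (hBD : B ⊆ D) (hD : D ∈ 𝓑) (hn : 1 ≤ n) : Near G 𝓑 n C D := by
  induction n generalizing B D with
  | zero => omega
  | succ n ih =>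
    rcases h.succ with rfl | ⟨B', hB', hadj⟩
    · obtain ⟨x, hx⟩ := hA
      exact (near_one_of_touch hC hD (touch_of_mem (hAC hx) (hBD hx))).mono (by omega)
    · cases n with
      | zero =>
        rw [near_zero_iff] at hB'
        subst hB'
        exact near_one_of_touch hC hD (Touch.mono hadj.2.2.2 hAC hBD)
      | succ n =>
        obtain ⟨D', hD', hBD'⟩ := hr B' hadj.2.1
        exact (ih hB' hBD' hD' (by omega)).trans
          (near_one_of_touch hD' hD (Touch.mono hadj.2.2.2 hBD' hBD))

/-- The regions of a ball cover a connected set. -/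
theorem isRegion_ball (h𝓐 : ∀ A ∈ 𝓐, IsRegion G A) (hP : P ∈ 𝓐) (n : ℕ) :
    IsRegion G (⋃₀ {R | R ∈ 𝓐 ∧ Near G 𝓐 n P R}) := by
  obtain ⟨x, hx⟩ := (h𝓐 P hP).nonempty
  have key : ∀ m ≤ n, ∀ R ∈ 𝓐, Near G 𝓐 m P R → ∀ y ∈ R,
      Linked G (⋃₀ {R | R ∈ 𝓐 ∧ Near G 𝓐 n P R}) x y := by
    intro m
    induction m with
    | zero =>
      intro _ R hR h y hy
      rw [near_zero_iff] at h
      subst h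
      exact ((h𝓐 P hP).linked hx hy).mono (Set.subset_sUnion_of_mem ⟨hP, .refl⟩)
    | succ m ih =>
      intro hm R hR h y hy
      have hRsub : R ⊆ ⋃₀ {R | R ∈ 𝓐 ∧ Near G 𝓐 n P R} :=
        Set.subset_sUnion_of_mem ⟨hR, h.mono hm⟩
      rcases h.succ with rfl | ⟨C, hC, hadj⟩
      · exact ((h𝓐 P hP).linked hx hy).mono hRsub
      · obtain ⟨-, hC𝓐, -, a, ha, b, hb, hab⟩ := hadj
        have h1 := ih (by omega) C hC𝓐 hC a ha
        refine h1.trans (Linked.trans ?_ (((h𝓐 R hR).linked hb hy).mono hRsub))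
        rcases hab with rfl | hab
        · exact .refl (hRsub hb)
        · exact .of_adj h1.right_mem (hRsub hb) hab
  refine isRegion_of_center (u := x) ⟨P, ⟨hP, .refl⟩, hx⟩ ?_
  rintro y ⟨R, ⟨hR, h⟩, hy⟩
  exact key n le_rfl R hR h y hy

/-! ### Geodesics and strips -/

/-- `π` lists a shortest path in the contact graph of `𝓐`. -/
structure Geodesic (G : SimpleGraph V) (𝓐 : Set (Set V)) (π : List (Set V)) : Prop where
  ne : π ≠ []
  mem : ∀ P ∈ π, P ∈ 𝓐
  step : ∀ i P Q, π[i]? = some P → π[i + 1]? = some Q → Near G 𝓐 1 P Q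
  sep : ∀ i j P Q n, π[i]? = some P → π[j]? = some Q → Near G 𝓐 n P Q → i ≤ j + n

theorem Geodesic.near (h : Geodesic G 𝓐 π) {i j : ℕ} (hij : i ≤ j) (hP : π[i]? = some P)
    (hQ : π[j]? = some Q) : Near G 𝓐 (j - i) P Q := by
  obtain ⟨k, rfl⟩ := Nat.exists_eq_add_of_le hij
  clear hij
  rw [Nat.add_sub_cancel_left]
  induction k generalizing Q with
  | zero =>
    rw [add_zero, hP] at hQ
    rw [near_zero_iff]
    exact Option.some_injective _ hQ
  | succ k ih =>
    have hlt : i + k < π.length := by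
      have := (List.getElem?_eq_some_iff.1 hQ).1
      omega
    have hk : π[i + k]? = some π[i + k] := List.getElem?_eq_getElem hlt
    exact (ih hk).trans (h.step _ _ _ hk hQ)

theorem Geodesic.index_unique (h : Geodesic G 𝓐 π) {i j : ℕ} (hi : π[i]? = some P)
    (hj : π[j]? = some P) : i = j :=
  le_antisymm (h.sep i j P P 0 hi hj .refl) (h.sep j i P P 0 hj hi .refl)

theorem IsSpine.exists_geodesic {Y : Set V} (h : IsSpine G 𝓡 Y π) :
    Geodesic G 𝓡 π ∧ ∀ y ∈ Y, ∃ P ∈ π, y ∈ P := by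
  obtain ⟨y₁, y₂, r, rfl, hr, p, hp, rfl⟩ := h
  have hget : ∀ i P, p.support[i]? = some P → i ≤ p.length ∧ P = p.getVert i := by
    intro i P h
    have hi : i ≤ p.length := by
      have := (List.getElem?_eq_some_iff.1 h).1
      rw [SimpleGraph.Walk.length_support] at this
      omega
    rw [← p.getVert_eq_support_getElem? hi] at h
    exact ⟨hi, (Option.some_injective _ h).symm⟩
  refine ⟨⟨by simp, ?_, ?_, ?_⟩, ?_⟩
  · have key : ∀ {A B : Set V} (q : (contactGraph G 𝓡).Walk A B), A ∈ 𝓡 →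
        ∀ P ∈ q.support, P ∈ 𝓡 := by
      intro A B q
      induction q with
      | nil => intro hA P hP; simp at hP; rwa [hP]
      | cons hadj q ih =>
        intro hA P hP
        rw [SimpleGraph.Walk.support_cons, List.mem_cons] at hP
        rcases hP with rfl | hP
        exacts [hA, ih hadj.2.2.1 P hP]
    exact key p (hr y₁ (by simp)).1
  · intro i P Q hP hQ
    obtain ⟨-, rfl⟩ := hget _ _ hP
    obtain ⟨hi, rfl⟩ := hget _ _ hQ
    exact near_iff_walk.2 ⟨(p.adj_getVert_succ (by omega)).toWalk, by simp⟩
  · intro i j P Q n hP hQ hPQ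
    obtain ⟨hi, rfl⟩ := hget _ _ hP
    obtain ⟨hj, rfl⟩ := hget _ _ hQ
    obtain ⟨q, hq⟩ := near_iff_walk.1 hPQ
    -- Walking to position `j`, then back along `q` to position `i` and on to the end cannot be
    -- shorter than `p`.
    have := hp ((p.take j).append (q.reverse.append (p.drop i)))
    rw [SimpleGraph.Walk.length_append, SimpleGraph.Walk.length_append,
      SimpleGraph.Walk.length_reverse, SimpleGraph.Walk.take_length,
      SimpleGraph.Walk.drop_length] at this
    omega
  · intro y hy
    rcases hy with rfl | rfl
    · exact ⟨_, p.start_mem_support, (hr _ (by simp)).2⟩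
    · exact ⟨_, p.end_mem_support, (hr _ (by simp)).2⟩

/-- All regions of `𝓐` are close to the shortest path `π`. -/
structure Strip (G : SimpleGraph V) (𝓐 : Set (Set V)) (π : List (Set V)) : Prop
    extends Geodesic G 𝓐 π where
  region : ∀ A ∈ 𝓐, IsRegion G A
  close : ∀ A ∈ 𝓐, ∃ (i : ℕ) (P : Set V), π[i]? = some P ∧ Near G 𝓐 2 A P

theorem Strip.isRegion (h : Strip G 𝓐 π) : IsRegion G (⋃₀ 𝓐) := by
  have h0 : π[0]? = some (π[0]'(List.length_pos_iff.2 h.ne)) := List.getElem?_eq_getElem _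
  set P := π[0]'(List.length_pos_iff.2 h.ne)
  have hP : P ∈ 𝓐 := h.mem P (List.mem_of_getElem? h0)
  obtain ⟨x, hx⟩ := (h.region P hP).nonempty
  refine isRegion_of_center (u := x) ⟨P, hP, hx⟩ ?_
  rintro y ⟨A, hA, hy⟩
  obtain ⟨i, Q, hQ, hAQ⟩ := h.close A hA
  have hball := isRegion_ball h.region hP (i + 2)
  refine (hball.linked ⟨P, ⟨hP, .refl⟩, hx⟩ ⟨A, ⟨hA, ?_⟩, hy⟩).mono
    (Set.sUnion_subset_sUnion fun R hR => hR.1)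
  exact (h.toGeodesic.near (Nat.zero_le i) h0 hQ).trans hAQ.symm

/-- A segment of a geodesic covers a connected set. -/
theorem Geodesic.linked_segment (h : Geodesic G 𝓐 π) (h𝓐 : ∀ A ∈ 𝓐, IsRegion G A) {i j : ℕ}
    (hij : i ≤ j) (hP : π[i]? = some P) (hQ : π[j]? = some Q) (hx : x ∈ P) (hy : y ∈ Q) :
    Linked G {z | ∃ (k : ℕ) (R : Set V), i ≤ k ∧ k ≤ j ∧ π[k]? = some R ∧ z ∈ R} x y := by
  obtain ⟨k, rfl⟩ := Nat.exists_eq_add_of_le hij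
  clear hij
  induction k generalizing Q y with
  | zero =>
    rw [add_zero, hP, Option.some_inj] at hQ
    subst hQ
    exact ((h𝓐 P (h.mem P (List.mem_of_getElem? hP))).linked hx hy).mono
      fun z hz => ⟨i, P, le_rfl, le_rfl, hP, hz⟩
  | succ k ih =>
    have hlt : i + k < π.length := by
      have := (List.getElem?_eq_some_iff.1 hQ).1
      omega
    have hk : π[i + k]? = some π[i + k] := List.getElem?_eq_getElem hlt
    have hreg := h𝓐 _ (h.mem _ (List.mem_of_getElem? hk))
    obtain ⟨a, ha, b, hb, hab⟩ := (h.step _ _ _ hk hQ).touch hreg.nonempty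
    have h1 : Linked G {z | ∃ (l : ℕ) (R : Set V), i ≤ l ∧ l ≤ i + (k + 1) ∧ π[l]? = some R ∧
        z ∈ R} x a := by
      refine Linked.mono ?_ (ih ha hk)
      rintro z ⟨l, R, h1, h2, h3, h4⟩
      exact ⟨l, R, h1, by omega, h3, h4⟩
    have hQsub : Q ⊆ {z | ∃ (l : ℕ) (R : Set V), i ≤ l ∧ l ≤ i + (k + 1) ∧ π[l]? = some R ∧ z ∈ R} :=
      fun z hz => ⟨_, Q, by omega, le_rfl, hQ, hz⟩
    refine h1.trans (Linked.trans ?_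
      (((h𝓐 Q (h.mem Q (List.mem_of_getElem? hQ))).linked hb hy).mono hQsub))
    rcases hab with rfl | hab
    · exact .refl (hQsub hb)
    · exact .of_adj h1.right_mem (hQsub hb) hab

/-! ### Shattering -/

theorem shatter_isRegion (hA : A ∈ shatter G 𝓡 S) : IsRegion G A := by
  obtain ⟨R, -, h | h⟩ := hA <;> exact component_isRegion h

theorem shatter_refines : Refines (shatter G 𝓡 S) 𝓡 := by
  rintro A ⟨R, hR, h | h⟩
  · exact ⟨R, hR, fun x hx => (component_subset h hx).1⟩
  · exact ⟨R, hR, fun x hx => (component_subset h hx).1⟩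

theorem shatter_split (hA : A ∈ shatter G 𝓡 S) : A ⊆ S ∨ Disjoint A S := by
  obtain ⟨R, -, h | h⟩ := hA
  · exact Or.inr (Set.disjoint_left.2 fun x hx => (component_subset h hx).2)
  · exact Or.inl fun x hx => (component_subset h hx).2

theorem mem_shatter_of_subset (hR : R ∈ 𝓡) (hreg : IsRegion G R) (h : R ⊆ S) :
    R ∈ shatter G 𝓡 S :=
  ⟨R, hR, Or.inr (by rw [Set.inter_eq_left.2 h]; exact hreg.mem_components)⟩

theorem mem_shatter_of_disjoint (hR : R ∈ 𝓡) (hreg : IsRegion G R) (h : Disjoint R S) :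
    R ∈ shatter G 𝓡 S :=
  ⟨R, hR, Or.inl (by rw [h.sdiff_eq_left]; exact hreg.mem_components)⟩

theorem exists_mem_shatter (hR : R ∈ 𝓡) (hx : x ∈ R) : ∃ A ∈ shatter G 𝓡 S, x ∈ A := by
  by_cases hxS : x ∈ S
  · obtain ⟨C, hC, hxC⟩ := exists_component (G := G) (A := R ∩ S) ⟨hx, hxS⟩
    exact ⟨C, ⟨R, hR, Or.inr hC⟩, hxC⟩
  · obtain ⟨C, hC, hxC⟩ := exists_component (G := G) (A := R \ S) ⟨hx, hxS⟩
    exact ⟨C, ⟨R, hR, Or.inl hC⟩, hxC⟩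

/-- The pieces that meet a component `K` of `B` are regions that cover `K`. -/
theorem isRegionSet_meeting (hR : ⋃₀ 𝓡 = H) (hBH : B ⊆ H)
    (hB : ∀ A ∈ shatter G 𝓡 S, (A ∩ B).Nonempty → A ⊆ B) (hK : K ∈ components G B) :
    IsRegionSet G K (meeting (shatter G 𝓡 S) K) := by
  refine ⟨fun A hA => shatter_isRegion hA.1, Set.Subset.antisymm ?_ ?_⟩
  · rintro x ⟨A, ⟨hA, y, hyA, hyK⟩, hx⟩
    have hAB := hB A hA ⟨y, hyA, component_subset hK hyK⟩
    exact (shatter_isRegion hA).subset_component hAB hK hyA hyK hx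
  · intro x hx
    have hxH := hBH (component_subset hK hx)
    rw [← hR] at hxH
    obtain ⟨R, hR, hxR⟩ := hxH
    obtain ⟨A, hA, hxA⟩ := exists_mem_shatter (G := G) (S := S) hR hxR
    exact ⟨A, ⟨hA, x, hxA, hx⟩, hxA⟩

/-! ### The supernode of a spine -/

theorem mem_nearSpine : R ∈ nearSpine G 𝓡 π ↔ R ∈ 𝓡 ∧ ∃ P ∈ π, Near G 𝓡 1 R P := by
  simp [nearSpine, Near]

theorem mem_nearSpine_of_mem (hπ : Geodesic G 𝓡 π) (hP : P ∈ π) : P ∈ nearSpine G 𝓡 π :=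
  mem_nearSpine.2 ⟨hπ.mem P hP, P, hP, .refl⟩

theorem nearSpine_subset_carve (h𝓡 : ∀ R ∈ 𝓡, IsRegion G R) :
    nearSpine G 𝓡 π ⊆ (carve G 𝓡 π).regions := by
  intro R hR
  have hR' := mem_nearSpine.1 hR
  have hsub : R ⊆ ⋃₀ nearSpine G 𝓡 π := Set.subset_sUnion_of_mem hR
  obtain ⟨x, hx⟩ := (h𝓡 R hR'.1).nonempty
  exact ⟨mem_shatter_of_subset hR'.1 (h𝓡 R hR'.1) hsub, x, hx, hsub hx⟩

theorem carve_subset (hA : A ∈ (carve G 𝓡 π).regions) : A ⊆ ⋃₀ nearSpine G 𝓡 π := by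
  obtain ⟨hA, x, hx, hxN⟩ := hA
  exact (shatter_split hA).resolve_right fun h => Set.disjoint_left.1 h hx hxN

theorem carve_verts (h𝓡 : ∀ R ∈ 𝓡, IsRegion G R) :
    (carve G 𝓡 π).verts = ⋃₀ nearSpine G 𝓡 π :=
  Set.Subset.antisymm (Set.sUnion_subset fun _ hA => carve_subset hA)
    (Set.sUnion_subset_sUnion (nearSpine_subset_carve h𝓡))

theorem carve_refines : Refines (carve G 𝓡 π).regions 𝓡 := fun A hA => shatter_refines A hA.1

/-- The supernode together with further regions that touch regions near the spine is a strip. -/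
theorem strip_of_touch (h𝓡 : ∀ R ∈ 𝓡, IsRegion G R) (hπ : Geodesic G 𝓡 π)
    (h𝓐 : ∀ A ∈ 𝓐, IsRegion G A) (hsub : nearSpine G 𝓡 π ⊆ 𝓐) (href : Refines 𝓐 𝓡)
    (htouch : ∀ A ∈ 𝓐, Touch G A (⋃₀ nearSpine G 𝓡 π)) : Strip G 𝓐 π where
  ne := hπ.ne
  mem P hP := hsub (mem_nearSpine_of_mem hπ hP)
  step i P Q hP hQ := by
    have hP' := List.mem_of_getElem? hP
    have hQ' := List.mem_of_getElem? hQ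
    exact near_one_of_touch (hsub (mem_nearSpine_of_mem hπ hP'))
      (hsub (mem_nearSpine_of_mem hπ hQ'))
      ((hπ.step i P Q hP hQ).touch (h𝓡 P (hπ.mem P hP')).nonempty)
  sep i j P Q n hP hQ hPQ := by
    have hP' := hπ.mem P (List.mem_of_getElem? hP)
    have hQ' := hπ.mem Q (List.mem_of_getElem? hQ)
    -- The spine stays a geodesic for the finer set because distances do not grow on passing to
    -- larger regions. `Near.lift` fails at distance zero, which is treated apart.
    rcases Nat.eq_zero_or_pos n with rfl | hn
    · rw [near_zero_iff] at hPQ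
      exact hπ.sep i j P Q 0 hP hQ (near_zero_iff.2 hPQ)
    · exact hπ.sep i j P Q n hP hQ
        (hPQ.lift href (h𝓡 P hP').nonempty le_rfl hP' le_rfl hQ' hn)
  region := h𝓐
  close A hA := by
    obtain ⟨a, ha, b, ⟨R, hR, hb⟩, hab⟩ := htouch A hA
    obtain ⟨hR𝓡, P, hP, hRP⟩ := mem_nearSpine.1 hR
    obtain ⟨i, hi⟩ := List.mem_iff_getElem?.1 hP
    refine ⟨i, P, hi, ?_⟩
    exact (near_one_of_touch hA (hsub hR) ⟨a, ha, b, hb, hab⟩).trans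
      (near_one_of_touch (hsub hR) (hsub (mem_nearSpine_of_mem hπ hP))
        (hRP.touch (h𝓡 R hR𝓡).nonempty))

theorem carve_strip (h𝓡 : ∀ R ∈ 𝓡, IsRegion G R) (hπ : Geodesic G 𝓡 π) :
    Strip G (carve G 𝓡 π).regions π := by
  refine strip_of_touch h𝓡 hπ (fun A hA => shatter_isRegion hA.1) (nearSpine_subset_carve h𝓡)
    carve_refines fun A hA => ?_
  obtain ⟨x, hx⟩ := (shatter_isRegion hA.1).nonempty
  exact touch_of_mem hx (carve_subset hA hx)

/-- The spine covers a connected set. -/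
theorem Geodesic.isRegion_spine (hπ : Geodesic G 𝓡 π) (h𝓡 : ∀ R ∈ 𝓡, IsRegion G R) :
    IsRegion G (⋃₀ {P | P ∈ π}) := by
  have h0 : π[0]? = some (π[0]'(List.length_pos_iff.2 hπ.ne)) := List.getElem?_eq_getElem _
  set P := π[0]'(List.length_pos_iff.2 hπ.ne)
  have hP := List.mem_of_getElem? h0
  obtain ⟨x, hx⟩ := (h𝓡 P (hπ.mem P hP)).nonempty
  refine isRegion_of_center (u := x) ⟨P, hP, hx⟩ ?_
  rintro y ⟨Q, hQ, hy⟩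
  obtain ⟨i, hi⟩ := List.mem_iff_getElem?.1 hQ
  refine Linked.mono ?_ (hπ.linked_segment h𝓡 (Nat.zero_le i) h0 hi hx hy)
  rintro z ⟨_, R, -, -, hR, hz⟩
  exact ⟨R, List.mem_of_getElem? hR, hz⟩

end Contact

end RegionClustering

/-! ### The recursion of `SelectPaths` -/

namespace RegionClustering

section Layout

variable {V : Type u} {G : SimpleGraph V} {E : PlaneEmbedding G} {X H W Y Z L K N : Set V}
  {𝓡 out : Set (Set V)} {𝓢 : Set (Supernode V)} {anc : Supernode V → Supernode V → Prop}
  {π : List (Set V)} {S : Supernode V} {A B C Q R : Set V} {u v w x y : V}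

/-! ### One call of `SelectPaths` -/

theorem IsCriticalSet.isOuterVertex (hY : IsCriticalSet E X H W Y) (hy : y ∈ Y) :
    E.IsOuterVertex X y := by
  rcases hY with ⟨-, z, hz, rfl⟩ | ⟨-, rfl⟩
  · rwa [Set.mem_singleton_iff.1 hy]
  · obtain ⟨-, w, -, hyX, hwX, d, rfl, rfl, hd | hd⟩ := hy
    · exact ⟨hyX, Or.inl ⟨d, rfl, hd⟩⟩
    -- If only the reverse dart is known to be outside, the dart after it on the same face starts at
    -- the right vertex.
    · exact ⟨hyX, Or.inl ⟨E.facePerm d.symm, E.facePerm_fst _, .face _ hd⟩⟩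

/-- A call of `SelectPaths` together with its choices. -/
structure Step (E : PlaneEmbedding G) (X H W : Set V) (𝓡 : Set (Set V)) (Y : Set V)
    (π : List (Set V)) (S : Supernode V) : Prop where
  conn : G.Connected
  region : IsRegion G X
  inv : CallInv E X H W 𝓡
  critical : IsCriticalSet E X H W Y
  spine : IsSpine G 𝓡 Y π
  carved : S = carve G 𝓡 π

namespace Step

variable (h : Step E X H W 𝓡 Y π S)

include h

theorem geodesic : Geodesic G 𝓡 π := h.spine.exists_geodesic.1

theorem isRegion_of_mem (hR : R ∈ 𝓡) : IsRegion G R := h.inv.regions.1 R hR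

theorem subset_of_mem (hR : R ∈ 𝓡) : R ⊆ H := by
  rw [← h.inv.regions.2]
  exact Set.subset_sUnion_of_mem hR

theorem verts_eq : S.verts = ⋃₀ nearSpine G 𝓡 π := by
  rw [h.carved]
  exact carve_verts h.inv.regions.1

theorem verts_subset : S.verts ⊆ H := by
  rw [h.verts_eq]
  exact Set.sUnion_subset fun R hR => h.subset_of_mem (mem_nearSpine.1 hR).1

theorem verts_isRegion : IsRegion G S.verts := by
  rw [h.carved]
  exact (carve_strip h.inv.regions.1 h.geodesic).isRegion

theorem spine_subset : ⋃₀ {P | P ∈ π} ⊆ S.verts := by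
  rw [h.verts_eq]
  exact Set.sUnion_subset_sUnion fun P hP => mem_nearSpine_of_mem h.geodesic hP

theorem critical_subset : Y ⊆ ⋃₀ {P | P ∈ π} := fun y hy => by
  obtain ⟨P, hP, hyP⟩ := h.spine.exists_geodesic.2 y hy
  exact ⟨P, hP, hyP⟩

theorem exists_outer : ∃ y ∈ S.verts, E.IsOuterVertex X y := by
  obtain ⟨y₁, y₂, r, hY, -⟩ := h.spine
  have hy : y₁ ∈ Y := by rw [hY]; simp
  exact ⟨y₁, h.spine_subset (h.critical_subset hy), h.critical.isOuterVertex hy⟩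

/-- Regions that are not absorbed avoid the spine. -/
theorem disjoint_spine (hR : R ∈ 𝓡) (hRN : ¬ R ⊆ S.verts) : Disjoint R (⋃₀ {P | P ∈ π}) := by
  rw [Set.disjoint_left]
  rintro x hx ⟨P, hP, hxP⟩
  refine hRN ?_
  rw [h.verts_eq]
  exact Set.subset_sUnion_of_mem (mem_nearSpine.2 ⟨hR, P, hP,
    near_one_of_touch hR (h.geodesic.mem P hP) (touch_of_mem hx hxP)⟩)

theorem shatter_subset (hA : A ∈ shatter G 𝓡 S.verts) : A ⊆ H := by
  obtain ⟨R, hR, hAR⟩ := shatter_refines A hA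
  exact hAR.trans (h.subset_of_mem hR)

variable [Finite V]

/-- The separator is the spine alone, not the whole supernode, so the result also applies to
connected sets that meet the supernode. -/
theorem not_adj_prev (hB : IsRegion G B) (hBH : B ⊆ H) (hBπ : Disjoint B (⋃₀ {P | P ∈ π}))
    (hBo : ∃ v ∈ B, E.IsOuterVertex X v) : ∀ x ∈ B, ∀ w ∈ W, ¬ G.Adj x w := by
  have hsub : B ⊆ H \ ⋃₀ {P | P ∈ π} := fun x hx => ⟨hBH hx, Set.disjoint_left.1 hBπ hx⟩
  obtain ⟨L, hL, hBL⟩ := hB.exists_component hsub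
  obtain ⟨v, hv, hvo⟩ := hBo
  intro x hx
  exact h.inv.separation h.conn h.region h.critical (h.spine_subset.trans h.verts_subset)
    (h.geodesic.isRegion_spine h.inv.regions.1) h.critical_subset hL ⟨v, hBL hv, hvo⟩ x (hBL hx)

theorem component_not_adj_prev (hK : K ∈ components G (H \ S.verts))
    (hKo : ∃ v ∈ K, E.IsOuterVertex X v) : ∀ x ∈ K, ∀ w ∈ W, ¬ G.Adj x w :=
  h.not_adj_prev (component_isRegion hK) (fun _ hx => (component_subset hK hx).1)
    (Set.disjoint_left.2 fun _ hx hx' => (component_subset hK hx).2 (h.spine_subset hx')) hKo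

omit [Finite V] in
theorem regionSet_child (hK : K ∈ components G (H \ S.verts)) :
    IsRegionSet G K (meeting (shatter G 𝓡 S.verts) K) := by
  refine isRegionSet_meeting h.inv.regions.2 Set.sdiff_subset (fun A hA hAB x hx => ?_) hK
  obtain ⟨y, hy, -, hyN⟩ := hAB
  exact ⟨h.shatter_subset hA hx,
    Set.disjoint_left.1 ((shatter_split hA).resolve_left fun h' => hyN (h' hy)) hx⟩

/-- Separation removes all adjacency to the old `W`, so the new supernode alone borders `K`. -/
theorem child (hK : K ∈ components G (H \ S.verts)) (hKo : ∃ v ∈ K, E.IsOuterVertex X v) :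
    CallInv E X K S.verts (meeting (shatter G 𝓡 S.verts) K) where
  sub x hx := h.inv.sub (component_subset hK hx).1
  conn := component_isRegion hK
  regions := h.regionSet_child hK
  boundary x hx y hyX hyK hadj := by
    by_contra hyN
    by_cases hyH : y ∈ H
    · exact hyK (component_closed hK hx ⟨hyH, hyN⟩ hadj)
    · exact h.component_not_adj_prev hK hKo x hx y
        (h.inv.boundary x (component_subset hK hx).1 y hyX hyH hadj) hadj
  outer := hKo
  prev := Or.inr ⟨h.verts_subset.trans h.inv.sub,
    Set.disjoint_left.2 fun _ hx hxK => (component_subset hK hxK).2 hx,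
    h.verts_isRegion, h.exists_outer⟩

end Step

theorem exists_isSpine (h𝓡 : IsRegionSet G H 𝓡) (hH : IsRegion G H) {y₁ y₂ : V}
    (hy₁ : y₁ ∈ H) (hy₂ : y₂ ∈ H) : ∃ π, IsSpine G 𝓡 {y₁, y₂} π := by
  have hex : ∀ y : V, ∃ R : Set V, y ∈ H → R ∈ 𝓡 ∧ y ∈ R := by
    intro y
    by_cases hy : y ∈ H
    · rw [← h𝓡.2] at hy
      obtain ⟨R, hR, hyR⟩ := hy
      exact ⟨R, fun _ => ⟨hR, hyR⟩⟩
    · exact ⟨∅, fun h => absurd h hy⟩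
  choose r hr using hex
  have hreach : (contactGraph G 𝓡).Reachable (r y₁) (r y₂) := by
    have hstep : ∀ {A B}, A ∈ 𝓡 → B ∈ 𝓡 → Touch G A B → (contactGraph G 𝓡).Reachable A B := by
      intro A B hA hB h
      obtain ⟨p, -⟩ := near_iff_walk.1 (near_one_of_touch hA hB h)
      exact ⟨p⟩
    have hmem : y₂ ∈ {y | ∃ R ∈ 𝓡, y ∈ R ∧ (contactGraph G 𝓡).Reachable (r y₁) R} := by
      refine (hH.linked hy₁ hy₂).mem_of_closed ⟨r y₁, (hr y₁ hy₁).1, (hr y₁ hy₁).2, .rfl⟩ ?_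
      rintro x ⟨R, hR, hxR, hreach⟩ hx y hy hadj
      exact ⟨r y, (hr y hy).1, (hr y hy).2,
        hreach.trans (hstep hR (hr y hy).1 ⟨x, hxR, y, (hr y hy).2, Or.inr hadj⟩)⟩
    obtain ⟨R, hR, hyR, h⟩ := hmem
    exact h.trans (hstep hR (hr y₂ hy₂).1 (touch_of_mem hyR (hr y₂ hy₂).2))
  obtain ⟨p, hp⟩ := hreach.exists_walk_length_eq_dist
  refine ⟨p.support, y₁, y₂, r, rfl, ?_, p, fun q => ?_, rfl⟩
  · rintro y (rfl | rfl)
    exacts [hr _ hy₁, hr _ hy₂]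
  · rw [hp]
    exact SimpleGraph.dist_le q

/-- Induction on the size of `H`: a component of the rest misses the nonempty supernode. -/
theorem exists_selectPaths [Finite V] (hG : G.Connected) (hX : IsRegion G X)
    (hI : CallInv E X H W 𝓡) : ∃ out 𝓢 anc, SelectPaths E X H W 𝓡 out 𝓢 anc := by
  induction hn : H.ncard using Nat.strong_induction_on generalizing H W 𝓡 with
  | _ n ih =>
  subst hn
  obtain ⟨y₁, hy₁, y₂, hy₂, hY⟩ := hI.exists_criticalSet hG hX
  obtain ⟨π, hπ⟩ := exists_isSpine hI.regions hI.conn hy₁ hy₂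
  have hs : Step E X H W 𝓡 {y₁, y₂} π (carve G 𝓡 π) := ⟨hG, hX, hI, hY, hπ, rfl⟩
  set S := carve G 𝓡 π
  have hex : ∀ K : Set V, ∃ out 𝓢 anc, K ∈ components G (H \ S.verts) →
      ((∃ v ∈ K, E.IsOuterVertex X v) →
        SelectPaths E X K S.verts (meeting (shatter G 𝓡 S.verts) K) out 𝓢 anc) ∧
      ((¬ ∃ v ∈ K, E.IsOuterVertex X v) →
        out = meeting (shatter G 𝓡 S.verts) K ∧ 𝓢 = ∅ ∧ ∀ A B, ¬ anc A B) := by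
    intro K
    by_cases hK : K ∈ components G (H \ S.verts)
    swap
    · exact ⟨∅, ∅, fun _ _ => False, fun h => absurd h hK⟩
    by_cases hKo : ∃ v ∈ K, E.IsOuterVertex X v
    swap
    · exact ⟨_, ∅, fun _ _ => False, fun _ => ⟨fun h => absurd h hKo, fun _ => ⟨rfl, rfl,
        fun _ _ => id⟩⟩⟩
    have hlt : K.ncard < H.ncard := by
      refine Set.ncard_lt_ncard ⟨fun x hx => (component_subset hK hx).1, fun hHK => ?_⟩
      obtain ⟨x, hx⟩ := hs.verts_isRegion.nonempty
      exact (component_subset hK (hHK (hs.verts_subset hx))).2 hx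
    obtain ⟨out, 𝓢, anc, h⟩ := ih _ hlt (hs.child hK hKo) rfl
    exact ⟨out, 𝓢, anc, fun _ => ⟨fun _ => h, fun h => absurd hKo h⟩⟩
  choose out 𝓢 anc h using hex
  exact ⟨_, _, _, SelectPaths.run H W 𝓡 {y₁, y₂} π S _ out 𝓢 anc hY hπ rfl rfl
    (fun K hK hKo => by rw [← hs.verts_eq]; exact (h K hK).1 hKo)
    (fun K hK hKo => by rw [← hs.verts_eq]; exact (h K hK).2 hKo)⟩

/-! ### The structure of the output -/

/-- There is an edge between `A` and `B`. -/
def AdjSet (G : SimpleGraph V) (A B : Set V) : Prop := ∃ a ∈ A, ∃ b ∈ B, G.Adj a b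

theorem AdjSet.mono (h : AdjSet G A B) (hA : A ⊆ C) (hB : B ⊆ Q) : AdjSet G C Q := by
  obtain ⟨a, ha, b, hb, h⟩ := h
  exact ⟨a, hA ha, b, hB hb, h⟩

/-- A region of the output that belongs to no supernode. -/
def IsLeaf (out : Set (Set V)) (𝓢 : Set (Supernode V)) (A : Set V) : Prop :=
  A ∈ out ∧ ∀ T ∈ 𝓢, Disjoint A T.verts

/-- The region `Q` of `𝓡` meets `N`, and outside `N` it falls into pieces next to `N` that
satisfy `P`. -/
def Splits (G : SimpleGraph V) (P : Set V → Prop) (N Q : Set V) : Prop :=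
  (Q ∩ N).Nonempty ∧
    ∀ x ∈ Q, x ∈ N ∨ ∃ Q' ⊆ Q, x ∈ Q' ∧ IsRegion G Q' ∧ P Q' ∧ AdjSet G Q' (Q ∩ N)

/-- The structure of the output of `SelectPaths`.  The set `ρ T` consists of the regions in the
call that created `T`, and `S₀` is the first supernode. -/
structure Layout (E : PlaneEmbedding G) (X H W : Set V) (𝓡 out : Set (Set V))
    (𝓢 : Set (Supernode V)) (anc : Supernode V → Supernode V → Prop) (S₀ : Supernode V)
    (ρ : Supernode V → Set (Set V)) : Prop where
  finite : 𝓢.Finite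
  carved : ∀ T ∈ 𝓢, T = carve G (ρ T) T.spine
  geodesic : ∀ T ∈ 𝓢, Geodesic G (ρ T) T.spine
  isRegion : ∀ T ∈ 𝓢, ∀ R ∈ ρ T, IsRegion G R
  support : ∀ T ∈ 𝓢, ⋃₀ ρ T ⊆ H
  refines : ∀ T ∈ 𝓢, Refines (ρ T) 𝓡
  disjoint : ∀ T ∈ 𝓢, ∀ T' ∈ 𝓢, T ≠ T' → Disjoint T.verts T'.verts
  exists_outer : ∀ T ∈ 𝓢, ∃ y ∈ T.verts, E.IsOuterVertex X y
  cover_outer : ∀ v ∈ H, E.IsOuterVertex X v → ∃ T ∈ 𝓢, v ∈ T.verts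
  anc_lt : ∀ A B, anc A B → A ∈ 𝓢 ∧ B ∈ 𝓢 ∧ (⋃₀ ρ B).ncard < (⋃₀ ρ A).ncard
  out_isRegion : ∀ A ∈ out, IsRegion G A
  out_refines : Refines out 𝓡
  regions_subset : ∀ T ∈ 𝓢, T.regions ⊆ out
  out_split : ∀ A ∈ out, (∃ T ∈ 𝓢, A ∈ T.regions) ∨ ∀ T ∈ 𝓢, Disjoint A T.verts
  adj_prev : ∀ K ⊆ H, IsRegion G K → (∀ T ∈ 𝓢, Disjoint K T.verts) → AdjSet G K W →
    ∀ T ∈ 𝓢, AdjSet G K T.verts → T = S₀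
  adj_two : ∀ K ⊆ H, IsRegion G K → (∀ T ∈ 𝓢, Disjoint K T.verts) →
    ∃ T₁ T₂ : Supernode V, ∀ T ∈ 𝓢, AdjSet G K T.verts → T = T₁ ∨ T = T₂
  adj_anc : ∀ K ⊆ H, IsRegion G K → (∀ T ∈ 𝓢, Disjoint K T.verts) →
    ∀ T ∈ 𝓢, ∀ T' ∈ 𝓢, AdjSet G K T.verts → AdjSet G K T'.verts → T ≠ T' →
      (anc T T' ∧ Refines (ρ T') (ρ T)) ∨ (anc T' T ∧ Refines (ρ T) (ρ T'))
  leaf_refines : ∀ K ⊆ H, IsRegion G K → (∀ T ∈ 𝓢, Disjoint K T.verts) →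
    ∀ A ∈ out, A ⊆ K → ∀ T ∈ 𝓢, AdjSet G K T.verts → ∃ R ∈ ρ T, A ⊆ R
  split_prev : ∀ Q ∈ 𝓡, AdjSet G Q W → IsLeaf out 𝓢 Q ∨
    (S₀ ∈ 𝓢 ∧ Q ∈ ρ S₀ ∧ Splits G (IsLeaf out 𝓢) S₀.verts Q)
  split : ∀ R ∈ 𝓡, IsLeaf out 𝓢 R ∨ ∃ T ∈ 𝓢, R ∈ ρ T ∧
    Splits G (fun Q => IsLeaf out 𝓢 Q ∨
      ∃ T' ∈ 𝓢, Q ∈ ρ T' ∧ Splits G (IsLeaf out 𝓢) T'.verts Q) T.verts R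

theorem Splits.imp {P P' : Set V → Prop} (h : Splits G P N Q) (hP : ∀ A, P A → P' A) :
    Splits G P' N Q :=
  ⟨h.1, fun x hx => (h.2 x hx).imp_right fun ⟨Q', h1, h2, h3, h4, h5⟩ =>
    ⟨Q', h1, h2, h3, hP _ h4, h5⟩⟩

/-- The components without outer vertices yield no supernodes. -/
theorem layout_of_no_outer (h𝓡 : IsRegionSet G K 𝓡) (hK : ¬ ∃ v ∈ K, E.IsOuterVertex X v)
    (hanc : ∀ A B, ¬ anc A B) (S₀ : Supernode V) (ρ : Supernode V → Set (Set V)) :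
    Layout E X K W 𝓡 𝓡 ∅ anc S₀ ρ where
  finite := Set.finite_empty
  carved _ h := h.elim
  geodesic _ h := h.elim
  isRegion _ h := h.elim
  support _ h := h.elim
  refines _ h := h.elim
  disjoint _ h := h.elim
  exists_outer _ h := h.elim
  cover_outer v hv hvo := absurd ⟨v, hv, hvo⟩ hK
  anc_lt A B h := absurd h (hanc A B)
  out_isRegion := h𝓡.1
  out_refines := .refl
  regions_subset _ h := h.elim
  out_split _ _ := Or.inr fun _ h => h.elim
  adj_prev _ _ _ _ _ _ h := h.elim
  adj_two _ _ _ _ := ⟨S₀, S₀, fun _ h => h.elim⟩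
  adj_anc _ _ _ _ _ h := h.elim
  leaf_refines _ _ _ _ _ _ _ _ h := h.elim
  split_prev _ hQ _ := Or.inl ⟨hQ, fun _ h => h.elim⟩
  split _ hR := Or.inl ⟨hR, fun _ h => h.elim⟩

end Layout

end RegionClustering

/-! ### Assembling the structure of the output of `SelectPaths` -/

namespace RegionClustering

section Layout

variable {V : Type u} {G : SimpleGraph V} {E : PlaneEmbedding G} {X H W Y Z L K N : Set V}
  {𝓡 out : Set (Set V)} {𝓢 : Set (Supernode V)} {anc : Supernode V → Supernode V → Prop}
  {π : List (Set V)} {S S₀ T : Supernode V} {A B C Q R : Set V} {u v w x y : V}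
  {ρ : Supernode V → Set (Set V)}

namespace Layout

variable (hL : Layout E X H W 𝓡 out 𝓢 anc S₀ ρ)

include hL

theorem verts_eq (hT : T ∈ 𝓢) : T.verts = ⋃₀ nearSpine G (ρ T) T.spine := by
  conv_lhs => rw [hL.carved T hT]
  exact carve_verts (hL.isRegion T hT)

theorem strip (hT : T ∈ 𝓢) : Strip G T.regions T.spine := by
  have h := carve_strip (hL.isRegion T hT) (hL.geodesic T hT)
  rwa [← hL.carved T hT] at h

theorem verts_isRegion (hT : T ∈ 𝓢) : IsRegion G T.verts := (hL.strip hT).isRegion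

theorem verts_subset_support (hT : T ∈ 𝓢) : T.verts ⊆ ⋃₀ ρ T := by
  rw [hL.verts_eq hT]
  exact Set.sUnion_subset_sUnion fun R hR => (mem_nearSpine.1 hR).1

theorem verts_subset (hT : T ∈ 𝓢) : T.verts ⊆ H :=
  (hL.verts_subset_support hT).trans (hL.support T hT)

end Layout

/-- The output of a call is assembled from the outputs for the components. -/
theorem Step.layout (h : Step E X H W 𝓡 Y π S) [Finite V]
    {out : Set V → Set (Set V)} {𝓢 : Set V → Set (Supernode V)}
    {anc : Set V → Supernode V → Supernode V → Prop} {S₀ : Set V → Supernode V}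
    {ρ : Set V → Supernode V → Set (Set V)}
    (hc : ∀ K ∈ components G (H \ S.verts), Layout E X K S.verts
      (meeting (shatter G 𝓡 S.verts) K) (out K) (𝓢 K) (anc K) (S₀ K) (ρ K))
    (hleaf : ∀ K ∈ components G (H \ S.verts), (¬ ∃ v ∈ K, E.IsOuterVertex X v) →
      out K = meeting (shatter G 𝓡 S.verts) K ∧ 𝓢 K = ∅) :
    ∃ ρ', Layout E X H W 𝓡 (S.regions ∪ ⋃ K ∈ components G (H \ S.verts), out K)
      ({S} ∪ ⋃ K ∈ components G (H \ S.verts), 𝓢 K)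
      (fun A B => (A = S ∧ ∃ K ∈ components G (H \ S.verts), B ∈ 𝓢 K) ∨
          ∃ K ∈ components G (H \ S.verts), anc K A B) S ρ' := by
  set κ := components G (H \ S.verts) with hκ
  have hKH : ∀ {K}, K ∈ κ → K ⊆ H := fun hK x hx => (component_subset hK hx).1
  have hKN : ∀ {K}, K ∈ κ → Disjoint K S.verts := fun hK =>
    Set.disjoint_left.2 fun x hx => (component_subset hK hx).2
  have hKK : ∀ {K K' x}, K ∈ κ → K' ∈ κ → x ∈ K → x ∈ K' → K = K' := component_eq
  have hTne : ∀ {K T}, K ∈ κ → T ∈ 𝓢 K → T.verts.Nonempty := fun hK hT =>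
    ((hc _ hK).verts_isRegion hT).nonempty
  have hTK : ∀ {K T}, K ∈ κ → T ∈ 𝓢 K → T.verts ⊆ K := fun hK hT => (hc _ hK).verts_subset hT
  have hSK : ∀ {K T}, K ∈ κ → T ∈ 𝓢 K → T ≠ S := by
    rintro K T hK hT rfl
    obtain ⟨x, hx⟩ := hTne hK hT
    exact Set.disjoint_left.1 (hKN hK) (hTK hK hT hx) hx
  have hTuniq : ∀ {K K' T}, K ∈ κ → K' ∈ κ → T ∈ 𝓢 K → T ∈ 𝓢 K' → K = K' := by
    intro K K' T hK hK' hT hT'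
    obtain ⟨x, hx⟩ := hTne hK hT
    exact hKK hK hK' (hTK hK hT hx) (hTK hK' hT' hx)
  have hmem : ∀ {T}, T ∈ {S} ∪ ⋃ K ∈ κ, 𝓢 K ↔ T = S ∨ ∃ K ∈ κ, T ∈ 𝓢 K := by
    intro T; simp
  have hmemS : ∀ {K T}, K ∈ κ → T ∈ 𝓢 K → T ∈ {S} ∪ ⋃ K ∈ κ, 𝓢 K := fun hK hT =>
    hmem.2 (Or.inr ⟨_, hK, hT⟩)
  have hout : ∀ {A}, A ∈ S.regions ∪ ⋃ K ∈ κ, out K ↔ A ∈ S.regions ∨ ∃ K ∈ κ, A ∈ out K := by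
    intro A; simp
  -- The families of the components can be glued because a supernode has a nonempty vertex set
  -- inside its component, so it occurs in only one of them.
  let ρ' : Supernode V → Set (Set V) := fun T =>
    {R | (T = S ∧ R ∈ 𝓡) ∨ ∃ K ∈ κ, T ∈ 𝓢 K ∧ R ∈ ρ K T}
  have hρS : ρ' S = 𝓡 := by
    ext R
    constructor
    · rintro (h | ⟨K, hK, hT, -⟩)
      · exact h.2
      · exact absurd rfl (hSK hK hT)
    · exact fun h => Or.inl ⟨rfl, h⟩
  have hρK : ∀ {K T}, K ∈ κ → T ∈ 𝓢 K → ρ' T = ρ K T := by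
    intro K T hK hT
    ext R
    constructor
    · rintro (h | ⟨K', hK', hT', hR⟩)
      · exact absurd h.1 (hSK hK hT)
      · rwa [hTuniq hK hK' hT hT']
    · exact fun h => Or.inr ⟨K, hK, hT, h⟩
  have hSregions : S = carve G 𝓡 S.spine := by
    conv_lhs => rw [h.carved]
    rw [h.carved]
    rfl
  have hSspine : S.spine = π := by rw [h.carved]; rfl
  have hpieces : Refines (shatter G 𝓡 S.verts) 𝓡 := shatter_refines
  have hmeet : ∀ {K}, Refines (meeting (shatter G 𝓡 S.verts) K) 𝓡 := fun A hA =>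
    hpieces A hA.1
  have houtK : ∀ {K A}, K ∈ κ → A ∈ out K → A ⊆ K := by
    intro K A hK hA
    obtain ⟨R, hR, hAR⟩ := (hc K hK).out_refines A hA
    rw [← (h.regionSet_child hK).2]
    exact hAR.trans (Set.subset_sUnion_of_mem hR)
  have hadjK : ∀ {K K' A B}, K ∈ κ → K' ∈ κ → A ⊆ K → B ⊆ K' → AdjSet G A B → K = K' := by
    rintro K K' A B hK hK' hA hB ⟨a, ha, b, hb, hab⟩
    exact hKK hK hK' (component_closed hK (hA ha) (component_subset hK' (hB hb)) hab) (hB hb)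
  have hfind : ∀ {B}, B ⊆ H → IsRegion G B → (∀ T ∈ {S} ∪ ⋃ K ∈ κ, 𝓢 K, Disjoint B T.verts) →
      ∃ K ∈ κ, B ⊆ K ∧ ∀ T ∈ 𝓢 K, Disjoint B T.verts := by
    intro B hBH hB hdisj
    have hBN := hdisj S (hmem.2 (Or.inl rfl))
    obtain ⟨K, hK, hBK⟩ := hB.exists_component (A := H \ S.verts)
      fun x hx => ⟨hBH hx, Set.disjoint_left.1 hBN hx⟩
    exact ⟨K, hK, hBK, fun T hT => hdisj T (hmemS hK hT)⟩
  have hadjT : ∀ {K B T}, K ∈ κ → B ⊆ K → T ∈ {S} ∪ ⋃ K ∈ κ, 𝓢 K → AdjSet G B T.verts →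
      T = S ∨ T ∈ 𝓢 K := by
    intro K B T hK hBK hT hadj
    rcases hmem.1 hT with hT | ⟨K', hK', hT⟩
    · exact Or.inl hT
    · rw [hadjK hK hK' hBK (hTK hK' hT) hadj]
      exact Or.inr hT
  have hlift : ∀ {K Q}, K ∈ κ → IsLeaf (out K) (𝓢 K) Q →
      IsLeaf (S.regions ∪ ⋃ K ∈ κ, out K) ({S} ∪ ⋃ K ∈ κ, 𝓢 K) Q := by
    intro K Q hK hQ
    have hQK := houtK hK hQ.1
    refine ⟨hout.2 (Or.inr ⟨K, hK, hQ.1⟩), fun T hT => ?_⟩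
    rcases hmem.1 hT with rfl | ⟨K', hK', hT⟩
    · exact (hKN hK).mono_left hQK
    · by_cases hKK' : K = K'
      · subst hKK'
        exact hQ.2 T hT
      · exact (component_disjoint hK hK' hKK').mono hQK (hTK hK' hT)
  have hpiece : ∀ {A B}, IsRegion G B → B ⊆ A → A ∈ 𝓡 → Disjoint B S.verts →
      B ∈ shatter G 𝓡 S.verts → ∃ K ∈ κ, B ⊆ K ∧ B ∈ meeting (shatter G 𝓡 S.verts) K := by
    intro A B hB hBA hA hBN hBs
    obtain ⟨K, hK, hBK⟩ := hB.exists_component (A := H \ S.verts)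
      fun x hx => ⟨h.subset_of_mem hA (hBA hx), Set.disjoint_left.1 hBN hx⟩
    obtain ⟨x, hx⟩ := hB.nonempty
    exact ⟨K, hK, hBK, hBs, x, hx, hBK hx⟩
  have hdiffDisj : ∀ {A C : Set V}, C ∈ components G (A \ S.verts) → Disjoint C S.verts :=
    fun hC => Set.disjoint_left.2 fun x hx => (component_subset hC hx).2
  refine ⟨ρ', ?_⟩
  constructor
  case finite =>
    refine (Set.finite_singleton S).union (Set.Finite.biUnion (Set.toFinite _) fun K hK => ?_)
    exact (hc K hK).finite
  case carved =>
    intro T hT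
    rcases hmem.1 hT with rfl | ⟨K, hK, hT⟩
    · rwa [hρS]
    · rw [hρK hK hT]; exact (hc K hK).carved T hT
  case geodesic =>
    intro T hT
    rcases hmem.1 hT with rfl | ⟨K, hK, hT⟩
    · rw [hρS, hSspine]; exact h.geodesic
    · rw [hρK hK hT]; exact (hc K hK).geodesic T hT
  case isRegion =>
    intro T hT
    rcases hmem.1 hT with rfl | ⟨K, hK, hT⟩
    · rw [hρS]; exact h.inv.regions.1
    · rw [hρK hK hT]; exact (hc K hK).isRegion T hT
  case support =>
    intro T hT
    rcases hmem.1 hT with rfl | ⟨K, hK, hT⟩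
    · rw [hρS]; exact h.inv.regions.2.le
    · rw [hρK hK hT]; exact ((hc K hK).support T hT).trans (hKH hK)
  case refines =>
    intro T hT
    rcases hmem.1 hT with rfl | ⟨K, hK, hT⟩
    · rw [hρS]; exact .refl
    · rw [hρK hK hT]; exact ((hc K hK).refines T hT).trans hmeet
  case disjoint =>
    intro T hT T' hT' hne
    rcases hmem.1 hT with rfl | ⟨K, hK, hT₁⟩ <;> rcases hmem.1 hT' with rfl | ⟨K', hK', hT₁'⟩
    · exact absurd rfl hne
    · exact ((hKN hK').mono_left (hTK hK' hT₁')).symm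
    · exact (hKN hK).mono_left (hTK hK hT₁)
    · by_cases hKK' : K = K'
      · subst hKK'
        exact (hc K hK).disjoint T hT₁ T' hT₁' hne
      · exact (component_disjoint hK hK' hKK').mono (hTK hK hT₁) (hTK hK' hT₁')
  case exists_outer =>
    intro T hT
    rcases hmem.1 hT with rfl | ⟨K, hK, hT⟩
    · exact h.exists_outer
    · exact (hc K hK).exists_outer T hT
  case cover_outer =>
    intro v hv hvo
    by_cases hvN : v ∈ S.verts
    · exact ⟨S, hmem.2 (Or.inl rfl), hvN⟩
    · obtain ⟨K, hK, hvK⟩ := exists_component (G := G) (A := H \ S.verts) ⟨hv, hvN⟩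
      obtain ⟨T, hT, hvT⟩ := (hc K hK).cover_outer v hvK hvo
      exact ⟨T, hmemS hK hT, hvT⟩
  -- Supports shrink strictly because descendants avoid the vertices of `S`. The sizes later serve
  -- as a sort key that puts ancestors first.
  case anc_lt =>
    rintro A B (⟨rfl, K, hK, hB⟩ | ⟨K, hK, hAB⟩)
    · refine ⟨hmem.2 (Or.inl rfl), hmemS hK hB, ?_⟩
      rw [hρS, hρK hK hB, h.inv.regions.2]
      refine Set.ncard_lt_ncard ⟨((hc K hK).support B hB).trans (hKH hK), fun hle => ?_⟩
      obtain ⟨x, hx⟩ := h.verts_isRegion.nonempty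
      exact Set.disjoint_left.1 (hKN hK) ((hc K hK).support B hB (hle (h.verts_subset hx))) hx
    · obtain ⟨hA, hB, hlt⟩ := (hc K hK).anc_lt A B hAB
      exact ⟨hmemS hK hA, hmemS hK hB, by rwa [hρK hK hA, hρK hK hB]⟩
  case out_isRegion =>
    intro A hA
    rcases hout.1 hA with hA | ⟨K, hK, hA⟩
    · rw [h.carved] at hA
      exact shatter_isRegion hA.1
    · exact (hc K hK).out_isRegion A hA
  case out_refines =>
    intro A hA
    rcases hout.1 hA with hA | ⟨K, hK, hA⟩
    · rw [h.carved] at hA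
      exact carve_refines A hA
    · exact ((hc K hK).out_refines.trans hmeet) A hA
  case regions_subset =>
    intro T hT A hA
    rcases hmem.1 hT with rfl | ⟨K, hK, hT⟩
    · exact hout.2 (Or.inl hA)
    · exact hout.2 (Or.inr ⟨K, hK, (hc K hK).regions_subset T hT hA⟩)
  case out_split =>
    intro A hA
    rcases hout.1 hA with hA | ⟨K, hK, hA⟩
    · exact Or.inl ⟨S, hmem.2 (Or.inl rfl), hA⟩
    · rcases (hc K hK).out_split A hA with ⟨T, hT, hAT⟩ | hdisj
      · exact Or.inl ⟨T, hmemS hK hT, hAT⟩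
      · exact Or.inr (hlift hK ⟨hA, hdisj⟩).2
  -- A component adjacent to `W` has no outer vertex, hence no supernodes of its own; only `S`
  -- remains.
  case adj_prev =>
    intro B hBH hB hdisj hBW T hT hBT
    obtain ⟨K, hK, hBK, hdK⟩ := hfind hBH hB hdisj
    refine (hadjT hK hBK hT hBT).resolve_right fun hT => ?_
    have hKo : ∃ v ∈ K, E.IsOuterVertex X v := by
      by_contra hno
      rw [(hleaf K hK hno).2] at hT
      exact hT
    obtain ⟨a, ha, w, hw, hadj⟩ := hBW
    exact h.component_not_adj_prev hK hKo a (hBK ha) w hw hadj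
  -- If `B` touches `S`, then `adj_prev` in its component leaves only the first supernode there.
  -- Otherwise all neighbours come from the component.
  case adj_two =>
    intro B hBH hB hdisj
    obtain ⟨K, hK, hBK, hdK⟩ := hfind hBH hB hdisj
    by_cases hBS : AdjSet G B S.verts
    · refine ⟨S, S₀ K, fun T hT hBT => (hadjT hK hBK hT hBT).imp_right fun hT => ?_⟩
      exact (hc K hK).adj_prev B hBK hB hdK hBS T hT hBT
    · obtain ⟨T₁, T₂, h12⟩ := (hc K hK).adj_two B hBK hB hdK
      refine ⟨T₁, T₂, fun T hT hBT => ?_⟩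
      rcases hadjT hK hBK hT hBT with rfl | hT
      · exact absurd hBT hBS
      · exact h12 T hT hBT
  case adj_anc =>
    intro B hBH hB hdisj T hT T' hT' hBT hBT' hne
    obtain ⟨K, hK, hBK, hdK⟩ := hfind hBH hB hdisj
    rcases hadjT hK hBK hT hBT with rfl | hT₁ <;> rcases hadjT hK hBK hT' hBT' with rfl | hT₁'
    · exact absurd rfl hne
    · left
      refine ⟨Or.inl ⟨rfl, K, hK, hT₁'⟩, ?_⟩
      rw [hρS, hρK hK hT₁']
      exact ((hc K hK).refines T' hT₁').trans hmeet
    · right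
      refine ⟨Or.inl ⟨rfl, K, hK, hT₁⟩, ?_⟩
      rw [hρS, hρK hK hT₁]
      exact ((hc K hK).refines T hT₁).trans hmeet
    · rw [hρK hK hT₁, hρK hK hT₁']
      rcases (hc K hK).adj_anc B hBK hB hdK T hT₁ T' hT₁' hBT hBT' hne with h' | h'
      · exact Or.inl ⟨Or.inr ⟨K, hK, h'.1⟩, h'.2⟩
      · exact Or.inr ⟨Or.inr ⟨K, hK, h'.1⟩, h'.2⟩
  case leaf_refines =>
    intro B hBH hB hdisj A hA hAB T hT hBT
    obtain ⟨K, hK, hBK, hdK⟩ := hfind hBH hB hdisj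
    have hAne : A.Nonempty := by
      rcases hout.1 hA with hA | ⟨K', hK', hA⟩
      · rw [h.carved] at hA
        exact (shatter_isRegion hA.1).nonempty
      · exact ((hc K' hK').out_isRegion A hA).nonempty
    obtain ⟨x, hx⟩ := hAne
    have hAK : A ∈ out K := by
      rcases hout.1 hA with hA | ⟨K', hK', hA⟩
      · exact absurd (Set.subset_sUnion_of_mem hA hx)
          (Set.disjoint_left.1 (hKN hK) (hBK (hAB hx)))
      · rwa [hKK hK hK' (hBK (hAB hx)) (houtK hK' hA hx)]
    rcases hadjT hK hBK hT hBT with rfl | hT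
    · rw [hρS]
      exact ((hc K hK).out_refines.trans hmeet) A hAK
    · rw [hρK hK hT]
      exact (hc K hK).leaf_refines B hBK hB hdK A hAK hAB T hT hBT
  case split_prev =>
    intro Q hQ hQW
    have hQreg := h.isRegion_of_mem hQ
    by_cases hQN : (Q ∩ S.verts).Nonempty
    · right
      refine ⟨hmem.2 (Or.inl rfl), by rwa [hρS], hQN, fun x hx => ?_⟩
      by_cases hxN : x ∈ S.verts
      · exact Or.inl hxN
      right
      obtain ⟨Q', hQ', hxQ'⟩ := exists_component (G := G) (A := Q \ S.verts) ⟨hx, hxN⟩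
      have hQ'Q : Q' ⊆ Q := fun z hz => (component_subset hQ' hz).1
      have hQ'reg := component_isRegion hQ'
      obtain ⟨K, hK, hQ'K, hQ'm⟩ := hpiece hQ'reg hQ'Q hQ (hdiffDisj hQ')
        ⟨Q, hQ, Or.inl hQ'⟩
      -- Since `Q` is not absorbed, it avoids the spine. With an outer vertex in `K`, the connected
      -- set `K ∪ Q` would be separated from `W`, but `Q` is adjacent to `W`.
      have hKo : ¬ ∃ v ∈ K, E.IsOuterVertex X v := by
        rintro ⟨v, hv, hvo⟩
        obtain ⟨q, hq, w, hw, hqw⟩ := hQW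
        have hQπ := h.disjoint_spine hQ fun hsub => hxN (hsub hx)
        refine h.not_adj_prev ((component_isRegion hK).union hQreg (hQ'K hxQ') hx (Or.inl rfl))
          (Set.union_subset (hKH hK) (h.subset_of_mem hQ))
          (Set.disjoint_union_left.2 ⟨(hKN hK).mono_right h.spine_subset, hQπ⟩)
          ⟨v, Or.inl hv, hvo⟩ q (Or.inr hq) w hw hqw
      obtain ⟨ho, hs⟩ := hleaf K hK hKo
      refine ⟨Q', hQ'Q, hxQ', hQ'reg, hlift hK ⟨by rwa [ho], fun T hT => ?_⟩,
        hQreg.component_diff_exit hQ' hQN⟩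
      rw [hs] at hT
      exact hT.elim
    · left
      rw [Set.not_nonempty_iff_eq_empty, ← Set.disjoint_iff_inter_eq_empty] at hQN
      obtain ⟨K, hK, hQK, hQm⟩ := hpiece hQreg le_rfl hQ hQN
        (mem_shatter_of_disjoint hQ hQreg hQN)
      have hKo : ¬ ∃ v ∈ K, E.IsOuterVertex X v := by
        intro hKo
        obtain ⟨q, hq, w, hw, hqw⟩ := hQW
        exact h.component_not_adj_prev hK hKo q (hQK hq) w hw hqw
      obtain ⟨ho, hs⟩ := hleaf K hK hKo
      refine hlift hK ⟨by rwa [ho], fun T hT => ?_⟩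
      rw [hs] at hT
      exact hT.elim
  case split =>
    intro R hR
    have hRreg := h.isRegion_of_mem hR
    have hliftS : ∀ {K Q}, K ∈ κ → ∀ T ∈ 𝓢 K, Q ∈ ρ K T → Splits G (IsLeaf (out K) (𝓢 K)) T.verts Q →
        ∃ T ∈ {S} ∪ ⋃ K ∈ κ, 𝓢 K, Q ∈ ρ' T ∧
          Splits G (IsLeaf (S.regions ∪ ⋃ K ∈ κ, out K) ({S} ∪ ⋃ K ∈ κ, 𝓢 K)) T.verts Q := by
      intro K Q hK T hT hQ hsplit
      exact ⟨T, hmemS hK hT, by rwa [hρK hK hT], hsplit.imp fun A hA => hlift hK hA⟩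
    by_cases hRN : (R ∩ S.verts).Nonempty
    · right
      refine ⟨S, hmem.2 (Or.inl rfl), by rwa [hρS], hRN, fun x hx => ?_⟩
      by_cases hxN : x ∈ S.verts
      · exact Or.inl hxN
      right
      obtain ⟨Q, hQ, hxQ⟩ := exists_component (G := G) (A := R \ S.verts) ⟨hx, hxN⟩
      have hQR : Q ⊆ R := fun z hz => (component_subset hQ hz).1
      have hQreg := component_isRegion hQ
      obtain ⟨K, hK, hQK, hQm⟩ := hpiece hQreg hQR hR (hdiffDisj hQ) ⟨R, hR, Or.inl hQ⟩
      have hadj : AdjSet G Q (R ∩ S.verts) := hRreg.component_diff_exit hQ hRN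
      refine ⟨Q, hQR, hxQ, hQreg, ?_, hadj⟩
      -- The pieces of `R` outside `S` are adjacent to `S`, the previous set for their component, so
      -- at most one more supernode cuts them.
      rcases (hc K hK).split_prev Q hQm (hadj.mono le_rfl Set.inter_subset_right) with hl | hs
      · exact Or.inl (hlift hK hl)
      · exact Or.inr (hliftS hK _ hs.1 hs.2.1 hs.2.2)
    · rw [Set.not_nonempty_iff_eq_empty, ← Set.disjoint_iff_inter_eq_empty] at hRN
      obtain ⟨K, hK, hRK, hRm⟩ := hpiece hRreg le_rfl hR hRN
        (mem_shatter_of_disjoint hR hRreg hRN)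
      rcases (hc K hK).split R hRm with hl | ⟨T, hT, hRT, hs⟩
      · exact Or.inl (hlift hK hl)
      · refine Or.inr ⟨T, hmemS hK hT, by rwa [hρK hK hT], hs.imp fun Q hQ => ?_⟩
        rcases hQ with hl | ⟨T', hT', hQT', hs'⟩
        · exact Or.inl (hlift hK hl)
        · exact Or.inr (hliftS hK T' hT' hQT' hs')

theorem SelectPaths.exists_layout [Finite V] (hG : G.Connected) (hX : IsRegion G X)
    {out : Set (Set V)} {𝓢 : Set (Supernode V)} {anc : Supernode V → Supernode V → Prop}
    (h : SelectPaths E X H W 𝓡 out 𝓢 anc) (hI : CallInv E X H W 𝓡) :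
    ∃ S₀ ∈ 𝓢, ∃ ρ, Layout E X H W 𝓡 out 𝓢 anc S₀ ρ := by
  induction h with
  | run H W 𝓡 Y π S 𝓡' out 𝓢 anc hY hπ hS h𝓡' hrec hleaf ih =>
    have hs : Step E X H W 𝓡 Y π S := ⟨hG, hX, hI, hY, hπ, hS⟩
    rw [← hs.verts_eq] at h𝓡'
    subst h𝓡'
    have hex : ∀ K, ∃ S₀ ρ, K ∈ components G (H \ S.verts) → Layout E X K S.verts
        (meeting (shatter G 𝓡 S.verts) K) (out K) (𝓢 K) (anc K) S₀ ρ := by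
      intro K
      by_cases hK : K ∈ components G (H \ S.verts)
      swap
      · exact ⟨S, fun _ => ∅, fun h => absurd h hK⟩
      by_cases hKo : ∃ v ∈ K, E.IsOuterVertex X v
      · obtain ⟨S₀, -, ρ, h⟩ := ih K hK hKo (hs.child hK hKo)
        exact ⟨S₀, ρ, fun _ => h⟩
      · obtain ⟨h1, h2, h3⟩ := hleaf K hK hKo
        refine ⟨S, fun _ => ∅, fun _ => ?_⟩
        rw [h1, h2]
        exact layout_of_no_outer (hs.regionSet_child hK) hKo h3 _ _
    choose S₀ ρ hc using hex
    obtain ⟨ρ', h⟩ := hs.layout (S₀ := S₀) (ρ := ρ) (fun K hK => hc K hK)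
      fun K hK hKo => ⟨(hleaf K hK hKo).1, (hleaf K hK hKo).2.1⟩
    exact ⟨S, Or.inl rfl, ρ', h⟩

/-- The situation of the first call. -/
theorem callInv_root [Finite V] (hG : G.Connected) (hX : IsRegion G X) (h𝓡 : IsRegionSet G X 𝓡) :
    CallInv E X X ∅ 𝓡 where
  sub := le_rfl
  conn := hX
  regions := h𝓡
  boundary _ _ y hy hy' := absurd hy hy'
  outer := by
    obtain ⟨v, hv⟩ := E.exists_isOuterVertex hG hX.nonempty
    exact ⟨v, hv.1, hv⟩
  prev := Or.inl ⟨rfl, rfl⟩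

end Layout

end RegionClustering

/-! ### Effect of `Assign`, and assignments along a strip -/

namespace RegionClustering

section Assign

variable {V : Type u} {G : SimpleGraph V} {X Y A B P Q : Set V} {u v w x y z : V}
  {σ σ₁ τ σ' : Assignment V} {nets π : List (Set V)} {𝓐 : Set (Set V)} {S : Supernode V}

/-- A step through unassigned vertices of `σ` that are put into the same cluster in `σ'`. -/
def AStep (G : SimpleGraph V) (X : Set V) (σ σ' : Assignment V) (x y : V) : Prop :=
  G.Adj x y ∧ x ∈ X ∧ y ∈ X ∧ σ x = none ∧ σ' x = σ' y

/-- A sequence of such steps. -/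
abbrev AChain (G : SimpleGraph V) (X : Set V) (σ σ' : Assignment V) : V → V → Prop :=
  Relation.ReflTransGen (AStep G X σ σ')

/-- The assignment `σ'` extends `σ`. -/
def Extends (σ σ' : Assignment V) : Prop := ∀ x, σ x ≠ none → σ' x = σ x

theorem Extends.trans (h : Extends σ τ) (h' : Extends τ σ') : Extends σ σ' := fun x hx =>
  (h' x (by rw [h x hx]; exact hx)).trans (h x hx)

theorem Extends.none (h : Extends σ τ) (hx : τ x = none) : σ x = none := by
  by_contra hne
  exact hne ((h x hne).symm.trans hx)

theorem AChain.label (h : AChain G X σ σ' x z) : σ' x = σ' z := by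
  induction h with
  | refl => rfl
  | tail _ h ih => exact ih.trans h.2.2.2.2

theorem AChain.mem (h : AChain G X σ σ' x z) (hx : x ∈ X) : z ∈ X := by
  induction h with
  | refl => exact hx
  | tail _ h _ => exact h.2.2.1

theorem AChain.linked (h : AChain G X σ σ' x z) :
    Linked G {y | σ' y = σ' z} x z := by
  induction h using Relation.ReflTransGen.head_induction_on with
  | refl => exact .refl rfl
  | head h hs ih =>
    have hl := AChain.label hs
    exact (Linked.of_adj (A := {y | σ' y = σ' z}) (h.2.2.2.2.trans hl) hl h.1).trans ih

theorem AChain.mono_left (h : AChain G X τ σ' x z) (hst : Extends σ τ) : AChain G X σ σ' x z :=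
  Relation.ReflTransGen.mono (fun _ _ (h : AStep G X τ σ' _ _) =>
    (⟨h.1, h.2.1, h.2.2.1, hst.none h.2.2.2.1, h.2.2.2.2⟩ : AStep G X σ σ' _ _)) _ _ h

theorem AChain.mono_right (h : AChain G X σ τ x z) (hz : τ z ≠ none) (hst : Extends τ σ')
    (hXY : X ⊆ Y) : AChain G Y σ σ' x z := by
  induction h using Relation.ReflTransGen.head_induction_on with
  | refl => exact .refl
  | head h hs ih =>
    have hl := AChain.label hs
    refine .head ⟨h.1, hXY h.2.1, hXY h.2.2.1, h.2.2.2.1, ?_⟩ ih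
    rw [hst _ (by rw [h.2.2.2.2, hl]; exact hz), hst _ (by rw [hl]; exact hz)]
    exact h.2.2.2.2

/-- What a run of assignments inside `X` does to one vertex. -/
def Grows (G : SimpleGraph V) (X : Set V) (σ σ' : Assignment V) : Prop :=
  ∀ x, σ' x = σ x ∨ (σ x = none ∧ x ∈ X ∧ ∃ z, AChain G X σ σ' x z ∧ σ z ≠ none)

/-- Only the part `p` of the path up to the first assigned vertex `z` matters: each new vertex
copies the label of `z` and reaches it along `p`. The label need not be that of the target `P`. -/
theorem Assign.spec (h : Assign G X P v σ σ') : Extends σ σ' ∧ Grows G X σ σ' ∧ σ' v ≠ none := by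
  obtain ⟨z, w, p, q, L, -, hX, -, hp, hz, hp', hrest⟩ := h
  have hzz : σ' z = some L := (hrest z (Or.inr rfl)).trans hz
  have hlab : ∀ x ∈ p.support, σ' x = some L := fun x hx => by
    by_cases hxz : x = z
    · rw [hxz]; exact hzz
    · exact hp' x hx hxz
  have hpX : ∀ x ∈ p.support, x ∈ X := fun x hx =>
    hX x ((SimpleGraph.Walk.mem_support_append_iff ..).2 (Or.inl hx))
  have hchain : ∀ {a c : V} (r : G.Walk a c), c = z → (∀ x ∈ r.support, x ∈ p.support) →
      AChain G X σ σ' a z := by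
    intro a c r hc
    induction r with
    | nil => exact fun _ => hc ▸ .refl
    | @cons a b _ hadj r ih =>
      intro hr
      simp only [SimpleGraph.Walk.support_cons, List.mem_cons, forall_eq_or_imp] at hr
      by_cases haz : a = z
      · rw [haz]
      · have hb := hr.2 _ r.start_mem_support
        exact .head ⟨hadj, hpX _ hr.1, hpX _ hb, hp _ hr.1 haz, (hlab _ hr.1).trans
          (hlab _ hb).symm⟩ (ih hc hr.2)
  refine ⟨fun x hx => hrest x ?_, fun x => ?_, ?_⟩
  · by_contra! hcon
    exact hx (hp x hcon.1 hcon.2)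
  · by_cases hx : x ∈ p.support ∧ x ≠ z
    · classical
      refine Or.inr ⟨hp x hx.1 hx.2, hpX x hx.1, z, ?_, by rw [hz]; simp⟩
      exact hchain (p.dropUntil x hx.1) rfl fun y hy => p.support_dropUntil_subset_support hx.1 hy
    · refine Or.inl (hrest x ?_)
      by_contra! h
      exact hx h
  · rw [hlab v p.start_mem_support]
    simp

theorem Grows.trans (h : Grows G X σ τ) (h' : Grows G X τ σ') (e : Extends σ τ)
    (e' : Extends τ σ') : Grows G X σ σ' := by
  intro x
  have hlift : ∀ {y z}, AChain G X σ τ y z → σ z ≠ none → AChain G X σ σ' y z :=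
    fun hc hz => hc.mono_right (by rw [e _ hz]; exact hz) e' le_rfl
  rcases h' x with hx | ⟨hx, hxX, z, hc, hz⟩
  · rcases h x with hx' | ⟨hx', hxX, z, hc, hz⟩
    · exact Or.inl (hx.trans hx')
    · exact Or.inr ⟨hx', hxX, z, hlift hc hz, hz⟩
  -- The end of the chain of the second run may itself have been labelled in the first; its chain
  -- then continues the path to a vertex assigned in `σ`.
  · refine Or.inr ⟨e.none hx, hxX, ?_⟩
    have hc' := hc.mono_left e
    rcases h z with hz' | ⟨-, -, y, hc₂, hy⟩
    · exact ⟨z, hc', hz' ▸ hz⟩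
    · exact ⟨y, hc'.trans (hlift hc₂ hy), hy⟩

theorem AssignLoop.spec (h : AssignLoop G X nets σ σ') :
    Extends σ σ' ∧ Grows G X σ σ' ∧ ∀ v ∈ X, σ' v ≠ none := by
  induction h with
  | done σ h => exact ⟨fun _ _ => rfl, fun _ => Or.inl rfl, h⟩
  | step σ σ₁ σ₂ v P hv hσ hP h₁ h₂ ih =>
    obtain ⟨e, g, -⟩ := h₁.spec
    exact ⟨e.trans ih.1, g.trans ih.2.1 e ih.1, ih.2.2⟩

theorem exists_assign (hX : IsRegion G X) (hw : w ∈ X) (hσw : σ w = some P) (hv : v ∈ X) :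
    ∃ σ', Assign G X P v σ σ' := by
  classical
  obtain ⟨p, hp⟩ := hX.linked hv hw
  have hsplit : ∀ {a b : V} (r : G.Walk a b), σ b ≠ none → ∃ (z : V) (p : G.Walk a z)
      (q : G.Walk z b), r = p.append q ∧ σ z ≠ none ∧ ∀ x ∈ p.support, x ≠ z → σ x = none := by
    intro a b r hb
    induction r with
    | nil => exact ⟨_, .nil, .nil, rfl, hb, by simp⟩
    | @cons a c b hadj r ih =>
      by_cases ha : σ a = none
      · obtain ⟨z, p, q, rfl, hz, hp⟩ := ih hb
        refine ⟨z, .cons hadj p, q, rfl, hz, ?_⟩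
        simp only [SimpleGraph.Walk.support_cons, List.mem_cons, forall_eq_or_imp]
        exact ⟨fun _ => ha, hp⟩
      · exact ⟨a, .nil, .cons hadj r, rfl, ha, by simp⟩
  obtain ⟨z, p₁, q, hpq, hz, hp₁⟩ := hsplit p.bypass (by rw [hσw]; simp)
  obtain ⟨L, hL⟩ := Option.ne_none_iff_exists'.1 hz
  refine ⟨fun x => if x ∈ p₁.support ∧ x ≠ z then some L else σ x, z, w, p₁, q, L, ?_, ?_, hσw,
    hp₁, hL, ?_, ?_⟩
  · rw [← hpq]; exact p.bypass_isPath
  · rw [← hpq]; exact fun x hx => hp x (p.support_bypass_subset_support hx)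
  · intro x hx hxz
    simp [hx, hxz]
  · intro x hx
    exact if_neg fun h => hx.elim (fun h' => h' h.1) h.2

/-- One assigned vertex of the connected set `X` serves as a permanent target, and every call lowers
the number of unassigned vertices. -/
theorem exists_assignLoop [Finite V] (hX : IsRegion G X) (hP : P ∈ nets) (hw : w ∈ X)
    (hσw : σ w = some P) : ∃ σ', AssignLoop G X nets σ σ' := by
  induction hn : {v | σ v = none}.ncard using Nat.strong_induction_on generalizing σ with
  | _ n ih =>
  subst hn
  by_cases hall : ∀ v ∈ X, σ v ≠ none
  · exact ⟨σ, .done σ hall⟩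
  push Not at hall
  obtain ⟨v, hv, hσv⟩ := hall
  obtain ⟨σ₁, h₁⟩ := exists_assign hX hw hσw hv
  obtain ⟨e, -, hv'⟩ := h₁.spec
  obtain ⟨σ', h'⟩ := ih _ (Set.ncard_lt_ncard ⟨fun x hx => e.none hx, fun h => hv' (h hσv)⟩)
    (by rw [e w (by rw [hσw]; simp), hσw]) rfl
  exact ⟨σ', .step σ σ₁ σ' v P hv hσv hP h₁ h'⟩

/-! ### Assignments along a strip -/

/-- With residue at most 2, the preceding net point is at most 2 steps away along the spine, so `A`
is within 2 + 2 = 4 of it and `x` would be assigned. -/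
theorem Strip.index_mod (hs : Strip G 𝓐 π)
    (hball : ∀ k P, π[14 * k]? = some P → ∀ A ∈ 𝓐, Near G 𝓐 4 P A → ∀ v ∈ A, σ v ≠ none)
    {i : ℕ} (hA : A ∈ 𝓐) (hx : x ∈ A) (hi : π[i]? = some P) (hAP : Near G 𝓐 2 A P)
    (hσ : σ x = none) : 3 ≤ i % 14 := by
  by_contra hlt
  have hk : 14 * (i / 14) < π.length := by
    have := (List.getElem?_eq_some_iff.1 hi).1
    omega
  have hQ : π[14 * (i / 14)]? = some π[14 * (i / 14)] := List.getElem?_eq_getElem hk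
  exact hball _ _ hQ A hA (((hs.toGeodesic.near (by omega) hQ hi).trans hAP.symm).mono (by omega))
    x hx hσ

/-- Touching regions project to indices at most 2 + 1 + 2 = 5 apart. If `j` were in a later block,
its residue of at least 3 would leave `i` at most 2 before the net point of that block, and `A`
would lie in its ball. -/
theorem Strip.index_div_le (hs : Strip G 𝓐 π)
    (hball : ∀ k P, π[14 * k]? = some P → ∀ A ∈ 𝓐, Near G 𝓐 4 P A → ∀ v ∈ A, σ v ≠ none)
    {i j : ℕ} (hA : A ∈ 𝓐) (hx : x ∈ A) (hi : π[i]? = some P) (hAP : Near G 𝓐 2 A P)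
    (hσx : σ x = none) (hB : B ∈ 𝓐) (hy : y ∈ B) (hj : π[j]? = some Q) (hBQ : Near G 𝓐 2 B Q)
    (hσy : σ y = none) (hAB : Touch G A B) : j / 14 ≤ i / 14 := by
  by_contra hlt
  have h3 := hs.index_mod hball hB hy hj hBQ hσy
  have h5 := hs.sep j i Q P 5 hj hi
    ((hBQ.symm.trans ((near_one_of_touch hB hA hAB.symm).trans hAP)).mono (by omega))
  have hk : 14 * (j / 14) < π.length := by
    have := (List.getElem?_eq_some_iff.1 hj).1
    omega
  have hR : π[14 * (j / 14)]? = some π[14 * (j / 14)] := List.getElem?_eq_getElem hk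
  exact hball _ _ hR A hA
    (((hs.toGeodesic.near (by omega) hi hR).symm.trans hAP.symm).mono (by omega)) x hx hσx

/-- If the balls around the net points are assigned, then the unassigned vertices lie in the gaps
between them, and a chain cannot cross from one gap to the next. -/
theorem Strip.near_of_chain (hs : Strip G 𝓐 π)
    (hball : ∀ k P, π[14 * k]? = some P → ∀ A ∈ 𝓐, Near G 𝓐 4 P A → ∀ v ∈ A, σ v ≠ none)
    (hx : x ∈ ⋃₀ 𝓐) (hc : AChain G (⋃₀ 𝓐) σ σ' x z) :
    ∃ A ∈ 𝓐, x ∈ A ∧ ∃ B ∈ 𝓐, z ∈ B ∧ Near G 𝓐 15 A B := by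
  obtain ⟨A, hA, hxA⟩ := hx
  by_cases hσx : σ x = none
  swap
  · rcases Relation.ReflTransGen.cases_head hc with rfl | ⟨y, h, -⟩
    · exact ⟨A, hA, hxA, A, hA, hxA, .refl⟩
    · exact absurd h.2.2.2.1 hσx
  obtain ⟨i, P, hi, hAP⟩ := hs.close A hA
  have h3 := hs.index_mod hball hA hxA hi hAP hσx
  -- Unassigned vertices of the chain keep the block of `x`. Residues 3 to 13 differ by at most 10,
  -- and 2 + 10 + 2 + 1 = 15, where the last 1 is the step to an end that may already be assigned.
  have key : (∀ B ∈ 𝓐, z ∈ B → σ z = none → ∀ j Q, π[j]? = some Q → Near G 𝓐 2 B Q →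
      j / 14 = i / 14) ∧ ∃ B ∈ 𝓐, z ∈ B ∧ Near G 𝓐 15 A B := by
    induction hc with
    | refl =>
      refine ⟨fun B hB hzB _ j Q hj hBQ => ?_, A, hA, hxA, .refl⟩
      have ht := touch_of_mem (G := G) hxA hzB
      exact le_antisymm (hs.index_div_le hball hA hxA hi hAP hσx hB hzB hj hBQ hσx ht)
        (hs.index_div_le hball hB hzB hj hBQ hσx hA hxA hi hAP hσx ht.symm)
    | @tail b c _ hbc ih =>
      obtain ⟨hadj, ⟨B, hB, hbB⟩, ⟨C, hC, hcC⟩, hσb, -⟩ := hbc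
      obtain ⟨j, Q, hj, hBQ⟩ := hs.close B hB
      have hji := ih.1 B hB hbB hσb j Q hj hBQ
      have h3' := hs.index_mod hball hB hbB hj hBQ hσb
      refine ⟨fun C hC hcC hσc k R hk hCR => ?_, C, hC, hcC, ?_⟩
      · have ht : Touch G B C := ⟨b, hbB, c, hcC, Or.inr hadj⟩
        rw [← hji]
        exact le_antisymm (hs.index_div_le hball hB hbB hj hBQ hσb hC hcC hk hCR hσc ht)
          (hs.index_div_le hball hC hcC hk hCR hσc hB hbB hj hBQ hσb ht.symm)
      · have hPQ : Near G 𝓐 10 P Q := by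
          rcases le_total i j with hij | hij
          · exact (hs.toGeodesic.near hij hi hj).mono (by omega)
          · exact (hs.toGeodesic.near hij hj hi).symm.mono (by omega)
        exact (hAP.trans (hPQ.trans (hBQ.symm.trans
          (near_one_of_touch hB hC ⟨b, hbB, c, hcC, Or.inr hadj⟩)))).mono (by omega)
  obtain ⟨B, hB, hzB, h⟩ := key.2
  exact ⟨A, hA, hxA, B, hB, hzB, h⟩

/-! ### Net points -/

theorem mem_netPoints : P ∈ S.netPoints ↔ ∃ k : ℕ, S.spine[14 * k]? = some P := by
  simp only [Supernode.netPoints, List.mem_filterMap, List.mem_range]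
  constructor
  · rintro ⟨k, -, h⟩
    exact ⟨k, h⟩
  · rintro ⟨k, h⟩
    have := (List.getElem?_eq_some_iff.1 h).1
    exact ⟨k, by omega, h⟩

theorem Geodesic.netPoints_nodup (h : Geodesic G 𝓐 S.spine) : S.netPoints.Nodup := by
  refine List.Nodup.filterMap ?_ List.nodup_range
  intro i j P hi hj
  have := h.index_unique hi hj
  omega

theorem Geodesic.exists_netPoint (h : Geodesic G 𝓐 S.spine) : ∃ P, P ∈ S.netPoints :=
  ⟨S.spine[0]'(List.length_pos_iff.2 h.ne), mem_netPoints.2 ⟨0, List.getElem?_eq_getElem _⟩⟩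

theorem Geodesic.netPoint_mem (h : Geodesic G 𝓐 S.spine) (hP : P ∈ S.netPoints) : P ∈ 𝓐 := by
  obtain ⟨k, hk⟩ := mem_netPoints.1 hP
  exact h.mem P (List.mem_of_getElem? hk)

theorem Geodesic.netPoint_eq (h : Geodesic G 𝓐 S.spine) (hP : P ∈ S.netPoints)
    (hQ : Q ∈ S.netPoints) (hPQ : Near G 𝓐 13 P Q) : P = Q := by
  obtain ⟨k, hk⟩ := mem_netPoints.1 hP
  obtain ⟨l, hl⟩ := mem_netPoints.1 hQ
  have h1 := h.sep _ _ _ _ _ hk hl hPQ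
  have h2 := h.sep _ _ _ _ _ hl hk hPQ.symm
  have : k = l := by omega
  subst this
  exact Option.some_injective _ (hk.symm.trans hl)

end Assign

end RegionClustering

namespace RegionClustering

section Phases

variable {V : Type u} {G : SimpleGraph V} {X Y A B P Q R : Set V} {u v w x y z : V}
  {σ σ₁ τ σ' : Assignment V} {nets π : List (Set V)} {𝓐 Sp : Set (Set V)} {S : Supernode V}

/-! ### Assigning a supernode -/

theorem mem_smallBall : R ∈ smallBall G S P ↔ R ∈ S.regions ∧ Near G S.regions 4 P R := by
  simp [smallBall, Near]

theorem mem_bigBall : R ∈ bigBall G Sp P ↔ R ∈ Sp ∧ Near G Sp 6 P R := by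
  simp [bigBall, Near]

theorem smallBall_isRegion (hs : Strip G S.regions S.spine) (hP : P ∈ S.netPoints) :
    IsRegion G (⋃₀ smallBall G S P) := by
  have h := isRegion_ball hs.region (hs.netPoint_mem hP) 4
  have heq : smallBall G S P = {R | R ∈ S.regions ∧ Near G S.regions 4 P R} :=
    Set.ext fun R => mem_smallBall
  rwa [heq]

theorem bigBall_isRegion (hs : Strip G Sp S.spine) (hP : P ∈ S.netPoints) :
    IsRegion G (⋃₀ bigBall G Sp P) := by
  have h := isRegion_ball hs.region (hs.netPoint_mem hP) 6
  have heq : bigBall G Sp P = {R | R ∈ Sp ∧ Near G Sp 6 P R} := Set.ext fun R => mem_bigBall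
  rwa [heq]

/-- Even balls of radius 6 are disjoint: 6 + 1 + 6 = 13 is less than the spacing 14. -/
theorem Strip.netPoint_eq_of_mem (hs : Strip G 𝓐 S.spine) (hP : P ∈ S.netPoints)
    (hQ : Q ∈ S.netPoints) (hA : A ∈ 𝓐) (hB : B ∈ 𝓐) (hPA : Near G 𝓐 6 P A)
    (hQB : Near G 𝓐 6 Q B) (hxA : x ∈ A) (hxB : x ∈ B) : P = Q :=
  hs.netPoint_eq hP hQ ((hPA.trans ((near_one_of_touch hA hB (touch_of_mem hxA hxB)).trans
    hQB.symm)).mono (by omega))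

theorem assignSmallBalls_cases (G : SimpleGraph V) (S : Supernode V) (σ : Assignment V) (v : V) :
    (∃ P ∈ S.netPoints, v ∈ ⋃₀ smallBall G S P ∧ assignSmallBalls G S σ v = some P) ∨
      ((∀ P ∈ S.netPoints, v ∉ ⋃₀ smallBall G S P) ∧ assignSmallBalls G S σ v = σ v) := by
  unfold assignSmallBalls
  generalize S.netPoints = l
  induction l generalizing σ with
  | nil => exact Or.inr ⟨by simp, rfl⟩
  | cons Q l ih =>
    rw [List.foldl_cons]
    rcases ih _ with ⟨P, hP, h1, h2⟩ | ⟨h1, h2⟩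
    · exact Or.inl ⟨P, List.mem_cons_of_mem _ hP, h1, h2⟩
    · by_cases hv : v ∈ ⋃₀ smallBall G S Q
      · exact Or.inl ⟨Q, List.mem_cons_self, hv, h2.trans (if_pos hv)⟩
      · refine Or.inr ⟨?_, h2.trans (if_neg hv)⟩
        intro P hP
        rcases List.mem_cons.1 hP with rfl | hP
        exacts [hv, h1 P hP]

/-- As the balls are disjoint, later net points do not overwrite earlier ones. -/
theorem assignSmallBalls_of_mem (hs : Strip G S.regions S.spine) (hP : P ∈ S.netPoints)
    (hv : v ∈ ⋃₀ smallBall G S P) : assignSmallBalls G S σ v = some P := by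
  rcases assignSmallBalls_cases G S σ v with ⟨Q, hQ, hvQ, h⟩ | ⟨h, -⟩
  · obtain ⟨A, hA, hvA⟩ := hv
    obtain ⟨B, hB, hvB⟩ := hvQ
    rw [mem_smallBall] at hA hB
    rwa [hs.netPoint_eq_of_mem hP hQ hA.1 hB.1 (hA.2.mono (by omega)) (hB.2.mono (by omega))
      hvA hvB]
  · exact absurd hv (h P hP)

theorem netPoint_subset_smallBall (hs : Strip G S.regions S.spine) (hP : P ∈ S.netPoints) :
    P ⊆ ⋃₀ smallBall G S P :=
  Set.subset_sUnion_of_mem (mem_smallBall.2 ⟨hs.netPoint_mem hP, .refl⟩)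

theorem smallBall_subset : ⋃₀ smallBall G S P ⊆ S.verts :=
  Set.sUnion_subset_sUnion fun _ hR => (mem_smallBall.1 hR).1

/-- A chain of span at most 15 ends in a small ball, and 15 + 1 + 4 = 20. The chain and the
connected ball link the vertex to its net point within the cluster. -/
theorem assignSupernode_spec (hs : Strip G S.regions S.spine) (hnone : ∀ v ∈ S.verts, σ v = none)
    (h : assignSupernode G S σ σ') :
    (∀ v ∉ S.verts, σ' v = σ v) ∧
    (∀ v ∈ S.verts, ∃ P ∈ S.netPoints, σ' v = some P ∧
      (∃ A ∈ S.regions, v ∈ A ∧ Near G S.regions 20 A P) ∧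
      ∃ x ∈ P, Linked G {y | σ' y = some P} v x) ∧
    ∀ P ∈ S.netPoints, ∀ v ∈ P, σ' v = some P := by
  obtain ⟨e, g, hall⟩ := AssignLoop.spec h
  have hballs : ∀ P ∈ S.netPoints, ∀ v ∈ ⋃₀ smallBall G S P, σ' v = some P := by
    intro P hP v hv
    have hv' := assignSmallBalls_of_mem (σ := σ) hs hP hv
    rw [e v (by rw [hv']; simp), hv']
  have hbase : ∀ z ∈ S.verts, assignSmallBalls G S σ z ≠ none →
      ∃ P ∈ S.netPoints, z ∈ ⋃₀ smallBall G S P := by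
    intro z hz hne
    rcases assignSmallBalls_cases G S σ z with ⟨P, hP, hzP, -⟩ | ⟨-, h⟩
    · exact ⟨P, hP, hzP⟩
    · exact absurd (h.trans (hnone z hz)) hne
  refine ⟨fun v hv => ?_, fun v hv => ?_, fun P hP v hv =>
    hballs P hP v (netPoint_subset_smallBall hs hP hv)⟩
  · rcases g v with h | ⟨-, h, -⟩
    · rw [h]
      rcases assignSmallBalls_cases G S σ v with ⟨P, -, hvP, -⟩ | ⟨-, h⟩
      · exact absurd (smallBall_subset hvP) hv
      · exact h
    · exact absurd h hv
  · have hchain : ∃ z, AChain G S.verts (assignSmallBalls G S σ) σ' v z ∧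
        assignSmallBalls G S σ z ≠ none := by
      rcases g v with h | ⟨-, -, h⟩
      · exact ⟨v, .refl, h ▸ hall v hv⟩
      · exact h
    obtain ⟨z, hc, hz⟩ := hchain
    have hzS := hc.mem hv
    obtain ⟨P, hP, hzP⟩ := hbase z hzS hz
    have hzl := hballs P hP z hzP
    refine ⟨P, hP, hc.label.trans hzl, ?_, ?_⟩
    · obtain ⟨A, hA, hvA, B, hB, hzB, hAB⟩ := hs.near_of_chain (σ := assignSmallBalls G S σ)
        (σ' := σ') (fun k Q hQ C hC hQC u hu => by
          rw [assignSmallBalls_of_mem hs (mem_netPoints.2 ⟨k, hQ⟩)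
            ⟨C, mem_smallBall.2 ⟨hC, hQC⟩, hu⟩]
          simp) hv hc
      obtain ⟨C, hC, hzC⟩ := hzP
      rw [mem_smallBall] at hC
      exact ⟨A, hA, hvA, hAB.trans ((near_one_of_touch hB hC.1 (touch_of_mem hzB hzC)).trans
        hC.2.symm)⟩
    · obtain ⟨x, hx⟩ := (hs.region P (hs.netPoint_mem hP)).nonempty
      have h1 := hc.linked
      rw [hzl] at h1
      exact ⟨x, hx, h1.trans (((smallBall_isRegion hs hP).linked hzP
        (netPoint_subset_smallBall hs hP hx)).mono fun y hy => hballs P hP y hy)⟩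

theorem exists_assignSupernode [Finite V] (hs : Strip G S.regions S.spine) (σ : Assignment V) :
    ∃ σ', assignSupernode G S σ σ' := by
  obtain ⟨P, hP⟩ := hs.exists_netPoint
  obtain ⟨x, hx⟩ := (hs.region P (hs.netPoint_mem hP)).nonempty
  exact exists_assignLoop hs.isRegion hP ⟨P, hs.netPoint_mem hP, hx⟩
    (assignSmallBalls_of_mem hs hP (netPoint_subset_smallBall hs hP hx))

/-! ### Assigning an expansion -/

theorem bigBall_subset : ⋃₀ bigBall G Sp P ⊆ ⋃₀ Sp :=
  Set.sUnion_subset_sUnion fun _ hR => (mem_bigBall.1 hR).1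

theorem forLoop_bigBalls_spec (hs : Strip G Sp S.spine) (hnd : nets.Nodup)
    (hsub : ∀ P ∈ nets, P ∈ S.netPoints)
    (h : ForLoop (fun P => AssignLoop G (⋃₀ bigBall G Sp P) [P]) nets σ τ) :
    Extends σ τ ∧ (∀ P ∈ nets, ∀ v ∈ ⋃₀ bigBall G Sp P, τ v ≠ none) ∧
      ∀ x, τ x = σ x ∨ (σ x = none ∧ ∃ P ∈ nets, x ∈ ⋃₀ bigBall G Sp P ∧
        ∃ z ∈ ⋃₀ bigBall G Sp P, AChain G (⋃₀ Sp) σ τ x z ∧ σ z ≠ none) := by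
  induction h with
  | nil σ => exact ⟨fun _ _ => rfl, by simp, fun _ => Or.inl rfl⟩
  | cons P l σ σ₁ σ₂ h₁ h₂ ih =>
    rw [List.nodup_cons] at hnd
    obtain ⟨e₂, hall₂, g₂⟩ := ih hnd.2 fun Q hQ => hsub Q (List.mem_cons_of_mem _ hQ)
    obtain ⟨e₁, g₁, hall₁⟩ := h₁.spec
    have hP := hsub P List.mem_cons_self
    refine ⟨e₁.trans e₂, ?_, fun x => ?_⟩
    · intro Q hQ v hv
      rcases List.mem_cons.1 hQ with rfl | hQ
      · have := hall₁ v hv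
        rwa [e₂ v this]
      · exact hall₂ Q hQ v hv
    · rcases g₂ x with hx | ⟨hx, Q, hQ, hxQ, z, hz, hc, hσz⟩
      · rcases g₁ x with hx' | ⟨hx', hxP, z, hc, hσz⟩
        · exact Or.inl (hx.trans hx')
        · refine Or.inr ⟨hx', P, List.mem_cons_self, hxP, z, hc.mem hxP, ?_, hσz⟩
          exact hc.mono_right (by rwa [e₁ z hσz]) e₂ bigBall_subset
      · refine Or.inr ⟨e₁.none hx, Q, List.mem_cons_of_mem _ hQ, hxQ, z, hz, hc.mono_left e₁, ?_⟩
        -- A vertex labelled while the ball of `P` was processed cannot lie in the disjoint ball of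
        -- `Q`, so labels are not relayed from ball to ball.
        rcases g₁ z with hz' | ⟨-, hzP, -⟩
        · rwa [← hz']
        · exfalso
          obtain ⟨A, hA, hzA⟩ := hz
          obtain ⟨B, hB, hzB⟩ := hzP
          rw [mem_bigBall] at hA hB
          have := hs.netPoint_eq_of_mem (hsub Q (List.mem_cons_of_mem _ hQ)) hP hA.1 hB.1 hA.2
            hB.2 hzA hzB
          exact hnd.1 (this ▸ hQ)

/-- The bound 28 is 15 for the final loop, 1 for a change of region, and the diameter 12 of a big
ball in which the chain may continue. -/
theorem assignExpansion_spec (hs : Strip G Sp S.spine) (h : assignExpansion G Sp S σ σ') :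
    Extends σ σ' ∧ (∀ v ∈ ⋃₀ Sp, σ' v ≠ none) ∧
      ∀ x, σ' x = σ x ∨ (σ x = none ∧ x ∈ ⋃₀ Sp ∧ ∃ z, AChain G (⋃₀ Sp) σ σ' x z ∧ σ z ≠ none ∧
        ∃ A ∈ Sp, x ∈ A ∧ ∃ B ∈ Sp, z ∈ B ∧ Near G Sp 28 A B) := by
  obtain ⟨nets, τ, hperm, h₁, h₂⟩ := h
  obtain ⟨e₁, hall₁, g₁⟩ := forLoop_bigBalls_spec hs (hperm.nodup_iff.2 hs.netPoints_nodup)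
    (fun P hP => hperm.mem_iff.1 hP) h₁
  obtain ⟨e₂, g₂, hall₂⟩ := h₂.spec
  refine ⟨e₁.trans e₂, hall₂, fun x => ?_⟩
  have hball : ∀ y, τ y ≠ σ y → y ∈ ⋃₀ Sp ∧ ∃ z, AChain G (⋃₀ Sp) σ σ' y z ∧ σ z ≠ none ∧
      ∃ A ∈ Sp, y ∈ A ∧ ∃ B ∈ Sp, z ∈ B ∧ Near G Sp 12 A B := by
    intro y hy
    obtain ⟨-, P, -, ⟨A, hA, hyA⟩, z, ⟨B, hB, hzB⟩, hc, hz⟩ := (g₁ y).resolve_left hy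
    rw [mem_bigBall] at hA hB
    exact ⟨⟨A, hA.1, hyA⟩, z, hc.mono_right (by rwa [e₁ z hz]) e₂ le_rfl, hz, A, hA.1, hyA, B,
      hB.1, hzB, hA.2.symm.trans hB.2⟩
  rcases g₂ x with hx | ⟨hx, hxX, z, hc, hz⟩
  · by_cases hx' : τ x = σ x
    · exact Or.inl (hx.trans hx')
    · have hσx : σ x = none := by
        by_contra hne
        exact hx' (e₁ x hne)
      obtain ⟨hxX, z, hc, hz, A, hA, hxA, B, hB, hzB, hAB⟩ := hball x hx'
      exact Or.inr ⟨hσx, hxX, z, hc, hz, A, hA, hxA, B, hB, hzB, hAB.mono (by omega)⟩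
  · have hc' := hc.mono_left e₁
    obtain ⟨A, hA, hxA, B, hB, hzB, hAB⟩ := hs.near_of_chain (σ := τ) (σ' := σ')
      (fun k Q hQ C hC hQC u hu => hall₁ Q (hperm.mem_iff.2 (mem_netPoints.2 ⟨k, hQ⟩)) u
        ⟨C, mem_bigBall.2 ⟨hC, hQC.mono (by omega)⟩, hu⟩) hxX hc
    refine Or.inr ⟨e₁.none hx, hxX, ?_⟩
    by_cases hz' : τ z = σ z
    · exact ⟨z, hc', hz' ▸ hz, A, hA, hxA, B, hB, hzB, hAB.mono (by omega)⟩
    · obtain ⟨-, y, hcy, hy, C, hC, hzC, D, hD, hyD, hCD⟩ := hball z hz'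
      exact ⟨y, hc'.trans hcy, hy, A, hA, hxA, D, hD, hyD,
        (hAB.trans ((near_one_of_touch hB hC (touch_of_mem hzB hzC)).trans hCD))⟩

theorem exists_assignExpansion [Finite V] (hs : Strip G Sp S.spine)
    (hnet : ∀ P ∈ S.netPoints, ∀ v ∈ P, σ v = some P) :
    ∃ σ', assignExpansion G Sp S σ σ' := by
  have hloop : ∀ (l : List (Set V)) (σ : Assignment V), (∀ P ∈ l, P ∈ S.netPoints) →
      (∀ P ∈ S.netPoints, ∀ v ∈ P, σ v = some P) → ∃ τ, Extends σ τ ∧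
        ForLoop (fun P => AssignLoop G (⋃₀ bigBall G Sp P) [P]) l σ τ := by
    intro l
    induction l with
    | nil => exact fun σ _ _ => ⟨σ, fun _ _ => rfl, .nil σ⟩
    | cons P l ih =>
      intro σ hl hσ
      have hP := hl P List.mem_cons_self
      obtain ⟨x, hx⟩ := (hs.region P (hs.netPoint_mem hP)).nonempty
      obtain ⟨σ₁, h₁⟩ := exists_assignLoop (nets := [P]) (bigBall_isRegion hs hP)
        List.mem_cons_self ⟨P, mem_bigBall.2 ⟨hs.netPoint_mem hP, .refl⟩, hx⟩ (hσ P hP x hx)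
      have e₁ := h₁.spec.1
      obtain ⟨τ, e, h⟩ := ih σ₁ (fun Q hQ => hl Q (List.mem_cons_of_mem _ hQ))
        fun Q hQ v hv => by rw [e₁ v (by rw [hσ Q hQ v hv]; simp), hσ Q hQ v hv]
      exact ⟨τ, e₁.trans e, .cons P l σ σ₁ τ h₁ h⟩
  obtain ⟨τ, e, h⟩ := hloop S.netPoints σ (fun _ h => h) hnet
  obtain ⟨P, hP⟩ := hs.exists_netPoint
  obtain ⟨x, hx⟩ := (hs.region P (hs.netPoint_mem hP)).nonempty
  obtain ⟨σ', h'⟩ := exists_assignLoop (σ := τ) (nets := S.netPoints) hs.isRegion hP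
    ⟨P, hs.netPoint_mem hP, hx⟩ (by rw [e x (by rw [hnet P hP x hx]; simp), hnet P hP x hx])
  exact ⟨σ', S.netPoints, τ, .refl _, h, h'⟩

end Phases

/-! ### Expansions -/

section Expansion

variable {V : Type u} {G : SimpleGraph V} {𝓡s : Set (Set V)} {𝓢 : Set (Supernode V)}
  {f : Supernode V → Set (Set V)} {S T : Supernode V} {A Q : Set V} {order : List (Supernode V)}

theorem subset_expandStep : f T ⊆ expandStep G 𝓡s 𝓢 f S T := by
  unfold expandStep
  split_ifs with h
  · rw [h]; exact Set.subset_union_left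
  · exact le_rfl

theorem subset_foldl_expandStep : f T ⊆ order.foldl (expandStep G 𝓡s 𝓢) f T := by
  induction order generalizing f with
  | nil => exact le_rfl
  | cons S l ih => exact subset_expandStep.trans ih

theorem regions_subset_expansion : T.regions ⊆ expansion G 𝓡s 𝓢 order T :=
  subset_foldl_expandStep (f := Supernode.regions)

/-- Current sets only grow from the supernodes themselves, so a region of another supernode is never
added. -/
theorem mem_expansion (h : A ∈ expansion G 𝓡s 𝓢 order T) : A ∈ T.regions ∨
    (A ∈ 𝓡s ∧ (∃ Q ∈ T.regions, Touch G A Q) ∧ ∀ S' ∈ 𝓢, S' ≠ T → A ∉ S'.regions) := by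
  have key : ∀ (order : List (Supernode V)) (f : Supernode V → Set (Set V)),
      (∀ S, S.regions ⊆ f S) → (∀ S, ∀ A ∈ f S, A ∈ S.regions ∨
        (A ∈ 𝓡s ∧ (∃ Q ∈ S.regions, Touch G A Q) ∧ ∀ S' ∈ 𝓢, S' ≠ S → A ∉ S'.regions)) →
      ∀ S, ∀ A ∈ order.foldl (expandStep G 𝓡s 𝓢) f S, A ∈ S.regions ∨
        (A ∈ 𝓡s ∧ (∃ Q ∈ S.regions, Touch G A Q) ∧ ∀ S' ∈ 𝓢, S' ≠ S → A ∉ S'.regions) := by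
    intro order
    induction order with
    | nil => exact fun f _ h => h
    | cons S₁ l ih =>
      intro f hf h
      refine ih _ (fun S => (hf S).trans subset_expandStep) fun S A hA => ?_
      unfold expandStep at hA
      split_ifs at hA with hS
      · subst hS
        rcases hA with hA | ⟨hA, ⟨Q, hQ, hadj⟩, hno⟩
        · exact h S A hA
        · exact Or.inr ⟨hA, ⟨Q, hQ, hadj.2.2.2⟩, fun S' hS' hne hAS' =>
            hno S' hS' hne (hf S' hAS')⟩
      · exact h S A hA
  exact key order Supernode.regions (fun _ => le_rfl) (fun _ _ hA => Or.inl hA) T A h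

/-- When `S` is processed, either `A` already belongs to another expansion or `S` takes it. -/
theorem exists_mem_expansion (hS : S ∈ order) (hS𝓢 : S ∈ 𝓢) (hA : A ∈ 𝓡s) (hQ : Q ∈ S.regions)
    (hQs : Q ∈ 𝓡s) (hAQ : Touch G A Q) (hne : A ≠ Q) :
    ∃ T ∈ 𝓢, A ∈ expansion G 𝓡s 𝓢 order T := by
  unfold expansion
  generalize (Supernode.regions : Supernode V → Set (Set V)) = f
  induction order generalizing f with
  | nil => simp at hS
  | cons S₁ l ih =>
    rcases List.mem_cons.1 hS with rfl | hS
    · by_cases h : ∃ T ∈ 𝓢, T ≠ S ∧ A ∈ f T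
      · obtain ⟨T, hT, -, hAT⟩ := h
        exact ⟨T, hT, (subset_expandStep.trans subset_foldl_expandStep) hAT⟩
      · push Not at h
        refine ⟨S, hS𝓢, subset_foldl_expandStep (f := expandStep G 𝓡s 𝓢 f S) ?_⟩
        unfold expandStep
        rw [if_pos rfl]
        exact Or.inr ⟨hA, ⟨Q, hQ, hne, hA, hQs, hAQ⟩, h⟩
    · exact ih hS _

end Expansion

end RegionClustering

/-! ### Invariants of the assignment loops -/

namespace RegionClustering

/-! ### Loops -/

section Loops

variable {V : Type u} {α : Type u} {body : α → Assignment V → Assignment V → Prop} {l : List α}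
  {σ σ' : Assignment V} {𝓢 D : Set α} {r : α → α → Prop} {I : Set α → Assignment V → Prop}

/-- The invariant depends on the set `D` of entries already processed, and `r` carries what the
order guarantees about them. -/
theorem ForLoop.induct
    (hstep : ∀ D a σ σ', a ∈ 𝓢 → (∀ b ∈ D, r b a) → I D σ → body a σ σ' → I (insert a D) σ')
    (h : ForLoop body l σ σ') (hl : ∀ a ∈ l, a ∈ 𝓢) (hp : l.Pairwise r)
    (hD : ∀ b ∈ D, ∀ a ∈ l, r b a) (hI : I D σ) : I (D ∪ {a | a ∈ l}) σ' := by
  induction h generalizing D with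
  | nil σ => simpa using hI
  | cons a l σ σ₁ σ₂ h₁ h₂ ih =>
    rw [List.pairwise_cons] at hp
    have hI₁ := hstep D a σ σ₁ (hl a List.mem_cons_self) (fun b hb => hD b hb a List.mem_cons_self)
      hI h₁
    have := ih (fun b hb => hl b (List.mem_cons_of_mem _ hb)) hp.2 (fun b hb c hc => by
      rcases hb with rfl | hb
      exacts [hp.1 c hc, hD b hb c (List.mem_cons_of_mem _ hc)]) hI₁
    have heq : insert a D ∪ {b | b ∈ l} = D ∪ {b | b ∈ a :: l} := by
      ext b
      simp only [Set.mem_union, Set.mem_insert_iff, Set.mem_ofPred_eq, List.mem_cons]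
      tauto
    rwa [heq] at this

theorem ForLoop.exists_of_invariant
    (hstep : ∀ D a σ σ', a ∈ 𝓢 → (∀ b ∈ D, r b a) → I D σ → body a σ σ' → I (insert a D) σ')
    (hex : ∀ D a σ, a ∈ 𝓢 → I D σ → ∃ σ', body a σ σ') (hl : ∀ a ∈ l, a ∈ 𝓢) (hp : l.Pairwise r)
    (hD : ∀ b ∈ D, ∀ a ∈ l, r b a) (hI : I D σ) : ∃ σ', ForLoop body l σ σ' := by
  induction l generalizing D σ with
  | nil => exact ⟨σ, .nil σ⟩
  | cons a l ih =>
    rw [List.pairwise_cons] at hp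
    have ha := hl a List.mem_cons_self
    obtain ⟨σ₁, h₁⟩ := hex D a σ ha hI
    obtain ⟨σ₂, h₂⟩ := ih (fun b hb => hl b (List.mem_cons_of_mem _ hb)) hp.2
      (fun b hb c hc => by
        rcases hb with rfl | hb
        exacts [hp.1 c hc, hD b hb c (List.mem_cons_of_mem _ hc)])
      (hstep D a σ σ₁ ha (fun b hb => hD b hb a List.mem_cons_self) hI h₁)
    exact ⟨σ₂, .cons a l σ σ₁ σ₂ h₁ h₂⟩

end Loops

/-! ### The invariants of `ClusterOuter` -/

section Invariants

variable {V : Type u} {G : SimpleGraph V} {E : PlaneEmbedding G} {X : Set V}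
  {𝓡 out : Set (Set V)} {𝓢 D : Set (Supernode V)} {anc : Supernode V → Supernode V → Prop}
  {S₀ S T : Supernode V} {ρ : Supernode V → Set (Set V)} {order : List (Supernode V)}
  {σ σ' : Assignment V} {A P : Set V} {v z : V} {n m : ℕ} {𝓐 𝓑 : Set (Set V)}

/-- The vertex `v` lies in a region of `𝓐` at distance at most `n` from `P`. -/
def NearVertex (G : SimpleGraph V) (𝓐 : Set (Set V)) (n : ℕ) (P : Set V) (v : V) : Prop :=
  ∃ R ∈ 𝓐, v ∈ R ∧ Near G 𝓐 n R P

/-- The vertices of `X` outside all supernodes. -/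
def free (X : Set V) (𝓢 : Set (Supernode V)) : Set V := {x | x ∈ X ∧ ∀ T ∈ 𝓢, x ∉ T.verts}

/-- The component of `v` in the graph of the vertices outside all supernodes. -/
def pocket (G : SimpleGraph V) (X : Set V) (𝓢 : Set (Supernode V)) (v : V) : Set V :=
  {x | Linked G (free X 𝓢) v x}

theorem pocket_isRegion (hv : v ∈ free X 𝓢) : IsRegion G (pocket G X 𝓢 v) := isRegion_linkedSet hv

theorem pocket_subset : pocket G X 𝓢 v ⊆ X := fun _ (hx : Linked G _ _ _) => hx.right_mem.1

theorem pocket_disjoint (hT : T ∈ 𝓢) : Disjoint (pocket G X 𝓢 v) T.verts :=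
  Set.disjoint_left.2 fun _ (hx : Linked G _ _ _) => hx.right_mem.2 T hT

theorem subset_pocket (hA : IsRegion G A) (hAX : A ⊆ X) (hd : ∀ T ∈ 𝓢, Disjoint A T.verts)
    (hv : v ∈ A) : A ⊆ pocket G X 𝓢 v := fun _ hx =>
  (hA.linked hv hx).mono fun _ hy => ⟨hAX hy, fun T hT => Set.disjoint_left.1 (hd T hT) hy⟩

theorem pocket_eq (h : Linked G (free X 𝓢) v z) : pocket G X 𝓢 v = pocket G X 𝓢 z :=
  Set.ext fun _ => ⟨fun hx => h.symm.trans hx, fun hx => h.trans hx⟩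

theorem NearVertex.trans_near (h : NearVertex G 𝓑 n P z) {B : Set V} (hr : Refines 𝓐 𝓑)
    (hA : A ∈ 𝓐) (hB : B ∈ 𝓐) (hvA : v ∈ A) (hzB : z ∈ B) (hAB : Near G 𝓐 m A B) (hm : 1 ≤ m) :
    NearVertex G 𝓑 (m + (1 + n)) P v := by
  obtain ⟨C, hC, hzC, hCP⟩ := h
  obtain ⟨A', hA', hAA'⟩ := hr A hA
  obtain ⟨B', hB', hBB'⟩ := hr B hB
  exact ⟨A', hA', hAA' hvA, (hAB.lift hr ⟨v, hvA⟩ hAA' hA' hBB' hB' hm).trans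
    ((near_one_of_touch hB' hC (touch_of_mem (hBB' hzB) hzC)).trans hCP)⟩

section

variable (hL : Layout E X X ∅ 𝓡 out 𝓢 anc S₀ ρ) (h𝓡 : ⋃₀ 𝓡 = X)

include hL

theorem Layout.mem_expansion (hT : T ∈ 𝓢) (hA : A ∈ expansion G out 𝓢 order T) :
    A ∈ T.regions ∨ (IsLeaf out 𝓢 A ∧ AdjSet G A T.verts) := by
  rcases RegionClustering.mem_expansion hA with h | ⟨hA, ⟨Q, hQ, a, ha, b, hb, hab⟩, hno⟩
  · exact Or.inl h
  · rcases hL.out_split A hA with ⟨T', hT', hAT'⟩ | hd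
    · by_cases h : T' = T
      · exact Or.inl (h ▸ hAT')
      · exact absurd hAT' (hno T' hT' h)
    · refine Or.inr ⟨⟨hA, hd⟩, a, ha, b, ⟨Q, hQ, hb⟩, hab.resolve_left fun h => ?_⟩
      exact Set.disjoint_left.1 (hd T hT) ha (h ▸ ⟨Q, hQ, hb⟩)

theorem Layout.carve_refines (hT : T ∈ 𝓢) : Refines T.regions (ρ T) := by
  have h := RegionClustering.carve_refines (G := G) (𝓡 := ρ T) (π := T.spine)
  rwa [← hL.carved T hT] at h

theorem Layout.expansion_mem_out (hT : T ∈ 𝓢) (hA : A ∈ expansion G out 𝓢 order T) : A ∈ out := by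
  rcases hL.mem_expansion hT hA with h | ⟨hl, -⟩
  exacts [hL.regions_subset T hT h, hl.1]

include h𝓡

theorem Layout.out_subset (hA : A ∈ out) : A ⊆ X := by
  obtain ⟨R, hR, hAR⟩ := hL.out_refines A hA
  exact h𝓡 ▸ hAR.trans (Set.subset_sUnion_of_mem hR)

theorem Layout.expansion_refines (hT : T ∈ 𝓢) : Refines (expansion G out 𝓢 order T) (ρ T) := by
  intro A hA
  rcases hL.mem_expansion hT hA with h | ⟨hl, hadj⟩
  · exact hL.carve_refines hT A h
  · exact hL.leaf_refines A (hL.out_subset h𝓡 hl.1) (hL.out_isRegion A hl.1) hl.2 A hl.1 le_rfl T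
      hT hadj

theorem Layout.expansion_strip (hT : T ∈ 𝓢) :
    Strip G (expansion G out 𝓢 order T) T.spine := by
  have hn : nearSpine G (ρ T) T.spine ⊆ T.regions := by
    have := nearSpine_subset_carve (G := G) (π := T.spine) (hL.isRegion T hT)
    rwa [← hL.carved T hT] at this
  refine strip_of_touch (hL.isRegion T hT) (hL.geodesic T hT)
    (fun A hA => hL.out_isRegion A (hL.expansion_mem_out hT hA))
    (hn.trans regions_subset_expansion) (hL.expansion_refines h𝓡 hT) fun A hA => ?_
  rw [← hL.verts_eq hT]
  rcases hL.mem_expansion hT hA with h | ⟨-, a, ha, b, hb, hab⟩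
  · obtain ⟨x, hx⟩ := (hL.out_isRegion A (hL.regions_subset T hT h)).nonempty
    exact touch_of_mem hx ⟨A, h, hx⟩
  · exact ⟨a, ha, b, hb, Or.inr hab⟩

end

/-- The state after the supernodes in `D` have been assigned. -/
structure SupernodesAssigned (G : SimpleGraph V) (D : Set (Supernode V)) (σ : Assignment V) :
    Prop where
  outside : ∀ v, (∀ S ∈ D, v ∉ S.verts) → σ v = none
  inside : ∀ S ∈ D, ∀ v ∈ S.verts, ∃ P ∈ S.netPoints, σ v = some P ∧
    NearVertex G S.regions 20 P v ∧ ∃ x ∈ P, Linked G {y | σ y = some P} v x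
  net : ∀ S ∈ D, ∀ P ∈ S.netPoints, ∀ v ∈ P, σ v = some P

/-- The state after the expansions of the supernodes in `D` have been assigned. -/
structure ExpansionsAssigned (G : SimpleGraph V) (X : Set V) (out : Set (Set V))
    (𝓢 : Set (Supernode V)) (ρ : Supernode V → Set (Set V)) (order : List (Supernode V))
    (D : Set (Supernode V)) (σ : Assignment V) : Prop where
  inside : ∀ T ∈ 𝓢, ∀ v ∈ T.verts, ∃ P ∈ T.netPoints, σ v = some P ∧ NearVertex G (ρ T) 20 P v
  outside : ∀ v P, σ v = some P → (∀ T ∈ 𝓢, v ∉ T.verts) → v ∈ X ∧ ∃ T ∈ 𝓢, T ∈ D ∧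
    P ∈ T.netPoints ∧ AdjSet G (pocket G X 𝓢 v) T.verts ∧ (NearVertex G (ρ T) 49 P v ∨
      (NearVertex G (ρ T) 78 P v ∧ ∃ S ∈ 𝓢, S ∈ D ∧ S ≠ T ∧ AdjSet G (pocket G X 𝓢 v) S.verts))
  linked : ∀ v P, σ v = some P → ∃ x ∈ P, Linked G {y | σ y = some P} v x
  net : ∀ T ∈ 𝓢, ∀ P ∈ T.netPoints, ∀ v ∈ P, σ v = some P
  full : ∀ S ∈ D, ∀ v ∈ ⋃₀ expansion G out 𝓢 order S, σ v ≠ none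

variable (hL : Layout E X X ∅ 𝓡 out 𝓢 anc S₀ ρ)

include hL

theorem Layout.supernodesAssigned_step (hS : S ∈ 𝓢) (hD : ∀ T ∈ D, T ∈ 𝓢 ∧ T ≠ S)
    (hI : SupernodesAssigned G D σ) (h : assignSupernode G S σ σ') :
    SupernodesAssigned G (insert S D) σ' := by
  have hdis : ∀ T ∈ D, ∀ v ∈ T.verts, v ∉ S.verts := fun T hT v hv hv' =>
    Set.disjoint_left.1 (hL.disjoint T (hD T hT).1 S hS (hD T hT).2) hv hv'
  obtain ⟨h1, h2, h3⟩ := assignSupernode_spec (hL.strip hS) (fun v hv => hI.outside v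
    fun T hT hvT => hdis T hT v hvT hv) h
  have hgrow : ∀ y P, σ y = some P → σ' y = some P := fun y P hy => by
    by_cases hyS : y ∈ S.verts
    · rw [hI.outside y fun T hT hyT => hdis T hT y hyT hyS] at hy
      cases hy
    · rw [h1 y hyS, hy]
  refine ⟨fun v hv => ?_, ?_, ?_⟩
  · rw [h1 v (hv S (Set.mem_insert _ _))]
    exact hI.outside v fun T hT => hv T (Set.mem_insert_of_mem _ hT)
  · rintro T (rfl | hT) v hv
    · exact h2 v hv
    · obtain ⟨P, hP, hvP, hn, x, hx, hl⟩ := hI.inside T hT v hv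
      exact ⟨P, hP, hgrow v P hvP, hn, x, hx, hl.mono fun y (hy : σ y = some P) => hgrow y P hy⟩
  · rintro T (rfl | hT) P hP v hv
    · exact h3 P hP v hv
    · exact hgrow v P (hI.net T hT P hP v hv)

theorem Layout.expansionsAssigned_empty (hI : SupernodesAssigned G 𝓢 σ) :
    ExpansionsAssigned G X out 𝓢 ρ order ∅ σ where
  inside T hT v hv := by
    obtain ⟨P, hP, hvP, ⟨A, hA, hvA, hAP⟩, -⟩ := hI.inside T hT v hv
    obtain ⟨B, hB, hAB⟩ := hL.carve_refines hT A hA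
    exact ⟨P, hP, hvP, B, hB, hAB hvA, hAP.lift (hL.carve_refines hT) ⟨v, hvA⟩ hAB hB le_rfl
      ((hL.geodesic T hT).netPoint_mem hP) (by omega)⟩
  outside v P hv hout := by
    rw [hI.outside v hout] at hv
    cases hv
  linked v P hv := by
    by_cases hout : ∀ T ∈ 𝓢, v ∉ T.verts
    · rw [hI.outside v hout] at hv
      cases hv
    · push Not at hout
      obtain ⟨T, hT, hvT⟩ := hout
      obtain ⟨Q, -, hvQ, -, x, hx, hl⟩ := hI.inside T hT v hvT
      rw [hv, Option.some_inj] at hvQ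
      exact hvQ ▸ ⟨x, hx, hl⟩
  net := hI.net
  full S hS := hS.elim

/-- A new vertex outside the supernodes copies the label of some `z` at distance at most 28. If `z`
lies in `S`, the bound is 28 + 1 + 20 = 49. Otherwise `z` is in the same pocket and was labelled
from an earlier supernode `T`, which gives 28 + 1 + 49 = 78. -/
theorem Layout.expansionsAssigned_step (h𝓡 : ⋃₀ 𝓡 = X) (hS : S ∈ 𝓢)
    (hD : ∀ T ∈ D, T ≠ S ∧ ¬ anc S T)
    (hI : ExpansionsAssigned G X out 𝓢 ρ order D σ)
    (h : assignExpansion G (expansion G out 𝓢 order S) S σ σ') :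
    ExpansionsAssigned G X out 𝓢 ρ order (insert S D) σ' := by
  obtain ⟨e, hfull, hg⟩ := assignExpansion_spec (hL.expansion_strip h𝓡 hS) h
  set Sp := expansion G out 𝓢 order S
  have hgrow : ∀ y P, σ y = some P → σ' y = some P := fun y P hy => by
    rw [e y (by rw [hy]; simp), hy]
  have hSpX : ⋃₀ Sp ⊆ X := Set.sUnion_subset fun A hA =>
    hL.out_subset h𝓡 (hL.expansion_mem_out hS hA)
  have hleaf : ∀ A ∈ Sp, ∀ x ∈ A, x ∉ S.verts → IsLeaf out 𝓢 A ∧ AdjSet G A S.verts :=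
    fun A hA x hx hxS => (hL.mem_expansion hS hA).resolve_left fun h => hxS ⟨A, h, hx⟩
  have hnew : ∀ v P, σ' v = some P → σ' v ≠ σ v → ∃ z, σ z = some P ∧
      Linked G {y | σ' y = some P} v z ∧ σ v = none ∧ AChain G (⋃₀ Sp) σ σ' v z ∧
      ∃ A ∈ Sp, v ∈ A ∧ ∃ B ∈ Sp, z ∈ B ∧ Near G Sp 28 A B := by
    intro v P hv hne
    obtain ⟨hσv, -, z, hc, hz, hAB⟩ := (hg v).resolve_left hne
    have hzP : σ' z = some P := hc.label.symm.trans hv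
    have hl := hc.linked
    rw [hzP] at hl
    exact ⟨z, (e z hz).symm.trans hzP, hl, hσv, hc, hAB⟩
  refine ⟨fun T hT v hv => ?_, fun v P hv hout => ?_, fun v P hv => ?_,
    fun T hT P hP v hv => hgrow v P (hI.net T hT P hP v hv), ?_⟩
  · obtain ⟨P, hP, hvP, hn⟩ := hI.inside T hT v hv
    exact ⟨P, hP, hgrow v P hvP, hn⟩
  · by_cases hne : σ' v = σ v
    · obtain ⟨hvX, T, hT, hTD, hP, hadj, hn⟩ := hI.outside v P (hne ▸ hv) hout
      refine ⟨hvX, T, hT, Set.mem_insert_of_mem _ hTD, hP, hadj, hn.imp_right ?_⟩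
      rintro ⟨hn, S', hS', hS'D, hne, hadj'⟩
      exact ⟨hn, S', hS', Set.mem_insert_of_mem _ hS'D, hne, hadj'⟩
    · obtain ⟨z, hz, -, -, hc, A, hA, hvA, B, hB, hzB, hAB⟩ := hnew v P hv hne
      have hvX : v ∈ X := hSpX ⟨A, hA, hvA⟩
      obtain ⟨hAl, hAS⟩ := hleaf A hA v hvA (hout S hS)
      have hadjS : AdjSet G (pocket G X 𝓢 v) S.verts := hAS.mono
        (subset_pocket (hL.out_isRegion A hAl.1) (hL.out_subset h𝓡 hAl.1) hAl.2 hvA) le_rfl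
      refine ⟨hvX, ?_⟩
      by_cases hzS : z ∈ S.verts
      · obtain ⟨Q, hQ, hzQ, hn⟩ := hI.inside S hS z hzS
        rw [hz, Option.some_inj] at hzQ
        subst hzQ
        exact ⟨S, hS, Set.mem_insert _ _, hQ, hadjS, Or.inl
          (hn.trans_near (hL.expansion_refines h𝓡 hS) hA hB hvA hzB hAB (by omega))⟩
      · obtain ⟨hBl, -⟩ := hleaf B hB z hzB hzS
        have hzout : ∀ T ∈ 𝓢, z ∉ T.verts := fun T hT => Set.disjoint_left.1 (hBl.2 T hT) hzB
        -- Vertices of supernodes are assigned already, so a chain through unassigned vertices stays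
        -- in one pocket.
        have hvz : Linked G (free X 𝓢) v z := by
          have hzfree : z ∈ free X 𝓢 := ⟨hSpX ⟨B, hB, hzB⟩, hzout⟩
          clear hne hv hout hvA hAB hadjS hvX
          induction hc using Relation.ReflTransGen.head_induction_on with
          | refl => exact .refl hzfree
          | @head a c hac _ ih =>
            refine (Linked.of_adj (A := free X 𝓢) ⟨hSpX hac.2.1, fun T hT haT => ?_⟩ ih.left_mem
              hac.1).trans ih
            obtain ⟨Q, -, haQ, -⟩ := hI.inside T hT a haT
            rw [hac.2.2.2.1] at haQ
            cases haQ
        obtain ⟨-, T, hT, hTD, hPT, hadj, hn⟩ := hI.outside z P hz hzout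
        rw [← pocket_eq hvz] at hadj hn
        have hvfree := hvz.left_mem
        have hTS := hD T hTD
        -- The weaker bound 78 would require another processed supernode touching the pocket, a
        -- third one besides `T` and `S`.
        have hn' : NearVertex G (ρ T) 49 P z := by
          refine hn.resolve_right ?_
          rintro ⟨-, S', hS', hS'D, hne', hadj'⟩
          obtain ⟨T₁, T₂, h12⟩ := hL.adj_two _ pocket_subset (pocket_isRegion hvfree)
            fun T hT => pocket_disjoint hT
          have h1 := h12 S hS hadjS
          have h2 := h12 T hT hadj
          have h3 := h12 S' hS' hadj'
          have h4 := hTS.1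
          have h5 := (hD S' hS'D).1
          grind
        -- Ancestors come first, so of the two comparable supernodes the earlier one, `T`, is the
        -- ancestor. Distances measured in the expansion of `S` therefore carry over to `ρ T`.
        have hrefine : Refines (ρ S) (ρ T) := by
          rcases hL.adj_anc _ pocket_subset (pocket_isRegion hvfree)
            (fun T hT => pocket_disjoint hT) T hT S hS hadj hadjS hTS.1 with h | h
          · exact h.2
          · exact absurd h.1 hTS.2
        exact ⟨T, hT, Set.mem_insert_of_mem _ hTD, hPT, hadj, Or.inr
          ⟨hn'.trans_near ((hL.expansion_refines h𝓡 hS).trans hrefine) hA hB hvA hzB hAB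
            (by omega), S, hS, Set.mem_insert _ _, hTS.1.symm, hadjS⟩⟩
  · by_cases hne : σ' v = σ v
    · obtain ⟨x, hx, hl⟩ := hI.linked v P (hne ▸ hv)
      exact ⟨x, hx, hl.mono fun y hy => hgrow y P hy⟩
    · obtain ⟨z, hz, hl, -⟩ := hnew v P hv hne
      obtain ⟨x, hx, hl'⟩ := hI.linked z P hz
      exact ⟨x, hx, hl.trans (hl'.mono fun y hy => hgrow y P hy)⟩
  · rintro T (rfl | hT) v hv
    · exact hfull v hv
    · have := hI.full T hT v hv
      rwa [e v this]

end Invariants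

end RegionClustering

namespace RegionClustering

/-! ### Routes -/

section Routes

variable {V : Type u} {G : SimpleGraph V} {A B C F N Q : Set V} {𝓕 : Set (Set V)}
  {a b c d x y : V} {n m : ℕ} {Pr : Set V → Prop}

/-- There is a walk from `a` to `b` that is composed of `n` walks, each of which stays in a member
of `𝓕`. -/
inductive Route (G : SimpleGraph V) (𝓕 : Set (Set V)) : ℕ → V → V → Prop
  | single {F : Set V} {a b : V} (hF : F ∈ 𝓕) (h : Linked G F a b) : Route G 𝓕 1 a b
  | mono {n m : ℕ} {a b : V} (h : Route G 𝓕 n a b) (hnm : n ≤ m) : Route G 𝓕 m a b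
  | trans_adj {n m : ℕ} {a b c d : V} (h : Route G 𝓕 n a b) (hbc : G.Adj b c)
      (h' : Route G 𝓕 m c d) : Route G 𝓕 (n + m) a d
  | trans {n m : ℕ} {a b c : V} (h : Route G 𝓕 n a b) (h' : Route G 𝓕 m b c) :
      Route G 𝓕 (n + m) a c

theorem Linked.route (h : Linked G F a b) (hF : F ∈ 𝓕) : Route G 𝓕 1 a b := .single hF h

theorem Route.exists_walk (h : Route G 𝓕 n a b) :
    ∃ (Γ : G.Walk a b) (pieces : List (List V)), Γ.support.Sublist pieces.flatten ∧
      pieces.length ≤ n ∧ ∀ L ∈ pieces, ∃ F ∈ 𝓕, ∀ x ∈ L, x ∈ F := by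
  induction h with
  | single hF h =>
    obtain ⟨Γ, hΓ⟩ := h
    exact ⟨Γ, [Γ.support], by simp, le_rfl, by simpa using ⟨_, hF, hΓ⟩⟩
  | mono _ hnm ih =>
    obtain ⟨Γ, p, h1, h2, h3⟩ := ih
    exact ⟨Γ, p, h1, h2.trans hnm, h3⟩
  | trans_adj _ hbc _ ih ih' =>
    obtain ⟨Γ, p, h1, h2, h3⟩ := ih
    obtain ⟨Γ', p', h1', h2', h3'⟩ := ih'
    refine ⟨Γ.append (.cons hbc Γ'), p ++ p', ?_, by rw [List.length_append]; omega, ?_⟩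
    · rw [SimpleGraph.Walk.support_append, List.flatten_append, SimpleGraph.Walk.support_cons,
        List.tail_cons]
      exact h1.append h1'
    · exact fun L hL => (List.mem_append.1 hL).elim (h3 L) (h3' L)
  | trans _ _ ih ih' =>
    obtain ⟨Γ, p, h1, h2, h3⟩ := ih
    obtain ⟨Γ', p', h1', h2', h3'⟩ := ih'
    refine ⟨Γ.append Γ', p ++ p', ?_, by rw [List.length_append]; omega, ?_⟩
    · rw [SimpleGraph.Walk.support_append, List.flatten_append]
      exact h1.append ((List.tail_sublist _).trans h1')
    · exact fun L hL => (List.mem_append.1 hL).elim (h3 L) (h3' L)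

/-- Removing loops from a walk keeps a sublist of its vertices; the division into pieces survives
this. -/
theorem exists_flatten_of_sublist {l : List V} {L : List (List V)} (h : l.Sublist L.flatten) :
    ∃ L' : List (List V), l = L'.flatten ∧ L'.length = L.length ∧ ∀ M ∈ L', ∃ N ∈ L, M ⊆ N := by
  induction L generalizing l with
  | nil => exact ⟨[], by simpa using h, rfl, by simp⟩
  | cons N L ih =>
    rw [List.flatten_cons, List.sublist_append_iff] at h
    obtain ⟨l₁, l₂, rfl, h₁, h₂⟩ := h
    obtain ⟨L', rfl, hlen, hL'⟩ := ih h₂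
    refine ⟨l₁ :: L', by simp, by simp [hlen], fun M hM => ?_⟩
    rcases List.mem_cons.1 hM with rfl | hM
    · exact ⟨N, List.mem_cons_self, h₁.subset⟩
    · obtain ⟨N', hN', hMN⟩ := hL' M hM
      exact ⟨N', List.mem_cons_of_mem _ hN', hMN⟩

/-- Walks can be turned into paths, with the pieces partitioning the path. -/
theorem Route.exists_path (h : Route G 𝓕 n a b) :
    ∃ (Γ : G.Walk a b) (pieces : List (List V)), Γ.IsPath ∧ Γ.support = pieces.flatten ∧
      pieces.length ≤ n ∧ ∀ L ∈ pieces, ∃ F ∈ 𝓕, ∀ x ∈ L, x ∈ F := by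
  classical
  obtain ⟨Γ, p, h1, h2, h3⟩ := h.exists_walk
  obtain ⟨p', hp', hlen, hsub⟩ := exists_flatten_of_sublist
    (Γ.support_bypass_sublist_support.trans h1)
  refine ⟨Γ.bypass, p', Γ.bypass_isPath, hp', hlen.trans_le h2, fun L hL => ?_⟩
  obtain ⟨N, hN, hLN⟩ := hsub L hL
  obtain ⟨F, hF, hNF⟩ := h3 N hN
  exact ⟨F, hF, fun x hx => hNF x (hLN hx)⟩

/-- The part of a walk before it leaves `B`. -/
theorem Linked.first_exit (h : Linked G A a b) (ha : a ∈ B) : Linked G B a b ∨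
    ∃ y x, Linked G B a y ∧ G.Adj y x ∧ x ∉ B ∧ Linked G A x b := by
  obtain ⟨p, hp⟩ := h
  induction p with
  | nil => exact Or.inl (.refl ha)
  | @cons u v w hadj p ih =>
    have hp' : ∀ x ∈ p.support, x ∈ A := fun x hx => hp x (by simp [hx])
    by_cases hv : v ∈ B
    · rcases ih hv hp' with h | ⟨y, x, h1, h2⟩
      · exact Or.inl ((Linked.of_adj ha hv hadj).trans h)
      · exact Or.inr ⟨y, x, (Linked.of_adj ha hv hadj).trans h1, h2⟩
    · exact Or.inr ⟨u, v, .refl ha, hadj, hv, p, hp'⟩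

/-- The part of a walk after it meets `C` for the last time. -/
theorem Linked.last_exit (h : Linked G A a b) : Linked G (A \ C) a b ∨ b ∈ C ∨
    ∃ y ∈ C, ∃ z, G.Adj y z ∧ Linked G (A \ C) z b := by
  obtain ⟨p, hp⟩ := h
  induction p with
  | @nil u =>
    by_cases hu : u ∈ C
    · exact Or.inr (Or.inl hu)
    · exact Or.inl (.refl (A := A \ C) ⟨hp u (by simp), hu⟩)
  | @cons u v w hadj p ih =>
    rcases ih fun x hx => hp x (by simp [hx]) with h | h
    · by_cases hu : u ∈ C
      · exact Or.inr (Or.inr ⟨u, hu, v, hadj, h⟩)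
      · exact Or.inl ((Linked.of_adj (A := A \ C) ⟨hp u (by simp), hu⟩ h.left_mem hadj).trans h)
    · exact Or.inr h

/-- A walk through `F` and `n` connected sets needs at most `2 n + 1` pieces. -/
theorem route_of_linked (hF : F ∈ 𝓕) (𝓚 : Finset (Set V)) (h𝓚 : ∀ C ∈ 𝓚, C ∈ 𝓕 ∧ IsRegion G C)
    (h : Linked G (F ∪ ⋃₀ {C | C ∈ 𝓚}) a b) : Route G 𝓕 (2 * 𝓚.card + 1) a b := by
  classical
  induction hn : 𝓚.card generalizing 𝓚 a b with
  | zero =>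
    rw [Finset.card_eq_zero] at hn
    subst hn
    exact (h.mono (by simp)).route hF
  | succ n ih =>
    -- One piece inside the connected set `C` shortcuts to the last visit of `C`. The rest avoids
    -- `C` and by induction needs `2 n + 1` pieces.
    have key : ∀ x ∉ F, Linked G (F ∪ ⋃₀ {C | C ∈ 𝓚}) x b → Route G 𝓕 (2 * n + 2) x b := by
      intro x hx hxb
      obtain ⟨C, hC, hxC⟩ := hxb.left_mem.resolve_left hx
      have hC' := h𝓚 C hC
      rcases hxb.last_exit (C := C) with h | h | ⟨y, hy, z, hyz, hz⟩
      · exact absurd hxC h.left_mem.2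
      · exact ((hC'.2.linked hxC h).route hC'.1).mono (by omega)
      · refine (((hC'.2.linked hxC hy).route hC'.1).trans_adj hyz
          (ih (𝓚.erase C) (fun D hD => h𝓚 D (Finset.mem_of_mem_erase hD)) (hz.mono ?_)
            (by rw [Finset.card_erase_of_mem hC]; omega))).mono (by omega)
        rintro w ⟨hw | ⟨D, hD, hwD⟩, hwC⟩
        · exact Or.inl hw
        · exact Or.inr ⟨D, Finset.mem_erase.2 ⟨fun h => hwC (h ▸ hwD), hD⟩, hwD⟩
    by_cases ha : a ∈ F
    · rcases h.first_exit ha with h | ⟨y, x, h1, h2, h3, h4⟩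
      · exact (h.route hF).mono (by omega)
      · exact ((h1.route hF).trans_adj h2 (key x h3 h4)).mono (by omega)
    · exact (key a ha h).mono (by omega)

theorem Splits.route (h : Splits G Pr N Q)
    (hN : ∀ x ∈ Q ∩ N, ∀ y ∈ Q ∩ N, Route G 𝓕 n x y)
    (hPr : ∀ Q' ⊆ Q, IsRegion G Q' → Pr Q' → ∀ x ∈ Q', ∀ y ∈ Q', Route G 𝓕 m x y)
    (hx : x ∈ Q) (hy : y ∈ Q) : Route G 𝓕 (m + n + m) x y := by
  have key : ∀ x ∈ Q, ∀ z ∈ Q ∩ N, Route G 𝓕 (m + n) x z := by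
    intro x hx z hz
    rcases h.2 x hx with hxN | ⟨Q', hQ', hxQ', hreg, hP, c, hc, d, hd, hcd⟩
    · exact (hN x ⟨hx, hxN⟩ z hz).mono (by omega)
    · exact (hPr Q' hQ' hreg hP x hxQ' c hc).trans_adj hcd (hN d hd z hz)
  rcases h.2 y hy with hyN | ⟨Q', hQ', hyQ', hreg, hP, c, hc, d, hd, hcd⟩
  · exact (key x hx y ⟨hy, hyN⟩).mono (by omega)
  · exact (key x hx d hd).trans_adj hcd.symm (hPr Q' hQ' hreg hP c hc y hyQ')

end Routes

/-! ### The scattering constant -/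

section Scattering

variable {V : Type u} {G : SimpleGraph V} {E : PlaneEmbedding G} {X : Set V}
  {𝓡 out : Set (Set V)} {𝓢 D : Set (Supernode V)} {anc : Supernode V → Supernode V → Prop}
  {S₀ S T : Supernode V} {ρ : Supernode V → Set (Set V)} {order : List (Supernode V)}
  {σ σ' : Assignment V} {A P Q R F : Set V} {v x y z : V} {n m : ℕ} {𝓐 𝓑 𝓕 : Set (Set V)}

/-- Only few net points are close to a given region. -/
theorem Geodesic.few_netPoints (h : Geodesic G 𝓐 S.spine) (A : Set V) :
    ∃ F : Finset (Set V), F.card ≤ 13 ∧ (∀ P ∈ F, P ∈ S.netPoints) ∧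
      ∀ P ∈ S.netPoints, Near G 𝓐 84 A P → P ∈ F := by
  classical
  by_cases hex : ∃ k : ℕ, ∃ P, S.spine[14 * k]? = some P ∧ Near G 𝓐 84 A P
  swap
  · refine ⟨∅, by simp, by simp, fun P hP hAP => ?_⟩
    obtain ⟨k, hk⟩ := mem_netPoints.1 hP
    exact absurd ⟨k, P, hk, hAP⟩ hex
  obtain ⟨P₀, hP₀, hAP₀⟩ := Nat.find_spec hex
  set k₀ := Nat.find hex
  -- From the first close net point on, others are at most 84 + 84 = 12 · 14 indices away, which
  -- leaves 13 candidates. Past the end of the spine, the default `P₀` is itself a net point.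
  refine ⟨((Finset.range 13).image fun i => (S.spine[14 * (k₀ + i)]?).getD P₀),
    Finset.card_image_le.trans (by simp), ?_, ?_⟩
  · intro P hP
    obtain ⟨i, -, rfl⟩ := Finset.mem_image.1 hP
    cases hi : S.spine[14 * (k₀ + i)]? with
    | none => exact mem_netPoints.2 ⟨k₀, hP₀⟩
    | some P => exact mem_netPoints.2 ⟨_, hi⟩
  · intro P hP hAP
    obtain ⟨k, hk⟩ := mem_netPoints.1 hP
    have h1 : k₀ ≤ k := Nat.find_min' hex ⟨P, hk, hAP⟩
    have h2 := h.sep _ _ _ _ _ hk hP₀ (hAP.symm.trans hAP₀)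
    refine Finset.mem_image.2 ⟨k - k₀, Finset.mem_range.2 (by omega), ?_⟩
    rw [Nat.add_sub_cancel' h1, hk]
    rfl

/-- The cluster of `P`. -/
def cluster (σ : Assignment V) (P : Set V) : Set V := {v | σ v = some P}

variable (hL : Layout E X X ∅ 𝓡 out 𝓢 anc S₀ ρ)
  (hσ : ExpansionsAssigned G X out 𝓢 ρ order D σ)

include hL hσ

theorem Layout.cluster_isRegion (hT : T ∈ 𝓢) (hP : P ∈ T.netPoints) :
    IsRegion G (cluster σ P) := by
  have hPreg := hL.isRegion T hT P ((hL.geodesic T hT).netPoint_mem hP)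
  have hsub : P ⊆ cluster σ P := fun v hv => hσ.net T hT P hP v hv
  obtain ⟨x, hx⟩ := hPreg.nonempty
  refine isRegion_of_center (hsub hx) fun v hv => ?_
  obtain ⟨y, hy, hvy⟩ := hσ.linked v P hv
  exact ((hPreg.linked hx hy).mono hsub).trans hvy.symm

/-- Inside a supernode, two vertices of a region are joined through few clusters. -/
theorem Layout.route_supernode (hT : T ∈ 𝓢) (hR : R ∈ ρ T) (hF : F ∈ 𝓕)
    (h𝓕 : ∀ P ∈ T.netPoints, cluster σ P ∈ 𝓕) (hx : x ∈ R ∩ T.verts) (hy : y ∈ R ∩ T.verts) :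
    Route G 𝓕 27 x y := by
  classical
  have hg := hL.geodesic T hT
  obtain ⟨𝓝, hcard, hnet, hnear⟩ := hg.few_netPoints R
  have hin : ∀ v ∈ R ∩ T.verts, ∃ P ∈ T.netPoints, Near G (ρ T) 21 R P ∧
      ∃ z ∈ P, Linked G (cluster σ P) v z := by
    rintro v ⟨hvR, hvT⟩
    obtain ⟨P, hP, hvP, A, hA, hvA, hAP⟩ := hσ.inside T hT v hvT
    exact ⟨P, hP, ((near_one_of_touch hR hA (touch_of_mem hvR hvA)).trans hAP).mono (by omega),
      hσ.linked v P hvP⟩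
  set U : Set V := F ∪ ⋃₀ {C | C ∈ 𝓝.image (cluster σ)} with hU
  have hUP : ∀ P ∈ T.netPoints, Near G (ρ T) 84 R P → cluster σ P ⊆ U := fun P hP hRP v hv =>
    Or.inr ⟨cluster σ P, Finset.mem_image_of_mem _ (hnear P hP hRP), hv⟩
  -- The net points reached from the two ends are joined along the spine. They are at most 42
  -- indices apart, so labels met there belong to net points within 21 + 42 + 1 + 20 = 84 of `R`.
  have hspine : ∀ (i j : ℕ) (P P' : Set V), i ≤ j → T.spine[i]? = some P →
      T.spine[j]? = some P' → Near G (ρ T) 21 R P → Near G (ρ T) 21 R P' → ∀ z ∈ P, ∀ z' ∈ P',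
      Linked G U z z' := by
    intro i j P P' hij hP hP' hRP hRP' z hz z' hz'
    refine (hg.linked_segment (hL.isRegion T hT) hij hP hP' hz hz').mono ?_
    rintro w ⟨k, Q, hik, hkj, hQ, hwQ⟩
    have h42 := hg.sep _ _ _ _ _ hP' hP (hRP'.symm.trans hRP)
    have hPQ := (hg.near hik hP hQ).mono (m := 42) (by omega)
    have hwT : w ∈ T.verts := ⟨Q, (hL.strip hT).mem Q (List.mem_of_getElem? hQ), hwQ⟩
    obtain ⟨P'', hP'', hwP, A, hA, hwA, hAP⟩ := hσ.inside T hT w hwT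
    exact hUP P'' hP'' ((hRP.trans (hPQ.trans ((near_one_of_touch (hg.mem Q
      (List.mem_of_getElem? hQ)) hA (touch_of_mem hwQ hwA)).trans hAP))).mono (by omega)) hwP
  obtain ⟨P, hP, hRP, z, hz, hxz⟩ := hin x hx
  obtain ⟨P', hP', hRP', z', hz', hyz'⟩ := hin y hy
  obtain ⟨k, hk⟩ := mem_netPoints.1 hP
  obtain ⟨k', hk'⟩ := mem_netPoints.1 hP'
  have hzz' : Linked G U z z' := by
    rcases le_total (14 * k) (14 * k') with h | h
    · exact hspine _ _ P P' h hk hk' hRP hRP' z hz z' hz'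
    · exact (hspine _ _ P' P h hk' hk hRP' hRP z' hz' z hz).symm
  have hxy : Linked G U x y := ((hxz.mono (hUP P hP (hRP.mono (by omega)))).trans hzz').trans
    (hyz'.mono (hUP P' hP' (hRP'.mono (by omega)))).symm
  refine (route_of_linked hF (𝓝.image (cluster σ)) ?_ hxy).mono ?_
  · intro C hC
    obtain ⟨P, hP, rfl⟩ := Finset.mem_image.1 hC
    exact ⟨h𝓕 P (hnet P hP), hL.cluster_isRegion hσ hT (hnet P hP)⟩
  · have := Finset.card_image_le (s := 𝓝) (f := cluster σ)
    omega

/-- A leaf region meets few clusters. -/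
theorem Layout.route_leaf (h𝓡 : ⋃₀ 𝓡 = X) (hQ : IsLeaf out 𝓢 Q) (hF : F ∈ 𝓕)
    (hQF : ∀ v ∈ Q, σ v = none → v ∈ F)
    (h𝓕 : ∀ T ∈ 𝓢, ∀ P ∈ T.netPoints, cluster σ P ∈ 𝓕) (hx : x ∈ Q) (hy : y ∈ Q) :
    Route G 𝓕 53 x y := by
  classical
  have hQreg := hL.out_isRegion Q hQ.1
  have hQK : Q ⊆ pocket G X 𝓢 x := subset_pocket hQreg (hL.out_subset h𝓡 hQ.1) hQ.2 hx
  set K := pocket G X 𝓢 x with hK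
  have hKreg : IsRegion G K := pocket_isRegion (Linked.left_mem (hQK hx))
  have hKd : ∀ T ∈ 𝓢, Disjoint K T.verts := fun T hT => pocket_disjoint hT
  obtain ⟨T₁, T₂, hT₁₂⟩ := hL.adj_two K pocket_subset hKreg hKd
  -- For a supernode next to the pocket, `Q` lies in one region of `ρ T`, so relevant net points are
  -- within 1 + 78 of that region. Two supernodes contribute at most 26 clusters, hence 2 · 26 + 1 =
  -- 53 pieces.
  have hfew : ∀ T, ∃ 𝓝 : Finset (Set V), 𝓝.card ≤ 13 ∧
      (∀ P ∈ 𝓝, T ∈ 𝓢 ∧ P ∈ T.netPoints) ∧ (T ∈ 𝓢 → AdjSet G K T.verts → ∀ v ∈ Q,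
        ∀ P ∈ T.netPoints, NearVertex G (ρ T) 78 P v → P ∈ 𝓝) := by
    intro T
    by_cases hT : T ∈ 𝓢 ∧ AdjSet G K T.verts
    swap
    · exact ⟨∅, by simp, by simp, fun h1 h2 => absurd ⟨h1, h2⟩ hT⟩
    obtain ⟨hT, hKT⟩ := hT
    obtain ⟨R, hR, hQR⟩ := hL.leaf_refines K pocket_subset hKreg hKd Q hQ.1 hQK T hT hKT
    obtain ⟨𝓝, h1, h2, h3⟩ := (hL.geodesic T hT).few_netPoints R
    refine ⟨𝓝, h1, fun P hP => ⟨hT, h2 P hP⟩, fun _ _ v hv P hP ⟨A, hA, hvA, hAP⟩ => ?_⟩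
    exact h3 P hP (((near_one_of_touch hR hA (touch_of_mem (hQR hv) hvA)).trans hAP).mono
      (by omega))
  obtain ⟨𝓝₁, hc₁, hn₁, h₁⟩ := hfew T₁
  obtain ⟨𝓝₂, hc₂, hn₂, h₂⟩ := hfew T₂
  have hsub : Q ⊆ F ∪ ⋃₀ {C | C ∈ (𝓝₁ ∪ 𝓝₂).image (cluster σ)} := by
    intro v hv
    by_cases hne : σ v = none
    · exact Or.inl (hQF v hv hne)
    obtain ⟨P, hvP⟩ := Option.ne_none_iff_exists'.1 hne
    obtain ⟨-, T, hT, -, hP, hadj, hn⟩ := hσ.outside v P hvP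
      fun T hT => Set.disjoint_left.1 (hQ.2 T hT) hv
    rw [← pocket_eq (hQK hv), ← hK] at hadj
    have hn' : NearVertex G (ρ T) 78 P v := by
      rcases hn with ⟨A, hA, hvA, hAP⟩ | ⟨hn, -⟩
      · exact ⟨A, hA, hvA, hAP.mono (by omega)⟩
      · exact hn
    refine Or.inr ⟨cluster σ P, Finset.mem_image_of_mem _ (Finset.mem_union.2 ?_), hvP⟩
    rcases hT₁₂ T hT hadj with rfl | rfl
    · exact Or.inl (h₁ hT hadj v hv P hP hn')
    · exact Or.inr (h₂ hT hadj v hv P hP hn')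
  refine (route_of_linked hF ((𝓝₁ ∪ 𝓝₂).image (cluster σ)) ?_
    ((hQreg.linked hx hy).mono hsub)).mono ?_
  · intro C hC
    obtain ⟨P, hP, rfl⟩ := Finset.mem_image.1 hC
    have hP' : ∃ T ∈ 𝓢, P ∈ T.netPoints := by
      rcases Finset.mem_union.1 hP with h | h
      exacts [⟨_, hn₁ P h⟩, ⟨_, hn₂ P h⟩]
    obtain ⟨T, hT, hPT⟩ := hP'
    exact ⟨h𝓕 T hT P hPT, hL.cluster_isRegion hσ hT hPT⟩
  · have h1 := Finset.card_image_le (s := 𝓝₁ ∪ 𝓝₂) (f := cluster σ)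
    have h2 := Finset.card_union_le 𝓝₁ 𝓝₂
    omega

theorem Layout.route (h𝓡 : ⋃₀ 𝓡 = X) (hR : R ∈ 𝓡) (hF : F ∈ 𝓕)
    (hRF : ∀ v ∈ R, σ v = none → v ∈ F)
    (h𝓕 : ∀ T ∈ 𝓢, ∀ P ∈ T.netPoints, cluster σ P ∈ 𝓕) (hx : x ∈ R) (hy : y ∈ R) :
    Route G 𝓕 293 x y := by
  have hleaf : ∀ Q ⊆ R, IsLeaf out 𝓢 Q → ∀ x ∈ Q, ∀ y ∈ Q, Route G 𝓕 53 x y :=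
    fun Q hQR hQ x hx y hy => hL.route_leaf hσ h𝓡 hQ hF (fun v hv => hRF v (hQR hv)) h𝓕 hx hy
  have hsplit : ∀ T ∈ 𝓢, ∀ Q ⊆ R, Q ∈ ρ T → ∀ m Pr, Splits G Pr T.verts Q →
      (∀ Q' ⊆ Q, IsRegion G Q' → Pr Q' → ∀ x ∈ Q', ∀ y ∈ Q', Route G 𝓕 m x y) →
      ∀ x ∈ Q, ∀ y ∈ Q, Route G 𝓕 (m + 27 + m) x y := by
    intro T hT Q hQR hQ m Pr hs hPr x hx y hy
    exact hs.route (fun x hx y hy => hL.route_supernode hσ hT hQ hF (h𝓕 T hT) hx hy) hPr hx hy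
  rcases hL.split R hR with h | ⟨T, hT, hRT, hs⟩
  · exact (hleaf R le_rfl h x hx y hy).mono (by omega)
  · refine hsplit T hT R le_rfl hRT 133 _ hs (fun Q hQR _ hQ => ?_) x hx y hy
    rcases hQ with h | ⟨T', hT', hQT', hs'⟩
    · exact fun x hx y hy => (hleaf Q hQR h x hx y hy).mono (by omega)
    · exact hsplit T' hT' Q hQR hQT' 53 _ hs' fun Q' hQ' _ h => hleaf Q' (hQ'.trans hQR) h

end Scattering

end RegionClustering

/-! ### Runs of `ClusterOuter` and `Cluster`, and the count of clusters -/

namespace RegionClustering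

section Outer

variable {V : Type u} {G : SimpleGraph V} {E : PlaneEmbedding G} {X H W K : Set V}
  {𝓡 out 𝓒 : Set (Set V)} {𝓢 D : Set (Supernode V)} {anc : Supernode V → Supernode V → Prop}
  {S₀ S T : Supernode V} {ρ : Supernode V → Set (Set V)} {order l : List (Supernode V)}
  {σ σ' : Assignment V} {A P Q R : Set V} {v x y z : V} {n m : ℕ}

/-! ### Runs of `ClusterOuter` -/

/-- The invariant for the assignment of the supernodes. -/
theorem Layout.supernodesAssigned_loop (hL : Layout E X X ∅ 𝓡 out 𝓢 anc S₀ ρ)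
    (D : Set (Supernode V)) (S : Supernode V) (σ σ' : Assignment V) (hS : S ∈ 𝓢)
    (hD : ∀ T ∈ D, T ≠ S) (hI : D ⊆ 𝓢 ∧ SupernodesAssigned G D σ)
    (h : assignSupernode G S σ σ') : insert S D ⊆ 𝓢 ∧ SupernodesAssigned G (insert S D) σ' :=
  ⟨Set.insert_subset hS hI.1,
    hL.supernodesAssigned_step hS (fun T hT => ⟨hI.1 hT, hD T hT⟩) hI.2 h⟩

theorem supernodesAssigned_empty : SupernodesAssigned G ∅ (fun _ => none) where
  outside _ _ := rfl
  inside _ h := h.elim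
  net _ h := h.elim

theorem Layout.supernodesAssigned (hL : Layout E X X ∅ 𝓡 out 𝓢 anc S₀ ρ)
    (hl : IsEnumeration 𝓢 l) (h : ForLoop (assignSupernode G) l (fun _ => none) σ) :
    SupernodesAssigned G 𝓢 σ := by
  have := (ForLoop.induct (r := fun A B => A ≠ B)
    (I := fun D σ => D ⊆ 𝓢 ∧ SupernodesAssigned G D σ) hL.supernodesAssigned_loop h
    (fun S hS => (hl.2 S).1 hS) hl.1 (D := ∅) (fun _ h => h.elim)
    ⟨Set.empty_subset _, supernodesAssigned_empty⟩).2
  have heq : ∅ ∪ {a | a ∈ l} = 𝓢 := by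
    ext S
    simp [hl.2 S]
  rwa [heq] at this

theorem Layout.expansionsAssigned (hL : Layout E X X ∅ 𝓡 out 𝓢 anc S₀ ρ) (h𝓡 : ⋃₀ 𝓡 = X)
    (hl : IsEnumeration 𝓢 l) (hp : l.Pairwise fun A B => ¬ anc B A)
    (hI : SupernodesAssigned G 𝓢 σ)
    (h : ForLoop (fun S => assignExpansion G (expansion G out 𝓢 order S) S) l σ σ') :
    ExpansionsAssigned G X out 𝓢 ρ order 𝓢 σ' := by
  have := ForLoop.induct (r := fun A B => A ≠ B ∧ ¬ anc B A)
    (fun D S σ σ' hS hD hI h => hL.expansionsAssigned_step h𝓡 hS hD hI h) h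
    (fun S hS => (hl.2 S).1 hS) (List.Pairwise.and hl.1 hp) (D := ∅) (fun _ h => h.elim)
    (hL.expansionsAssigned_empty hI)
  have heq : ∅ ∪ {a | a ∈ l} = 𝓢 := by
    ext S
    simp [hl.2 S]
  rwa [heq] at this

theorem exists_clusterOuter [Finite V] (hG : G.Connected) (hX : IsRegion G X)
    (h𝓡 : IsRegionSet G X 𝓡) : ∃ 𝓒, ClusterOuter E X 𝓡 𝓒 := by
  have hI := callInv_root (E := E) hG hX h𝓡
  obtain ⟨out, 𝓢, anc, hsel⟩ := exists_selectPaths hG hX hI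
  obtain ⟨S₀, -, ρ, hL⟩ := SelectPaths.exists_layout hG hX hsel hI
  let f : Supernode V → ℕ := fun T => (⋃₀ ρ T).ncard
  -- Sorting by decreasing size of the support puts ancestors first.
  set l := hL.finite.toFinset.toList.mergeSort fun A B => decide (f B ≤ f A) with hl_def
  have hperm : l.Perm hL.finite.toFinset.toList := List.mergeSort_perm _ _
  have hl : IsEnumeration 𝓢 l :=
    ⟨hperm.nodup_iff.2 (Finset.nodup_toList _), fun S => by rw [hperm.mem_iff]; simp⟩
  have hsort : l.Pairwise fun A B => ¬ anc B A := by
    have := List.pairwise_mergeSort (le := fun A B : Supernode V => decide (f B ≤ f A))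
      (fun a b c h h' => by simp only [decide_eq_true_eq] at *; omega)
      (fun a b => by simp only [Bool.or_eq_true, decide_eq_true_eq]; omega)
      hL.finite.toFinset.toList
    refine this.imp fun {A B} h hanc => ?_
    have h1 := (hL.anc_lt B A hanc).2.2
    have h2 : f B ≤ f A := by simpa using h
    exact absurd h1 (not_lt.2 h2)
  obtain ⟨σ₃, h₃⟩ := ForLoop.exists_of_invariant (r := fun A B => A ≠ B)
    (I := fun D σ => D ⊆ 𝓢 ∧ SupernodesAssigned G D σ) hL.supernodesAssigned_loop
    (fun D S σ hS _ => exists_assignSupernode (hL.strip hS) σ)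
    (fun S hS => (hl.2 S).1 hS) hl.1 (D := ∅) (fun _ h => h.elim)
    ⟨Set.empty_subset _, supernodesAssigned_empty⟩
  obtain ⟨σ₄, h₄⟩ := ForLoop.exists_of_invariant (r := fun A B => A ≠ B ∧ ¬ anc B A)
    (body := fun S => assignExpansion G (expansion G out 𝓢 l S) S)
    (fun D S σ σ' hS hD hI h => hL.expansionsAssigned_step h𝓡.2 hS hD hI h)
    (fun D S σ hS hI => exists_assignExpansion (hL.expansion_strip h𝓡.2 hS) (hI.net S hS))
    (fun S hS => (hl.2 S).1 hS) (List.Pairwise.and hl.1 hsort) (D := ∅) (fun _ h => h.elim)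
    (hL.expansionsAssigned_empty (hL.supernodesAssigned hl h₃))
  exact ⟨_, out, 𝓢, anc, l, l, l, σ₃, σ₄, hsel, hl, hl, hl, hsort, h₃, h₄, rfl⟩

/-- What the analysis of `Cluster` uses about the output of `ClusterOuter`. -/
structure Scatters (E : PlaneEmbedding G) (X : Set V) (𝓡 𝓒 : Set (Set V)) : Prop where
  subset : ∀ C ∈ 𝓒, C ⊆ X
  eq_of_mem : ∀ C ∈ 𝓒, ∀ C' ∈ 𝓒, ∀ x ∈ C, x ∈ C' → C = C'
  nonempty : (⋃₀ 𝓒).Nonempty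
  linked_outer : ∀ y ∈ ⋃₀ 𝓒, ∃ w, E.IsOuterVertex X w ∧ Linked G (⋃₀ 𝓒) w y
  outer_subset : ∀ R ∈ 𝓡, (∃ v ∈ R, E.IsOuterVertex X v) → R ⊆ ⋃₀ 𝓒
  route : ∀ R ∈ 𝓡, ∀ x ∈ R, ∀ y ∈ R, Route G (𝓒 ∪ {R \ ⋃₀ 𝓒}) 293 x y

theorem Layout.exists_mem_expansion (hL : Layout E X X ∅ 𝓡 out 𝓢 anc S₀ ρ)
    (hord : ∀ S ∈ 𝓢, S ∈ order) (hT : T ∈ 𝓢) (hA : IsLeaf out 𝓢 A) (hAT : AdjSet G A T.verts) :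
    ∃ S ∈ 𝓢, A ∈ expansion G out 𝓢 order S := by
  obtain ⟨a, ha, b, ⟨Q, hQ, hb⟩, hab⟩ := hAT
  refine RegionClustering.exists_mem_expansion (hord T hT) hT hA.1 hQ (hL.regions_subset T hT hQ)
    ⟨a, ha, b, hb, Or.inr hab⟩ ?_
  rintro rfl
  exact Set.disjoint_left.1 (hA.2 T hT) ha ⟨_, hQ, ha⟩

/-- A vertex of such a region is in a supernode or in a leaf piece next to one, and such a piece
belongs to some expansion, all of which are fully assigned. -/
theorem Layout.ne_none_of_not_leaf (hL : Layout E X X ∅ 𝓡 out 𝓢 anc S₀ ρ)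
    (hσ : ExpansionsAssigned G X out 𝓢 ρ order 𝓢 σ) (hord : ∀ S ∈ 𝓢, S ∈ order) (hR : R ∈ 𝓡)
    (hRl : ¬ IsLeaf out 𝓢 R) (hx : x ∈ R) : σ x ≠ none := by
  have hin : ∀ T ∈ 𝓢, ∀ v ∈ T.verts, σ v ≠ none := fun T hT v hv => by
    obtain ⟨P, -, h, -⟩ := hσ.inside T hT v hv
    simp [h]
  have hleaf : ∀ T ∈ 𝓢, ∀ Q Q', IsLeaf out 𝓢 Q → AdjSet G Q (Q' ∩ T.verts) → ∀ x ∈ Q,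
      σ x ≠ none := fun T hT Q Q' hQ hadj x hx => by
    obtain ⟨S, hS, hQS⟩ := hL.exists_mem_expansion hord hT hQ
      (hadj.mono le_rfl Set.inter_subset_right)
    exact hσ.full S hS x ⟨Q, hQS, hx⟩
  obtain ⟨T, hT, -, -, hs⟩ := (hL.split R hR).resolve_left hRl
  rcases hs x hx with hxT | ⟨Q, -, hxQ, -, (hQ | ⟨T', hT', -, -, hs'⟩), hadj⟩
  · exact hin T hT x hxT
  · exact hleaf T hT Q R hQ hadj x hxQ
  · rcases hs' x hxQ with hxT | ⟨Q', -, hxQ', -, hQ', hadj'⟩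
    · exact hin T' hT' x hxT
    · exact hleaf T' hT' Q' Q hQ' hadj' x hxQ'

theorem ClusterOuter.scatters [Finite V] (hG : G.Connected) (hX : IsRegion G X)
    (h𝓡 : IsRegionSet G X 𝓡) (h : ClusterOuter E X 𝓡 𝓒) : Scatters E X 𝓡 𝓒 := by
  obtain ⟨out, 𝓢, anc, order, l₃, l₄, σ₃, σ, hsel, h₂, h₃, h₄, hp, hσ₃, hσ₄, h𝓒⟩ := h
  obtain ⟨S₀, hS₀, ρ, hL⟩ := SelectPaths.exists_layout hG hX hsel (callInv_root hG hX h𝓡)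
  have hσ := hL.expansionsAssigned h𝓡.2 h₄ hp (hL.supernodesAssigned h₃ hσ₃) hσ₄
  have hmem : ∀ T ∈ 𝓢, ∀ P ∈ T.netPoints, cluster σ P ∈ 𝓒 := fun T hT P hP => by
    rw [h𝓒]
    exact ⟨T, hT, P, hP, rfl⟩
  have hall : ∀ x, x ∈ ⋃₀ 𝓒 ↔ σ x ≠ none := by
    intro x
    constructor
    · rw [h𝓒]
      rintro ⟨C, ⟨S, -, P, -, rfl⟩, hx⟩
      exact Option.ne_none_iff_exists'.2 ⟨P, hx⟩
    · intro hx
      obtain ⟨P, hP⟩ := Option.ne_none_iff_exists'.1 hx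
      by_cases hout : ∀ T ∈ 𝓢, x ∉ T.verts
      · obtain ⟨-, T, hT, -, hPT, -⟩ := hσ.outside x P hP hout
        exact ⟨cluster σ P, hmem T hT P hPT, hP⟩
      · push Not at hout
        obtain ⟨T, hT, hxT⟩ := hout
        obtain ⟨P', hP', hxP', -⟩ := hσ.inside T hT x hxT
        exact ⟨cluster σ P', hmem T hT P' hP', hxP'⟩
  have hverts : ∀ T ∈ 𝓢, T.verts ⊆ ⋃₀ 𝓒 := fun T hT v hv => (hall v).2 (by
    obtain ⟨P, -, h, -⟩ := hσ.inside T hT v hv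
    simp [h])
  refine ⟨?_, ?_, ?_, ?_, ?_, ?_⟩
  · rw [h𝓒]
    rintro C ⟨T, hT, P, hP, rfl⟩ v hv
    by_cases hout : ∀ T ∈ 𝓢, v ∉ T.verts
    · exact (hσ.outside v P hv hout).1
    · push Not at hout
      obtain ⟨T', hT', hvT'⟩ := hout
      exact hL.verts_subset hT' hvT'
  · rw [h𝓒]
    rintro C ⟨-, -, P, -, rfl⟩ C' ⟨-, -, P', -, rfl⟩ x hx hx'
    have : some P = some P' := Eq.trans (Eq.symm hx) hx'
    rw [Option.some_inj.1 this]
  · obtain ⟨y, hy, -⟩ := hL.exists_outer S₀ hS₀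
    exact ⟨y, hverts S₀ hS₀ hy⟩
  -- The cluster of `y` is linked to its net point, which lies in a connected supernode with an
  -- outer vertex.
  · intro y hy
    rw [h𝓒] at hy
    obtain ⟨C, ⟨T, hT, P, hP, rfl⟩, hy⟩ := hy
    obtain ⟨x, hx, hyx⟩ := hσ.linked y P hy
    obtain ⟨w, hw, hwo⟩ := hL.exists_outer T hT
    have hxT : x ∈ T.verts := ⟨P, (hL.strip hT).netPoint_mem hP, hx⟩
    refine ⟨w, hwo, (((hL.verts_isRegion hT).linked hw hxT).mono (hverts T hT)).trans
      (hyx.symm.mono (Set.subset_sUnion_of_mem (hmem T hT P hP)))⟩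
  · rintro R hR ⟨v, hvR, hvo⟩ x hx
    refine (hall x).2 (hL.ne_none_of_not_leaf hσ (fun S hS => (h₂.2 S).2 hS) hR (fun hl => ?_) hx)
    obtain ⟨T, hT, hvT⟩ := hL.cover_outer v (h𝓡.2 ▸ ⟨R, hR, hvR⟩) hvo
    exact Set.disjoint_left.1 (hl.2 T hT) hvR hvT
  · intro R hR x hx y hy
    exact hL.route hσ h𝓡.2 hR (Or.inr rfl) (fun v hv hne => ⟨hv, fun h => (hall v).1 h hne⟩)
      (fun T hT P hP => Or.inl (hmem T hT P hP)) hx hy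

theorem isScatteringConstant : IsScatteringConstant.{u} 293 := by
  intro V _ G E X 𝓡 𝓒 hG hX h𝓡 h R hR a ha b hb
  obtain ⟨Γ, p, h1, h2, h3, h4⟩ := ((h.scatters hG hX h𝓡).route R hR a ha b hb).exists_path
  refine ⟨Γ, p, h1, h2, h3, fun L hL => ?_⟩
  obtain ⟨F, hF | rfl, hLF⟩ := h4 L hL
  exacts [Or.inl ⟨F, hF, hLF⟩, Or.inr hLF]

/-! ### Runs of `Cluster` -/

theorem isRegionSet_component {U : Set V} (h𝓡 : IsRegionSet G X 𝓡) (hU : U ⊆ X)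
    (hK : K ∈ components G U) : IsRegionSet G K (meeting (shatter G 𝓡 U) K) :=
  isRegionSet_meeting h𝓡.2 hU (fun _ hA ⟨_, hx, hxU⟩ => (shatter_split hA).resolve_right fun h =>
    Set.disjoint_left.1 h hx hxU) hK

theorem exists_cluster [Finite V] (hG : G.Connected) (hX : IsRegion G X)
    (h𝓡 : IsRegionSet G X 𝓡) : ∃ 𝓒, Cluster E X 𝓡 𝓒 := by
  induction hn : X.ncard using Nat.strong_induction_on generalizing X 𝓡 with
  | _ n ih =>
  subst hn
  obtain ⟨𝓒s, h⟩ := exists_clusterOuter (E := E) hG hX h𝓡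
  have hs := h.scatters hG hX h𝓡
  have hex : ∀ K, ∃ 𝓒, K ∈ components G (X \ ⋃₀ 𝓒s) →
      Cluster E K (meeting (shatter G 𝓡 (X \ ⋃₀ 𝓒s)) K) 𝓒 := by
    intro K
    by_cases hK : K ∈ components G (X \ ⋃₀ 𝓒s)
    swap
    · exact ⟨∅, fun h => absurd h hK⟩
    have hlt : K.ncard < X.ncard := by
      refine Set.ncard_lt_ncard ⟨fun x hx => (component_subset hK hx).1, fun hXK => ?_⟩
      obtain ⟨x, C, hC, hx⟩ := hs.nonempty
      exact (component_subset hK (hXK (hs.subset C hC hx))).2 ⟨C, hC, hx⟩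
    obtain ⟨𝓒, h𝓒⟩ := ih _ hlt (component_isRegion hK)
      (isRegionSet_component h𝓡 Set.sdiff_subset hK) rfl
    exact ⟨𝓒, fun _ => h𝓒⟩
  choose 𝓒 h𝓒 using hex
  exact ⟨_, .run X 𝓡 𝓒s _ 𝓒 h rfl h𝓒⟩

/-- A walk inside `X` from `a` to `b` meets at most `n` members of `𝓒`. -/
def Hits (G : SimpleGraph V) (X : Set V) (𝓒 : Set (Set V)) (n : ℕ) (a b : V) : Prop :=
  ∃ Γ : G.Walk a b, (∀ x ∈ Γ.support, x ∈ X) ∧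
    {C | C ∈ 𝓒 ∧ ∃ x ∈ Γ.support, x ∈ C}.encard ≤ n

theorem Hits.mono (h : Hits G X 𝓒 n x y) (hnm : n ≤ m) : Hits G X 𝓒 m x y := by
  obtain ⟨Γ, h1, h2⟩ := h
  exact ⟨Γ, h1, h2.trans (by exact_mod_cast hnm)⟩

theorem Hits.lift {𝓒' : Set (Set V)} (h : Hits G K 𝓒' n x y) (hK : K ⊆ X)
    (h𝓒 : ∀ C ∈ 𝓒, ∀ x ∈ C, x ∈ K → C ∈ 𝓒') : Hits G X 𝓒 n x y := by
  obtain ⟨Γ, h1, h2⟩ := h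
  refine ⟨Γ, fun x hx => hK (h1 x hx), (Set.encard_le_encard ?_).trans h2⟩
  rintro C ⟨hC, x, hx, hxC⟩
  exact ⟨h𝓒 C hC x hxC (h1 x hx), x, hx, hxC⟩

theorem Linked.hits (h : Linked G A x y) (hA : A ⊆ X)
    (hP : ∀ C ∈ 𝓒, ∀ z ∈ C, z ∈ A → C = P) : Hits G X 𝓒 1 x y := by
  obtain ⟨Γ, hΓ⟩ := h
  refine ⟨Γ, fun x hx => hA (hΓ x hx), (Set.encard_le_encard (t := {P}) ?_).trans (by simp)⟩
  rintro C ⟨hC, z, hz, hzC⟩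
  exact hP C hC z hzC (hΓ z hz)

theorem encard_meeting_le {V : Type u} {𝓒 : Set (Set V)} {l l₁ l₂ : List V} {n m : ℕ}
    (hl : ∀ x ∈ l, x ∈ l₁ ∨ x ∈ l₂)
    (h₁ : {C | C ∈ 𝓒 ∧ ∃ x ∈ l₁, x ∈ C}.encard ≤ n) (h₂ : {C | C ∈ 𝓒 ∧ ∃ x ∈ l₂, x ∈ C}.encard ≤ m) :
    {C | C ∈ 𝓒 ∧ ∃ x ∈ l, x ∈ C}.encard ≤ (n + m : ℕ) := by
  push_cast
  refine le_trans (Set.encard_le_encard ?_) ((Set.encard_union_le _ _).trans (add_le_add h₁ h₂))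
  rintro C ⟨hC, x, hx, hxC⟩
  exact (hl x hx).imp (fun h => ⟨hC, x, h, hxC⟩) fun h => ⟨hC, x, h, hxC⟩

theorem Route.hits {𝓕 : Set (Set V)} (h : Route G 𝓕 n x y)
    (h𝓕 : ∀ F ∈ 𝓕, ∀ x y, Linked G F x y → Hits G X 𝓒 m x y) : Hits G X 𝓒 (n * m) x y := by
  induction h with
  | single hF h => rw [one_mul]; exact h𝓕 _ hF _ _ h
  | mono _ hnm ih => exact ih.mono (Nat.mul_le_mul_right m hnm)
  | trans_adj _ hbc _ ih ih' =>
    obtain ⟨Γ, h1, h2⟩ := ih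
    obtain ⟨Γ', h1', h2'⟩ := ih'
    have hsup : ∀ x ∈ (Γ.append (.cons hbc Γ')).support, x ∈ Γ.support ∨ x ∈ Γ'.support := by
      intro x hx
      rwa [SimpleGraph.Walk.support_append, SimpleGraph.Walk.support_cons, List.tail_cons,
        List.mem_append] at hx
    rw [add_mul]
    exact ⟨_, fun x hx => (hsup x hx).elim (h1 x) (h1' x), encard_meeting_le hsup h2 h2'⟩
  | trans _ _ ih ih' =>
    obtain ⟨Γ, h1, h2⟩ := ih
    obtain ⟨Γ', h1', h2'⟩ := ih'
    have hsup : ∀ x ∈ (Γ.append Γ').support, x ∈ Γ.support ∨ x ∈ Γ'.support :=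
      fun x hx => SimpleGraph.Walk.mem_support_append_iff .. |>.1 hx
    rw [add_mul]
    exact ⟨_, fun x hx => (hsup x hx).elim (h1 x) (h1' x), encard_meeting_le hsup h2 h2'⟩

/-- Regions with an outer vertex are settled by the outer clusters; the others take two rounds
after the first one that reaches them. -/
theorem Cluster.spec [Finite V] (hG : G.Connected) (h : Cluster E X 𝓡 𝓒) (hX : IsRegion G X)
    (h𝓡 : IsRegionSet G X 𝓡) :
    (∀ C ∈ 𝓒, C ⊆ X) ∧
    (∀ R ∈ 𝓡, (∃ v ∈ R, E.IsOuterVertex X v) → ∀ x ∈ R, ∀ y ∈ R, Hits G X 𝓒 293 x y) ∧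
    ∀ R ∈ 𝓡, ∀ x ∈ R, ∀ y ∈ R, Hits G X 𝓒 (293 ^ 2) x y := by
  induction h with
  | run X 𝓡 𝓒s U 𝓒 houter hU hrec ih =>
  have hs := houter.scatters hG hX h𝓡
  have hUX : U ⊆ X := hU ▸ Set.sdiff_subset
  have ihK := fun K hK => ih K hK (component_isRegion hK) (isRegionSet_component h𝓡 hUX hK)
  have hRX : ∀ R ∈ 𝓡, R ⊆ X := fun R hR => h𝓡.2 ▸ Set.subset_sUnion_of_mem hR
  have hRU : ∀ R ∈ 𝓡, R ∩ U = R \ ⋃₀ 𝓒s := by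
    intro R hR
    rw [hU]
    ext x
    exact ⟨fun h => ⟨h.1, h.2.2⟩, fun h => ⟨h.1, hRX R hR h.1, h.2⟩⟩
  set 𝓒a := 𝓒s ∪ ⋃ K ∈ components G U, 𝓒 K with h𝓒a
  have hmem : ∀ C ∈ 𝓒a, C ∈ 𝓒s ∨ ∃ K ∈ components G U, C ∈ 𝓒 K := by
    intro C hC
    simpa [h𝓒a] using hC
  have hlift : ∀ K ∈ components G U, ∀ C ∈ 𝓒a, ∀ x ∈ C, x ∈ K → C ∈ 𝓒 K := by
    intro K hK C hC x hx hxK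
    rcases hmem C hC with hC | ⟨K', hK', hC⟩
    · have hxU := component_subset hK hxK
      rw [hU] at hxU
      exact absurd ⟨C, hC, hx⟩ hxU.2
    · rwa [component_eq hK hK' hxK ((ihK K' hK').1 C hC hx)]
  have hone : ∀ C ∈ 𝓒s, ∀ x y, Linked G C x y → Hits G X 𝓒a 1 x y := by
    intro C hC x y h
    refine h.hits (P := C) (hs.subset C hC) fun C' hC' z hz hzC => ?_
    rcases hmem C' hC' with h | ⟨K, hK, h⟩
    · exact hs.eq_of_mem C' h C hC z hz hzC
    · have hzU := component_subset hK ((ihK K hK).1 C' h hz)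
      rw [hU] at hzU
      exact absurd ⟨C, hC, hzC⟩ hzU.2
  refine ⟨?_, ?_, ?_⟩
  · intro C hC
    rcases hmem C hC with h | ⟨K, hK, h⟩
    · exact hs.subset C h
    · exact ((ihK K hK).1 C h).trans ((component_subset hK).trans hUX)
  · intro R hR hRo x hx y hy
    refine (Route.hits (m := 1) (hs.route R hR x hx y hy) ?_)
    rintro F (hF | rfl) x y h
    · exact hone F hF x y h
    -- A region with an outer vertex has no unassigned part.
    · exact absurd (hs.outer_subset R hR hRo h.left_mem.1) h.left_mem.2
  · intro R hR x hx y hy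
    have hreg := h𝓡.1 R hR
    by_cases hRs : (R ∩ ⋃₀ 𝓒s).Nonempty
    · rw [sq]
      refine Route.hits (hs.route R hR x hx y hy) ?_
      rintro F (hF | rfl) x y h
      · exact (hone F hF x y h).mono (by omega)
      · obtain ⟨Q, hQ, hxQ⟩ := exists_component (G := G) h.left_mem
        have hyQ := component_linked hQ hxQ h
        have hQreg := component_isRegion hQ
        have hQU : Q ⊆ U := (component_subset hQ).trans
          ((hRU R hR).symm.subset.trans Set.inter_subset_right)
        obtain ⟨K, hK, hQK⟩ := hQreg.exists_component hQU
        have hQm : Q ∈ meeting (shatter G 𝓡 U) K :=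
          ⟨⟨R, hR, Or.inr (by rwa [hRU R hR])⟩, x, hxQ, hQK hxQ⟩
        -- As `R` meets the clusters, each uncovered piece `Q` has a neighbour in one, and that
        -- neighbour is linked to the outer face. So `Q` has an outer vertex in the next round and
        -- falls under the bound 293.
        obtain ⟨q, hq, c, hc, hqc⟩ := hreg.component_diff_exit hQ hRs
        obtain ⟨w, hw, hwc⟩ := hs.linked_outer c hc.2
        have hKU := component_subset hK
        have hout : E.IsOuterVertex K q := E.isOuterVertex_of_adj hG (hKU.trans hUX)
          (Set.disjoint_left.2 fun z hz hzK => by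
            have := hKU hzK
            rw [hU] at this
            exact this.2 hz) hw hwc (hQK hq) hqc.symm
        exact ((ihK K hK).2.1 Q hQm ⟨q, hq, hout⟩ x hxQ y hyQ).lift (hKU.trans hUX) (hlift K hK)
    -- An untouched region is passed on whole to one component, at no cost.
    · have hRsub : R ⊆ U := by
        rw [hU]
        exact fun z hz => ⟨hRX R hR hz, fun h => hRs ⟨z, hz, h⟩⟩
      obtain ⟨K, hK, hRK⟩ := hreg.exists_component hRsub
      exact ((ihK K hK).2.2 R ⟨mem_shatter_of_subset hR hreg hRsub, x, hx, hRK hx⟩ x hx y hy).lift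
        ((component_subset hK).trans hUX) (hlift K hK)

end Outer

end RegionClustering

theorem mainTheorem4 :
    ∃ β : ℕ, β ≤ 3744 ∧ RegionClustering.IsScatteringConstant.{u} β ∧
      ∀ (V : Type u) [Finite V] (G : SimpleGraph V) (E : RegionClustering.PlaneEmbedding G)
        (𝓡 : Set (Set V)),
        G.Connected → RegionClustering.IsRegionSet G Set.univ 𝓡 →
        (∃ 𝓒 : Set (Set V), RegionClustering.Cluster E Set.univ 𝓡 𝓒) ∧
        ∀ 𝓒 : Set (Set V), RegionClustering.Cluster E Set.univ 𝓡 𝓒 →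
          ∀ R ∈ 𝓡, ∀ s ∈ R, ∀ t ∈ R, ∃ Γ : G.Walk s t, Γ.IsPath ∧
            {C | C ∈ 𝓒 ∧ ∃ x ∈ Γ.support, x ∈ C}.encard ≤ ((β ^ 2 : ℕ) : ℕ∞) := by
  refine ⟨293, by norm_num, RegionClustering.isScatteringConstant, fun V _ G E 𝓡 hG h𝓡 => ?_⟩
  have hX := RegionClustering.isRegion_univ hG
  refine ⟨RegionClustering.exists_cluster hG hX h𝓡, fun 𝓒 h𝓒 R hR s hs t ht => ?_⟩
  classical
  obtain ⟨Γ, -, hΓ⟩ := (h𝓒.spec hG hX h𝓡).2.2 R hR s hs t ht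
  refine ⟨Γ.bypass, Γ.bypass_isPath, (Set.encard_le_encard ?_).trans hΓ⟩
  rintro C ⟨hC, x, hx, hxC⟩
  exact ⟨hC, x, Γ.support_bypass_subset_support hx, hxC⟩
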